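/- Setting. Let $\mathbb S,\mathbb A$ be finite nonempty sets and let $(\mathbb S,\mathbb A,P,c,\gamma)$ be a discounted Markov decision process with costs $c(s,a)\in[0,1]$ and discount factor $\gamma\in(0,1)$. Let $h:\Delta_{\mathbb A}\to[0,\bar h]$ be a continuous convex regularizer on the simplex of probability vectors on $\mathbb A$. For a policy $\pi:\mathbb S\to\Delta_{\mathbb A}$ let $V^\pi(s)=\mathbb E\big[\sum_{t\ge0}\gamma^t(c(s_t,a_t)+h(\pi(\cdot|s_t)))\mid s_0=s\big]$, where $a_t\sim\pi(\cdot|s_t)$, $s_{t+1}\sim P(\cdot|s_t,a_t)$. Let $V^*$ be the fixed point of $(\Gamma V)(s)=\min_{p\in\Delta_{\mathbb A}}[\langle c(s,\cdot)+\gamma P_sV,p\rangle+h(p)]$, where $(P_sV)(a)=\sum_{s'}P(s'|s,a)V(s')$; a policy $\pi$ is $\epsilon$-optimal if $\|V^\pi-V^*\|_\infty\le\epsilon$, and $\pi^*$ is optimal if $V^{\pi^*}\le V^\pi$ for all policies $\pi$. Let $\omega$ be a distance generating function on $\Delta_{\mathbb A}$: it is continuous and convex, and on the set $X^\circ$ of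 the points of $\Delta_{\mathbb A}$ where it is subdifferentiable it is continuously differentiable and $1$-strongly convex with respect to the $\ell_1$-norm. Let $D(x,y)=\omega(y)-\omega(x)-\langle\nabla\omega(x),y-x\rangle$ be its Bregman divergence. Assume that $h$ is $\mu$-strongly convex relative to $D$ for some $\mu>0$, that is, $h(y)-h(x)-\langle h'(x),y-x\rangle\ge\mu D(x,y)$ for all $x\in X^\circ$, all subgradients $h'(x)$ of $h$ at $x$, and all $y\in\Delta_{\mathbb A}$, and that $D(\mathbf 1_{\mathbb A}/|\mathbb A|,y)\le D_0$ for all $y\in\Delta_{\mathbb A}$. Algorithm (stochastic value mirror descent). Start from the uniform policy $\hat\pi_0$. For $k=0,\dots,K-1$: set $\pi_0=\hat\pi_k$; for every $(s,a)$ draw $m_{k,1}$ independent transitions from $P(\cdot|s,a)$ and let $\tilde P^0$ be the empirical kernel. If $k=0$ let $V_0\equiv(1+\bar h)/(1-\gamma)$; otherwise let $V_0$ solve $V_0(s)=\langle c(s,\cdot)+\gamma\tilde P^0_sV_0,\pi_0(\cdot|s)\rangle+h(\pi_0(\cdot|s))$. For $t=0,\dots,T-1$: if $t=0$ let $G=\tilde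 P^0V_0$; if $t>0$ draw $m_{k,2}$ fresh independent transitions for every $(s,a)$, with empirical kernel $\hat P^t$, and let $G=\tilde P^0V_0+\hat P^t(V_t-V_0)$. For all $s$ let $$\pi_{t+1}(\cdot|s)=\operatorname*{argmin}_{p\in\Delta_{\mathbb A}}\big\{\eta_{k,t}[\langle c(s,\cdot)+\gamma G(s,\cdot),p\rangle+h(p)]+D(\pi_t(\cdot|s),p)\big\},$$ $$V_{t+1}(s)=\min\{\langle c(s,\cdot)+\gamma G(s,\cdot),\pi_{t+1}(\cdot|s)\rangle+h(\pi_{t+1}(\cdot|s)),\,V_t(s)\}.$$ Then set $\hat\pi_{k+1}=\pi_T$. The output is $\hat\pi_K$. Each drawn transition counts as one observation. Theorem. Let $\epsilon>0$, $\delta\in(0,1)$, $u_k=2^{-k}\max\{\frac{1+\bar h}{1-\gamma},\mu D_0\}$, $K=\max\{0,\lceil\log_2(u_0/\epsilon)\rceil\}$, $T=\lceil 18/(1-\gamma)\rceil$, $\eta_{k,t}=\frac{2}{\mu(t+1)}$, and for all $k<K$ let the integers $m_{k,1},m_{k,2}$ satisfy $$m_{k,1}\ge200\max\Big\{\tfrac{64(1+\bar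 h)^2}{\mu}(1-\gamma)^{-5}u_k^{-1}(\ln T+1),1\Big\}\ln(24K|\mathbb S||\mathbb A|\delta^{-1}),$$ $$m_{k,2}\ge\Big[\tfrac{400(1+\bar h+\mu D_0)}{\mu}(\ln T+1)+16\Big](1-\gamma)^{-4}\ln[4K(T-1)|\mathbb S||\mathbb A|\delta^{-1}].$$ Then, with probability at least $1-\delta$, the output $\hat\pi_K$ is an $\epsilon$-optimal policy and $D(\hat\pi_K(\cdot|s),\pi^*(\cdot|s))\le\frac{\epsilon}{\mu(1-\gamma)}$ for every state $s$ and every optimal policy $\pi^*$. Moreover, if $\epsilon\le1$ and $m_{k,1},m_{k,2}$ are the smallest nonnegative integers allowed above, then the total number of observations, $|\mathbb S||\mathbb A|\sum_{k=0}^{K-1}[m_{k,1}+(T-1)m_{k,2}]$, is $\tilde{\mathcal O}(|\mathbb S||\mathbb A|(1-\gamma)^{-5}\epsilon^{-1})$: with a universal constant $C$ it is at most $$C\Big(\tfrac{(1+\bar h)^2}{\mu}+D_0+1\Big)\,|\mathbb S||\mathbb A|(1-\gamma)^{-5}\epsilon^{-1}\Big(1+\ln\tfrac{(1+\bar h+\mu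 D_0)|\mathbb S||\mathbb A|}{(1-\gamma)\epsilon\delta}\Big)^3.$$ -/

import Mathlib

noncomputable section

/-- A finite discounted Markov decision process: transition kernel `P s a s'` (probability of
moving to `s'` when `a` is taken in `s`), cost `c s a` in `[0, 1]`, discount factor in `(0, 1)`. -/
structure DMDP (S A : Type*) [Fintype S] where
  P : S → A → S → ℝ
  c : S → A → ℝ
  γ : ℝ
  P_mem : ∀ s a, P s a ∈ stdSimplex ℝ S
  c_mem : ∀ s a, c s a ∈ Set.Icc (0 : ℝ) 1
  γ_mem : γ ∈ Set.Ioo (0 : ℝ) 1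

/-- A continuous convex regularizer `h : Δ_A → [0, hbar]` (values off the simplex are never used). -/
structure Regularizer (A : Type*) [Fintype A] where
  h : (A → ℝ) → ℝ
  hbar : ℝ
  mapsTo : Set.MapsTo h (stdSimplex ℝ A) (Set.Icc 0 hbar)
  cont : ContinuousOn h (stdSimplex ℝ A)
  convex : ConvexOn ℝ (stdSimplex ℝ A) h

/-- `g` is a subgradient at `x` of the convex function `f` on the simplex. -/
def IsSubgradient {A : Type*} [Fintype A] (f : (A → ℝ) → ℝ) (x g : A → ℝ) : Prop :=
  ∀ y ∈ stdSimplex ℝ A, f x + ∑ a, g a * (y a - x a) ≤ f y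

/-- The points of the simplex at which `f` is subdifferentiable.  It is the whole simplex if `f` is
differentiable there, and the set of positive vectors for the negative entropy. -/
def subdiffDomain {A : Type*} [Fintype A] (f : (A → ℝ) → ℝ) : Set (A → ℝ) :=
  {x | x ∈ stdSimplex ℝ A ∧ ∃ g, IsSubgradient f x g}

/-- A distance generating function on the simplex: continuous, convex, continuously differentiable
with gradient `grad` where it is subdifferentiable, and `1`-strongly convex for the `ℓ₁`-norm. -/
structure DistGen (A : Type*) [Fintype A] where
  w : (A → ℝ) → ℝ
  grad : (A → ℝ) → A → ℝ
  cont : ContinuousOn w (stdSimplex ℝ A)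
  convex : ConvexOn ℝ (stdSimplex ℝ A) w
  hasDeriv : ∀ x ∈ subdiffDomain w,
    HasFDerivWithinAt w (∑ a, grad x a • (ContinuousLinearMap.proj a : (A → ℝ) →L[ℝ] ℝ))
      (subdiffDomain w) x
  cont_grad : ContinuousOn grad (subdiffDomain w)
  strong : ∀ x ∈ subdiffDomain w, ∀ y ∈ stdSimplex ℝ A,
    w x + ∑ a, grad x a * (y a - x a) + (∑ a, |y a - x a|) ^ 2 / 2 ≤ w y

/-- The Bregman divergence `D(x, y) = w y - w x - ⟨∇w x, y - x⟩`. -/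
def DistGen.breg {A : Type*} [Fintype A] (d : DistGen A) (x y : A → ℝ) : ℝ :=
  d.w y - d.w x - ∑ a, d.grad x a * (y a - x a)

/-- The regularizer is `μ`-strongly convex relative to the Bregman divergence of `d`. -/
def Regularizer.StronglyConvex {A : Type*} [Fintype A] (R : Regularizer A) (d : DistGen A)
    (μ : ℝ) : Prop :=
  0 < μ ∧ ∀ x ∈ subdiffDomain d.w, ∀ g, IsSubgradient R.h x g → ∀ y ∈ stdSimplex ℝ A,
    μ * d.breg x y ≤ R.h y - (R.h x + ∑ a, g a * (y a - x a))

/-- Stationary randomized policies; `p s a` is the probability of action `a` in state `s`. -/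
def IsPolicy {S A : Type*} [Fintype A] (p : S → A → ℝ) : Prop :=
  ∀ s, p s ∈ stdSimplex ℝ A

/-- The uniform distribution. -/
def uniformDist (A : Type*) [Fintype A] : A → ℝ := fun _ => 1 / (Fintype.card A : ℝ)

/-- State transition matrix induced by the policy `p` and a kernel `P`. -/
def kernelMatrix {S A : Type*} [Fintype A] (P : S → A → S → ℝ) (p : S → A → ℝ) : Matrix S S ℝ :=
  Matrix.of fun s s' => ∑ a, p s a * P s a s'

/-- Expected one-step regularized cost `c_p(s) + h(p(·|s))`. -/
def stageCost {S A : Type*} [Fintype S] [Fintype A] (M : DMDP S A) (R : Regularizer A)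
    (p : S → A → ℝ) (s : S) : ℝ :=
  ∑ a, p s a * M.c s a + R.h (p s)

/-- The value of `p`: the expected discounted cumulative regularized cost
`∑ t, γ ^ t * E[c(s_t, a_t) + h(p(·|s_t))]` of the chain started at `s_0 = s`; the law of `s_t` is
row `s` of the `t`-th power of the transition matrix and `a_t` is drawn from `p(·|s_t)`. -/
def policyValue {S A : Type*} [Fintype S] [DecidableEq S] [Fintype A] (M : DMDP S A)
    (R : Regularizer A) (p : S → A → ℝ) (s : S) : ℝ :=
  ∑' t : ℕ, M.γ ^ t * ∑ s', (kernelMatrix M.P p ^ t) s s' * stageCost M R p s'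

/-- The (regularized) Bellman operator: a minimum over the simplex in every state. -/
def bellman {S A : Type*} [Fintype S] [Fintype A] (M : DMDP S A) (R : Regularizer A)
    (V : S → ℝ) (s : S) : ℝ :=
  sInf ((fun x : A → ℝ => ∑ a, x a * (M.c s a + M.γ * ∑ s', M.P s a s' * V s') + R.h x) ''
    stdSimplex ℝ A)

/-- `p` is an `ε`-optimal policy: its value is within `ε`, in the sup norm, of the fixed point
`Vstar` of the Bellman operator. -/
def IsEpsOptimal {S A : Type*} [Fintype S] [DecidableEq S] [Fintype A] (M : DMDP S A)
    (R : Regularizer A) (ε : ℝ) (p : S → A → ℝ) : Prop :=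
  IsPolicy p ∧ ∃ Vstar : S → ℝ, bellman M R Vstar = Vstar ∧
    ∀ s, |policyValue M R p s - Vstar s| ≤ ε

/-- `p` is an optimal policy: its value is minimal among all policies in every state. -/
def IsOptimalPolicy {S A : Type*} [Fintype S] [DecidableEq S] [Fintype A] (M : DMDP S A)
    (R : Regularizer A) (p : S → A → ℝ) : Prop :=
  IsPolicy p ∧ ∀ p', IsPolicy p' → ∀ s, policyValue M R p s ≤ policyValue M R p' s

/-- Objective of the prox-mapping: `η (⟨q, x⟩ + h x) + D(x₀, x)`. -/
def proxObjective {A : Type*} [Fintype A] (R : Regularizer A) (d : DistGen A) (η : ℝ)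
    (q x₀ x : A → ℝ) : ℝ :=
  η * (∑ a, q a * x a + R.h x) + d.breg x₀ x

/-- The prox-mapping: the minimizer of `proxObjective` over the simplex. -/
def proxStep {A : Type*} [Fintype A] (R : Regularizer A) (d : DistGen A) (η : ℝ)
    (q x₀ : A → ℝ) : A → ℝ :=
  Classical.epsilon fun x =>
    x ∈ stdSimplex ℝ A ∧ IsMinOn (proxObjective R d η q x₀) (stdSimplex ℝ A) x

/-- The minimizer exists, so `proxStep` is one. -/
theorem proxStep_spec {A : Type*} [Fintype A] [Nonempty A] (R : Regularizer A) (d : DistGen A)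
    (η : ℝ) (q x₀ : A → ℝ) :
    proxStep R d η q x₀ ∈ stdSimplex ℝ A ∧
      IsMinOn (proxObjective R d η q x₀) (stdSimplex ℝ A) (proxStep R d η q x₀) := by
  classical
  have hc : ContinuousOn (proxObjective R d η q x₀) (stdSimplex ℝ A) := by
    unfold proxObjective DistGen.breg
    have h1 := R.cont
    have h2 := d.cont
    fun_prop
  obtain ⟨i⟩ := ‹Nonempty A›
  exact Classical.epsilon_spec (p := fun x =>
    x ∈ stdSimplex ℝ A ∧ IsMinOn (proxObjective R d η q x₀) (stdSimplex ℝ A) x)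
    ((isCompact_stdSimplex ℝ A).exists_isMinOn ⟨_, single_mem_stdSimplex ℝ i⟩ hc)

/-- Numbers of observations per state-action pair: `m1 k` in iteration `0` of epoch `k`, and
`m2 k` in each later iteration. -/
def batch (m1 m2 : ℕ → ℕ) (k t : ℕ) : ℕ := if t = 0 then m1 k else m2 k

/-- Total number of observations of state transitions in `K` epochs of `T` iterations. -/
def numObservations (S A : Type*) [Fintype S] [Fintype A] (K T : ℕ) (m1 m2 : ℕ → ℕ) : ℕ :=
  ∑ k ∈ Finset.range K, ∑ t ∈ Finset.range T, ∑ _s : S, ∑ _a : A, batch m1 m2 k t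

/-- Empirical kernel built from the first `m` observed successors `x s a 0, …, x s a (m - 1)`. -/
def empirical {S A : Type*} [DecidableEq S] (m : ℕ) (x : S → A → ℕ → S) : S → A → S → ℝ :=
  fun s a s' => (1 / (m : ℝ)) * ∑ i ∈ Finset.range m, if x s a i = s' then 1 else 0

/-- One epoch of stochastic value mirror descent started from the policy `p₀` and the value `V₀`,
with estimated kernels `Q 0, Q 1, …` and stepsizes `η`; returns the pair `(p_t, V_t)`. -/
def svmdEpoch {S A : Type*} [Fintype S] [Fintype A] (M : DMDP S A) (R : Regularizer A)
    (d : DistGen A) (η : ℕ → ℝ) (Q : ℕ → S → A → S → ℝ) (p₀ : S → A → ℝ) (V₀ : S → ℝ) :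
    ℕ → (S → A → ℝ) × (S → ℝ)
  | 0 => (p₀, V₀)
  | t + 1 =>
    let p := (svmdEpoch M R d η Q p₀ V₀ t).1
    let V := (svmdEpoch M R d η Q p₀ V₀ t).2
    let PV : S → A → ℝ := fun s a =>
      if t = 0 then ∑ s', Q 0 s a s' * V₀ s'
      else ∑ s', Q 0 s a s' * V₀ s' + ∑ s', Q t s a s' * (V s' - V₀ s')
    let q : S → A → ℝ := fun s a => M.c s a + M.γ * PV s a
    let p' : S → A → ℝ := fun s => proxStep R d (η t) (q s) (p s)
    (p', fun s => min (∑ a, q s a * p' s a + R.h (p' s)) (V s))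

/-- Initial value of epoch `k`: the constant `(1 + hbar) / (1 - γ)` for `k = 0`, and otherwise the
solution of `V = ⟨c + γ Q V, p⟩ + h(p)` for the estimated kernel `Q`. -/
def svmdInit {S A : Type*} [Fintype S] [DecidableEq S] [Fintype A] (M : DMDP S A)
    (R : Regularizer A) (k : ℕ) (Q : S → A → S → ℝ) (p : S → A → ℝ) : S → ℝ :=
  if k = 0 then fun _ => (1 + R.hbar) / (1 - M.γ)
  else ((1 : Matrix S S ℝ) - M.γ • kernelMatrix Q p)⁻¹.mulVec (stageCost M R p)

/-- The policy after `k` epochs of `T` iterations; `x k t s a i` is the `i`-th transition observed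
from `(s, a)` in iteration `t` of epoch `k`. -/
def svmdPolicy {S A : Type*} [Fintype S] [DecidableEq S] [Fintype A] (M : DMDP S A)
    (R : Regularizer A) (d : DistGen A) (T : ℕ) (η : ℕ → ℕ → ℝ) (m1 m2 : ℕ → ℕ)
    (x : ℕ → ℕ → S → A → ℕ → S) : ℕ → S → A → ℝ
  | 0 => fun _ => uniformDist A
  | k + 1 =>
    let p := svmdPolicy M R d T η m1 m2 x k
    let Q : ℕ → S → A → S → ℝ := fun t => empirical (batch m1 m2 k t) (x k t)
    (svmdEpoch M R d (η k) Q p (svmdInit M R k (Q 0) p) T).1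

/-- `u_k = 2⁻ᵏ max {(1 + hbar) / (1 - γ), μ D0}`. -/
def uSeq (γ hbar μ D0 : ℝ) (k : ℕ) : ℝ := 1 / 2 ^ k * max ((1 + hbar) / (1 - γ)) (μ * D0)

/-- Number of epochs. -/
def numEpochs (γ hbar μ D0 ε : ℝ) : ℕ := ⌈Real.logb 2 (uSeq γ hbar μ D0 0 / ε)⌉₊

/-- Number of iterations per epoch. -/
def numIters (γ : ℝ) : ℕ := ⌈18 / (1 - γ)⌉₊

/-- Lower bound required of `m_{k,1}`, for `nS` states and `nA` actions. -/
def mOne (nS nA : ℕ) (γ hbar μ D0 ε δ : ℝ) (k : ℕ) : ℝ :=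
  200 * max (64 * (1 + hbar) ^ 2 / μ * ((1 - γ) ^ 5)⁻¹ * (uSeq γ hbar μ D0 k)⁻¹ *
      (Real.log (numIters γ) + 1)) 1 *
    Real.log (24 * numEpochs γ hbar μ D0 ε * nS * nA * δ⁻¹)

/-- Lower bound required of `m_{k,2}`, for `nS` states and `nA` actions. -/
def mTwo (nS nA : ℕ) (γ hbar μ D0 ε δ : ℝ) : ℝ :=
  (400 * (1 + hbar + μ * D0) / μ * (Real.log (numIters γ) + 1) + 16) * ((1 - γ) ^ 4)⁻¹ *
    Real.log (4 * numEpochs γ hbar μ D0 ε * ((numIters γ : ℝ) - 1) * nS * nA * δ⁻¹)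

end

/-!
Write `G = (1 - γ)⁻¹`, let `V*` be the optimal value and `π*` the optimal policy, `P̃` the empirical
kernel of iteration `0` of an epoch, and `V₀`, `π₀` the value and the policy the epoch starts from.

**One epoch as mirror descent with small noise.** In an epoch the algorithm evaluates
`c + γ (P̃ V₀ + P̂ᵗ (V_t - V₀))`. This is `c' + γ P V_t` plus the noise `γ (P̂ᵗ - P) (V_t - V₀)`, where
`c' = c + γ (P̃ - P) V₀`: up to noise proportional to the range of `V₀ - V_t`, which is small because
`V_t` is nonincreasing and stays close to `V*`, an epoch is value mirror descent in the decision
process with the true kernel and the costs `c'` (`perturbedCost`, `IsNoisyEpoch`,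
`isNoisyEpoch_svmdEpoch`). Optimality of the prox step gives a three-point inequality
(`proxStep_optimality`); weighted by `t + 2`, it telescopes for the stepsizes `2 / (μ (t + 1))` and
bounds both `V_T` and the Bregman divergence of the last policy (`IsNoisyEpoch.final_bounds`).

**Costs perturbed by `e` matter only to second order.** Let `e = c' - c` be uniformly small, and let
`W` be the value of `π*` for the costs `c'`. Then the Bellman residual of `π` at `W` for the costs
`c'` is the suboptimality gap of `π` for the true costs plus `⟨g, π - π*⟩`, where
`g = e + γ P (W - V*)` is at most `G ‖e‖`. Strong convexity of `h` makes the gap at least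
`(μ / 2) ‖π - π*‖₁²`, which absorbs the extra term up to `O(G² ‖e‖² / μ)`
(`IsBellmanPair.residual_bounds`). Hence a suboptimality of order `u` tolerates an error `e` of
order `√u`, which is the reason for the rate `ε⁻¹` in place of `ε⁻²`. Together with the telescoped
prox inequalities this shows that each epoch halves the bound `u_k` on the suboptimality and on
`μ D(π, π*)` (`IsNoisyEpoch.halving`, `GoodSamples.halving`).

**Decoupling.** From the second epoch on, `V₀` depends on the samples of `P̃`, so Hoeffding's
inequality does not apply to `(P̃ - P) V₀` at `(s, a)`. Replacing the row `(s, a)` of `P̃` by the true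
one gives a value independent of that row's samples, and the rank-one update formula bounds
the original error by twice the decoupled one (`leaveOneOutValue`,
`abs_kernelError_le_leaveOneOut`).

**Probability and counting.** Hoeffding's inequality for functions of finitely many independent
samples (`measure_lt_abs_mean_sub_le_of_dependsOn`) and a union bound over epochs, iterations and
state-action pairs make all these errors small simultaneously with probability `1 - δ`
(`one_sub_le_measure_goodSamples`). The sample sizes sum to the stated count because
`∑ 1 / u_k ≤ 2 / ε` (`numObservations_le`).
-/

noncomputable section

/-! ### Subgradients on the simplex -/

/-- A real inequality that holds up to a multiple of `ε` for all `ε ∈ (0, 1)` holds exactly. -/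
theorem le_of_forall_le_add_mul {a b c : ℝ} (h : ∀ ε ∈ Set.Ioo (0 : ℝ) 1, a ≤ b + ε * c) :
    a ≤ b := by
  have ht : Filter.Tendsto (fun ε : ℝ => b + ε * c) (nhdsWithin 0 (Set.Ioi 0)) (nhds b) := by
    have : Filter.Tendsto (fun ε : ℝ => b + ε * c) (nhds 0) (nhds (b + 0 * c)) :=
      Continuous.tendsto (by fun_prop) 0
    simpa using this.mono_left nhdsWithin_le_nhds
  refine ge_of_tendsto ht ?_
  filter_upwards [Ioo_mem_nhdsGT (show (0 : ℝ) < 1 by norm_num)] with ε hε using h ε hε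

section Simplex

variable {A : Type*} [Fintype A]

theorem uniformDist_mem [Nonempty A] : uniformDist A ∈ stdSimplex ℝ A := by
  refine ⟨fun a => by unfold uniformDist; positivity, ?_⟩
  simp [uniformDist]

theorem uniformDist_pos [Nonempty A] (a : A) : 0 < uniformDist A a := by
  unfold uniformDist
  have : 0 < Fintype.card A := Fintype.card_pos
  positivity

theorem Regularizer.hbar_nonneg [Nonempty A] (R : Regularizer A) : 0 ≤ R.hbar := by
  have := R.mapsTo (uniformDist_mem (A := A))
  exact this.1.trans this.2

/-- The strict epigraph of the `1`-homogeneous extension `y ↦ (∑ y) f (y / ∑ y)` of a function `f`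
on the simplex to the open positive orthant.  Unlike the epigraph of `f` it has interior points. -/
def perspectiveEpigraph (f : (A → ℝ) → ℝ) : Set ((A → ℝ) × ℝ) :=
  {z | (∀ a, 0 < z.1 a) ∧ (∑ a, z.1 a) * f ((∑ a, z.1 a)⁻¹ • z.1) < z.2}

theorem normalize_mem [Nonempty A] {y : A → ℝ} (hy : ∀ a, 0 < y a) :
    (∑ a, y a)⁻¹ • y ∈ stdSimplex ℝ A := by
  have hs : 0 < ∑ a, y a := Finset.sum_pos (fun a _ => hy a) Finset.univ_nonempty
  refine ⟨fun a => ?_, ?_⟩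
  · have := hy a
    simp only [Pi.smul_apply, smul_eq_mul]
    positivity
  · simp only [Pi.smul_apply, smul_eq_mul, ← Finset.mul_sum]
    exact inv_mul_cancel₀ hs.ne'

theorem isOpen_perspectiveEpigraph [Nonempty A] {f : (A → ℝ) → ℝ}
    (hf : ContinuousOn f (stdSimplex ℝ A)) : IsOpen (perspectiveEpigraph f) := by
  have hO : IsOpen {z : (A → ℝ) × ℝ | ∀ a, 0 < z.1 a} := by
    simp only [Set.ofPred_forall]
    exact isOpen_iInter_of_finite fun a => isOpen_lt continuous_const (by fun_prop)
  have hpos : ∀ z : (A → ℝ) × ℝ, (∀ a, 0 < z.1 a) → ∑ a, z.1 a ≠ 0 := fun z hz =>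
    (Finset.sum_pos (fun a _ => hz a) Finset.univ_nonempty).ne'
  have hs : Continuous fun z : (A → ℝ) × ℝ => ∑ a, z.1 a := by fun_prop
  have hc : ContinuousOn (fun z : (A → ℝ) × ℝ =>
      (∑ a, z.1 a) * f ((∑ a, z.1 a)⁻¹ • z.1) - z.2) {z | ∀ a, 0 < z.1 a} := by
    refine ContinuousOn.sub (hs.continuousOn.mul (hf.comp ?_ fun z hz => normalize_mem hz))
      continuous_snd.continuousOn
    exact (hs.continuousOn.inv₀ fun z hz => hpos z hz).smul continuous_fst.continuousOn
  have := hc.isOpen_inter_preimage hO (isOpen_Iio (a := (0 : ℝ)))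
  convert this using 1
  ext z
  simp [perspectiveEpigraph]

theorem convex_perspectiveEpigraph [Nonempty A] {f : (A → ℝ) → ℝ}
    (hf : ConvexOn ℝ (stdSimplex ℝ A) f) : Convex ℝ (perspectiveEpigraph f) := by
  rintro ⟨y, r⟩ ⟨hy, hyr⟩ ⟨y', r'⟩ ⟨hy', hyr'⟩ a b ha hb hab
  dsimp only at hy hyr hy' hyr'
  have hpos : ∀ i, 0 < a * y i + b * y' i := by
    intro i
    rcases ha.eq_or_lt with h | h
    · have : b = 1 := by linarith
      simpa [← h, this] using hy' i
    · have := mul_pos h (hy i)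
      have := mul_nonneg hb (hy' i).le
      linarith
  refine ⟨fun i => by simpa using hpos i, ?_⟩
  have hs : 0 < ∑ i, y i := Finset.sum_pos (fun i _ => hy i) Finset.univ_nonempty
  have hs' : 0 < ∑ i, y' i := Finset.sum_pos (fun i _ => hy' i) Finset.univ_nonempty
  have hm : ∑ i, (a • (y, r) + b • (y', r')).1 i = a * ∑ i, y i + b * ∑ i, y' i := by
    simp [Finset.sum_add_distrib, Finset.mul_sum]
  rw [hm]
  have hp := normalize_mem hy
  have hp' := normalize_mem hy'
  set σ := ∑ i, y i
  set σ' := ∑ i, y' i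
  have hM : 0 < a * σ + b * σ' := by
    rcases ha.eq_or_lt with h | h
    · have : b = 1 := by linarith
      simpa [← h, this] using hs'
    · have := mul_pos h hs
      have := mul_nonneg hb hs'.le
      linarith
  set m := a * σ + b * σ' with hmdef
  have hcomb : m⁻¹ • (a • (y, r) + b • (y', r')).1 =
      (a * σ / m) • (σ⁻¹ • y) + (b * σ' / m) • (σ'⁻¹ • y') := by
    ext i
    simp only [Prod.fst_add, Prod.smul_fst, Pi.smul_apply, Pi.add_apply, smul_eq_mul]
    field_simp
  have hle := hf.2 hp hp' (show 0 ≤ a * σ / m by positivity) (show 0 ≤ b * σ' / m by positivity)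
    (by rw [← add_div]; exact div_self hM.ne')
  rw [hcomb]
  simp only [smul_eq_mul] at hle
  have h1 : m * f ((a * σ / m) • (σ⁻¹ • y) + (b * σ' / m) • (σ'⁻¹ • y')) ≤
      a * (σ * f (σ⁻¹ • y)) + b * (σ' * f (σ'⁻¹ • y')) := by
    calc _ ≤ m * (a * σ / m * f (σ⁻¹ • y) + b * σ' / m * f (σ'⁻¹ • y')) :=
          mul_le_mul_of_nonneg_left hle hM.le
      _ = _ := by field_simp
  refine h1.trans_lt ?_
  simp only [Prod.snd_add, Prod.smul_snd, smul_eq_mul]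
  rcases ha.eq_or_lt with h | h
  · have : b = 1 := by linarith
    simpa [← h, this] using hyr'
  · have h2 := mul_lt_mul_of_pos_left hyr h
    have h3 := mul_le_mul_of_nonneg_left hyr'.le hb
    linarith

theorem mix_uniform_mem [Nonempty A] {x : A → ℝ} (hx : x ∈ stdSimplex ℝ A) {ε : ℝ}
    (h0 : 0 < ε) (h1 : ε < 1) :
    (1 - ε) • x + ε • uniformDist A ∈ stdSimplex ℝ A ∧
      ∀ a, 0 < ((1 - ε) • x + ε • uniformDist A) a := by
  refine ⟨convex_stdSimplex ℝ A hx uniformDist_mem (by linarith) h0.le (by ring), fun a => ?_⟩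
  have := mul_pos h0 (uniformDist_pos a)
  have := mul_nonneg (sub_nonneg.2 h1.le) (hx.1 a)
  simp only [Pi.add_apply, Pi.smul_apply, smul_eq_mul]
  linarith

theorem tendsto_mix_uniform [Nonempty A] {f : (A → ℝ) → ℝ}
    (hf : ContinuousOn f (stdSimplex ℝ A)) {x : A → ℝ} (hx : x ∈ stdSimplex ℝ A) :
    Filter.Tendsto (fun ε : ℝ => f ((1 - ε) • x + ε • uniformDist A))
      (nhdsWithin 0 (Set.Ioo 0 1)) (nhds (f x)) := by
  refine (hf x hx).tendsto.comp (tendsto_nhdsWithin_iff.2 ⟨?_, ?_⟩)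
  · have : Filter.Tendsto (fun ε : ℝ => (1 - ε) • x + ε • uniformDist A) (nhds 0)
        (nhds ((1 - (0 : ℝ)) • x + (0 : ℝ) • uniformDist A)) :=
      Continuous.tendsto (by fun_prop) 0
    simpa using this.mono_left nhdsWithin_le_nhds
  · filter_upwards [self_mem_nhdsWithin] with ε hε using (mix_uniform_mem hx hε.1 hε.2).1

/-- Sandwich theorem: between a concave function `g` on a part `B` of the simplex that meets the
relative interior and a convex function `f ≥ g` on the simplex there is an affine function. -/
theorem exists_affine_between [Nonempty A] {f g : (A → ℝ) → ℝ} {B : Set (A → ℝ)}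
    (hf : ContinuousOn f (stdSimplex ℝ A)) (hfc : ConvexOn ℝ (stdSimplex ℝ A) f)
    (hB : B ⊆ stdSimplex ℝ A) (hg : ConcaveOn ℝ B g) (hle : ∀ x ∈ B, g x ≤ f x)
    {p : A → ℝ} (hpB : p ∈ B) (hp : ∀ a, 0 < p a) :
    ∃ (v : A → ℝ) (u : ℝ), (∀ y ∈ stdSimplex ℝ A, ∑ a, v a * y a - u ≤ f y) ∧
      ∀ y ∈ B, g y ≤ ∑ a, v a * y a - u := by
  classical
  have hmem : ∀ y ∈ stdSimplex ℝ A, (∀ a, 0 < y a) → ∀ r, f y < r →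
      (y, r) ∈ perspectiveEpigraph f := by
    intro y hy hpos r hr
    refine ⟨hpos, ?_⟩
    simp only [hy.2]
    simpa using hr
  have hdisj : Disjoint (perspectiveEpigraph f) {z : (A → ℝ) × ℝ | z.1 ∈ B ∧ z.2 ≤ g z.1} := by
    rw [Set.disjoint_left]
    rintro ⟨y, r⟩ ⟨-, h2⟩ ⟨h3, h4⟩
    dsimp only at h2 h3 h4
    have hs := (hB h3).2
    rw [hs] at h2
    simp only [inv_one, one_smul, one_mul] at h2
    have := hle y h3
    linarith
  obtain ⟨φ, u, h1, h2⟩ := geometric_hahn_banach_open (convex_perspectiveEpigraph hfc)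
    (isOpen_perspectiveEpigraph hf) hg.convex_hypograph hdisj
  set c : ℝ := φ (0, 1) with hc
  set l : A → ℝ := fun a => φ (Pi.single a 1, 0) with hl
  have hφ : ∀ y r, φ (y, r) = ∑ a, l a * y a + c * r := by
    intro y r
    have hy : (y, r) = ∑ a, y a • ((Pi.single a (1 : ℝ) : A → ℝ), (0 : ℝ)) +
        r • ((0 : A → ℝ), (1 : ℝ)) := by
      refine Prod.ext ?_ ?_
      · ext i
        simp [Finset.sum_apply, Prod.fst_sum, Pi.single_apply]
      · simp [Prod.snd_sum]
    rw [hy, map_add, map_sum, map_smul]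
    simp only [map_smul, smul_eq_mul]
    rw [mul_comm c r]
    congr 1
    exact Finset.sum_congr rfl fun a _ => mul_comm _ _
  have hpΔ := hB hpB
  have key1 : ∑ a, l a * p a + c * (f p + 1) < u := by
    rw [← hφ]; exact h1 _ (hmem p hpΔ hp _ (by linarith))
  have key2 : u ≤ ∑ a, l a * p a + c * g p := by
    rw [← hφ]; exact h2 _ ⟨hpB, le_rfl⟩
  have hcneg : c < 0 := by
    have := hle p hpB
    by_contra hcc
    have : c * (f p + 1) ≥ c * g p := mul_le_mul_of_nonneg_left (by linarith) (not_lt.1 hcc)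
    linarith
  have hdiv : ∀ y : A → ℝ, ∑ a, (-l a / c) * y a = -(∑ a, l a * y a) / c := by
    intro y
    rw [← Finset.sum_neg_distrib, Finset.sum_div]
    exact Finset.sum_congr rfl fun a _ => by ring
  refine ⟨fun a => -l a / c, -u / c, fun y hy => ?_, fun y hy => ?_⟩
  · -- first at positive points, where `(y, r)` lies in the open set for every `r > f y`
    have hpos : ∀ y ∈ stdSimplex ℝ A, (∀ a, 0 < y a) → ∑ a, (-l a / c) * y a - -u / c ≤ f y := by
      intro y hy hyp
      refine le_of_forall_gt fun r hr => ?_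
      have := h1 _ (hmem y hy hyp r hr)
      rw [hφ] at this
      rw [hdiv, ← sub_div, div_lt_iff_of_neg hcneg]
      linarith
    have ht := tendsto_mix_uniform hf hy
    have hl' : ContinuousOn (fun y : A → ℝ => ∑ a, (-l a / c) * y a - -u / c)
        (stdSimplex ℝ A) := by fun_prop
    have ht' := tendsto_mix_uniform hl' hy
    have : (nhdsWithin (0 : ℝ) (Set.Ioo 0 1)).NeBot := by
      rw [nhdsWithin_Ioo_eq_nhdsGT (by norm_num)]; infer_instance
    refine le_of_tendsto_of_tendsto ht' ht ?_
    filter_upwards [self_mem_nhdsWithin] with ε hε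
    exact hpos _ (mix_uniform_mem hy hε.1 hε.2).1 (mix_uniform_mem hy hε.1 hε.2).2
  · have := h2 (y, g y) ⟨hy, le_rfl⟩
    rw [hφ] at this
    rw [hdiv, ← sub_div, le_div_iff_of_neg hcneg]
    linarith

theorem sum_mul_sub (g x y : A → ℝ) :
    ∑ a, g a * (y a - x a) = ∑ a, g a * y a - ∑ a, g a * x a := by
  rw [← Finset.sum_sub_distrib]
  exact Finset.sum_congr rfl fun a _ => by ring

/-- A continuous convex function on the simplex is subdifferentiable at positive vectors. -/
theorem mem_subdiffDomain_of_pos [Nonempty A] {f : (A → ℝ) → ℝ}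
    (hf : ContinuousOn f (stdSimplex ℝ A)) (hfc : ConvexOn ℝ (stdSimplex ℝ A) f)
    {p : A → ℝ} (hp : p ∈ stdSimplex ℝ A) (hpos : ∀ a, 0 < p a) : p ∈ subdiffDomain f := by
  obtain ⟨v, u, h1, h2⟩ := exists_affine_between (g := fun _ => f p) (B := {p}) hf hfc
    (by simpa using hp) (concaveOn_const _ (convex_singleton p)) (by simp) rfl hpos
  refine ⟨hp, v, fun y hy => ?_⟩
  have := h1 y hy
  have := h2 p rfl
  rw [sum_mul_sub]
  linarith

variable (d : DistGen A)

theorem breg_self (x : A → ℝ) : d.breg x x = 0 := by simp [DistGen.breg]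

theorem breg_ge {x y : A → ℝ} (hx : x ∈ subdiffDomain d.w) (hy : y ∈ stdSimplex ℝ A) :
    (∑ a, |y a - x a|) ^ 2 / 2 ≤ d.breg x y := by
  have := d.strong x hx y hy
  unfold DistGen.breg
  linarith

variable [Nonempty A]

theorem uniformDist_mem_subdiffDomain : uniformDist A ∈ subdiffDomain d.w :=
  mem_subdiffDomain_of_pos d.cont d.convex uniformDist_mem uniformDist_pos

/-- Among all subgradients at a point, the gradient is the largest in feasible directions: towards
positive points it is a one-sided directional derivative, and these points are dense. -/
theorem subgradient_le_grad {x v : A → ℝ} (hx : x ∈ subdiffDomain d.w)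
    (hv : IsSubgradient d.w x v) {y : A → ℝ} (hy : y ∈ stdSimplex ℝ A) :
    ∑ a, v a * (y a - x a) ≤ ∑ a, d.grad x a * (y a - x a) := by
  have hpos : ∀ y ∈ stdSimplex ℝ A, (∀ a, 0 < y a) →
      ∑ a, v a * (y a - x a) ≤ ∑ a, d.grad x a * (y a - x a) := by
    intro y hy hyp
    have hseg : segment ℝ x y ⊆ subdiffDomain d.w := by
      rintro z ⟨a, b, ha, hb, hab, rfl⟩
      rcases hb.eq_or_lt with h | h
      · have : a = 1 := by linarith
        simpa [← h, this] using hx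
      · refine mem_subdiffDomain_of_pos d.cont d.convex
          (convex_stdSimplex ℝ A hx.1 hy ha hb hab) fun i => ?_
        have h1 := mul_pos h (hyp i)
        have h2 := mul_nonneg ha (hx.1.1 i)
        simp only [Pi.add_apply, Pi.smul_apply, smul_eq_mul]
        linarith
    have hmin : IsLocalMinOn
        (fun z => d.w z - (∑ a, v a • (ContinuousLinearMap.proj a : (A → ℝ) →L[ℝ] ℝ)) z)
        (subdiffDomain d.w) x := by
      refine IsMinOn.localize fun z hz => ?_
      have := hv z hz.1
      rw [sum_mul_sub] at this
      simp only [_root_.sum_apply, _root_.smul_apply,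
        ContinuousLinearMap.proj_apply, smul_eq_mul, Set.mem_ofPred_eq]
      linarith
    have hd := (d.hasDeriv x hx).sub
      (∑ a, v a • (ContinuousLinearMap.proj a : (A → ℝ) →L[ℝ] ℝ)).hasFDerivWithinAt
        (s := subdiffDomain d.w) (x := x)
    have := hmin.hasFDerivWithinAt_nonneg hd
      (sub_mem_posTangentConeAt_of_segment_subset hseg)
    simp only [_root_.sub_apply, _root_.sum_apply,
      _root_.smul_apply, ContinuousLinearMap.proj_apply, smul_eq_mul,
      Pi.sub_apply] at this
    linarith
  have ht : ContinuousOn (fun y : A → ℝ => ∑ a, v a * (y a - x a)) (stdSimplex ℝ A) := by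
    fun_prop
  have ht' : ContinuousOn (fun y : A → ℝ => ∑ a, d.grad x a * (y a - x a)) (stdSimplex ℝ A) := by
    fun_prop
  have : (nhdsWithin (0 : ℝ) (Set.Ioo 0 1)).NeBot := by
    rw [nhdsWithin_Ioo_eq_nhdsGT (by norm_num)]; infer_instance
  refine le_of_tendsto_of_tendsto (tendsto_mix_uniform ht hy) (tendsto_mix_uniform ht' hy) ?_
  filter_upwards [self_mem_nhdsWithin] with ε hε
  exact hpos _ (mix_uniform_mem hy hε.1 hε.2).1 (mix_uniform_mem hy hε.1 hε.2).2

/-! ### The prox-mapping -/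

variable {d} {R : Regularizer A} {μ : ℝ}

/-- First-order optimality of the prox-mapping: the sandwich theorem splits the optimality
condition into a subgradient of `h` and a subgradient of the distance generating function. -/
theorem proxStep_optimality (hμ : R.StronglyConvex d μ) {η : ℝ} (hη : 0 < η) (q x₀ : A → ℝ) :
    proxStep R d η q x₀ ∈ subdiffDomain d.w ∧ ∀ y ∈ stdSimplex ℝ A,
      η * (∑ a, q a * proxStep R d η q x₀ a + R.h (proxStep R d η q x₀)) +
          d.breg x₀ (proxStep R d η q x₀) + (1 + η * μ) * d.breg (proxStep R d η q x₀) y ≤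
        η * (∑ a, q a * y a + R.h y) + d.breg x₀ y := by
  obtain ⟨hp, hmin⟩ := proxStep_spec R d η q x₀
  set p := proxStep R d η q x₀
  have hmin' : ∀ y ∈ stdSimplex ℝ A, η * (∑ a, q a * p a + R.h p) + d.breg x₀ p ≤
      η * (∑ a, q a * y a + R.h y) + d.breg x₀ y := fun y hy => hmin hy
  -- minimality says exactly that this concave function lies below the distance generating function
  have hconc : ConcaveOn ℝ (stdSimplex ℝ A) (fun y => (η * (∑ a, q a * p a + R.h p) -
      ∑ a, d.grad x₀ a * p a + d.w p) + (∑ a, (d.grad x₀ a - η * q a) * y a - η * R.h y)) := by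
    refine ConcaveOn.add (concaveOn_const _ (convex_stdSimplex ℝ A)) (ConcaveOn.sub ?_ ?_)
    · refine ⟨convex_stdSimplex ℝ A, fun x _ y _ a b _ _ _ => le_of_eq ?_⟩
      simp only [smul_eq_mul, Finset.mul_sum, Pi.add_apply, Pi.smul_apply,
        ← Finset.sum_add_distrib]
      exact Finset.sum_congr rfl fun a _ => by ring
    · exact R.convex.smul hη.le
  have hexp : ∀ y : A → ℝ, ∑ a, (d.grad x₀ a - η * q a) * y a =
      ∑ a, d.grad x₀ a * y a - η * ∑ a, q a * y a := by
    intro y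
    rw [Finset.mul_sum, ← Finset.sum_sub_distrib]
    exact Finset.sum_congr rfl fun a _ => by ring
  obtain ⟨v, u, h1, h2⟩ := exists_affine_between d.cont d.convex subset_rfl hconc (fun y hy => by
    have := hmin' y hy
    simp only [DistGen.breg, sum_mul_sub] at this
    rw [hexp]
    linarith) uniformDist_mem uniformDist_pos
  have hvp : ∑ a, v a * p a - u = d.w p := by
    refine le_antisymm (h1 p hp) ?_
    have := h2 p hp
    rw [hexp] at this
    linarith
  have hv : IsSubgradient d.w p v := by
    intro y hy
    have := h1 y hy
    rw [sum_mul_sub]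
    linarith
  have hpX : p ∈ subdiffDomain d.w := ⟨hp, v, hv⟩
  set g : A → ℝ := fun a => (d.grad x₀ a - η * q a - v a) / η with hg
  have hgs : ∀ y : A → ℝ, η * ∑ a, g a * (y a - p a) =
      ∑ a, d.grad x₀ a * (y a - p a) - η * ∑ a, q a * (y a - p a) - ∑ a, v a * (y a - p a) := by
    intro y
    simp only [Finset.mul_sum, ← Finset.sum_sub_distrib]
    refine Finset.sum_congr rfl fun a _ => ?_
    simp only [hg]
    field_simp
  have hsub : IsSubgradient R.h p g := by
    intro y hy
    have h3 := h2 y hy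
    rw [hexp] at h3
    refine le_of_mul_le_mul_left ?_ hη
    rw [mul_add, hgs]
    simp only [sum_mul_sub]
    linarith
  refine ⟨hpX, fun y hy => ?_⟩
  have h4 := mul_le_mul_of_nonneg_left (hμ.2 p hpX g hsub y hy) hη.le
  rw [mul_sub, mul_add η (R.h p), hgs] at h4
  have h5 := subgradient_le_grad d hpX hv hy
  simp only [DistGen.breg, sum_mul_sub] at h4 h5 ⊢
  linarith

/-- Strong convexity relative to the Bregman divergence gives strong convexity in the `ℓ₁`-norm on
the whole simplex: approach a point by its mixtures with the uniform distribution, at which both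
functions have subgradients. -/
theorem Regularizer.StronglyConvex.combination_le (hμ : R.StronglyConvex d μ) {x y : A → ℝ}
    (hx : x ∈ stdSimplex ℝ A) (hy : y ∈ stdSimplex ℝ A) {t : ℝ} (ht : t ∈ Set.Icc (0 : ℝ) 1) :
    R.h ((1 - t) • x + t • y) ≤ (1 - t) * R.h x + t * R.h y -
      μ / 2 * (t * (1 - t)) * (∑ a, |x a - y a|) ^ 2 := by
  set m := (1 - t) • x + t • y with hm
  have hmΔ : m ∈ stdSimplex ℝ A :=
    convex_stdSimplex ℝ A hx hy (by linarith [ht.2]) ht.1 (by ring)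
  have : (nhdsWithin (0 : ℝ) (Set.Ioo 0 1)).NeBot := by
    rw [nhdsWithin_Ioo_eq_nhdsGT (by norm_num)]; infer_instance
  have hlim : Filter.Tendsto (fun ε : ℝ => (1 - t) * R.h x + t * R.h y -
      μ / 2 * (t * (1 - t)) * (∑ a, |x a - y a|) ^ 2 + ε / (1 - ε) * R.hbar)
      (nhdsWithin 0 (Set.Ioo 0 1)) (nhds ((1 - t) * R.h x + t * R.h y -
      μ / 2 * (t * (1 - t)) * (∑ a, |x a - y a|) ^ 2)) := by
    have h1 : ContinuousAt (fun ε : ℝ => (1 - t) * R.h x + t * R.h y -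
        μ / 2 * (t * (1 - t)) * (∑ a, |x a - y a|) ^ 2 + ε / (1 - ε) * R.hbar) 0 := by
      have : ContinuousAt (fun ε : ℝ => ε / (1 - ε)) 0 :=
        continuousAt_id.div (by fun_prop) (by norm_num)
      fun_prop
    have := h1.tendsto.mono_left (nhdsWithin_le_nhds (s := Set.Ioo (0 : ℝ) 1))
    simpa using this
  refine le_of_tendsto_of_tendsto (tendsto_mix_uniform R.cont hmΔ) hlim ?_
  filter_upwards [self_mem_nhdsWithin] with ε hε
  obtain ⟨hzΔ, hzpos⟩ := mix_uniform_mem hmΔ hε.1 hε.2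
  set z := (1 - ε) • m + ε • uniformDist A with hz
  obtain ⟨-, g, hg⟩ := mem_subdiffDomain_of_pos R.cont R.convex hzΔ hzpos
  have hzX := mem_subdiffDomain_of_pos d.cont d.convex hzΔ hzpos
  have hquad : ∀ w ∈ stdSimplex ℝ A,
      R.h z + ∑ a, g a * (w a - z a) + μ * ((∑ a, |w a - z a|) ^ 2 / 2) ≤ R.h w := by
    intro w hw
    have h1 := hμ.2 z hzX g hg w hw
    have h2 := mul_le_mul_of_nonneg_left (breg_ge d hzX hw) hμ.1.le
    linarith
  have hqx := hquad x hx
  have hqy := hquad y hy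
  set α := ∑ a, |x a - z a|
  set β := ∑ a, |y a - z a|
  have htri : ∑ a, |x a - y a| ≤ α + β := by
    simp only [α, β, ← Finset.sum_add_distrib]
    refine Finset.sum_le_sum fun a _ => ?_
    have := abs_sub_le (x a) (z a) (y a)
    rwa [abs_sub_comm (z a)] at this
  have hnn : 0 ≤ ∑ a, |x a - y a| := Finset.sum_nonneg fun a _ => abs_nonneg _
  have ht' : 0 ≤ t * (1 - t) := mul_nonneg ht.1 (by linarith [ht.2])
  have hq : t * (1 - t) * (∑ a, |x a - y a|) ^ 2 ≤ (1 - t) * α ^ 2 + t * β ^ 2 := by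
    have h1 : (∑ a, |x a - y a|) ^ 2 ≤ (α + β) ^ 2 := pow_le_pow_left₀ hnn htri 2
    have h2 := mul_le_mul_of_nonneg_left h1 ht'
    nlinarith [sq_nonneg ((1 - t) * α - t * β)]
  -- the first-order terms cancel up to `ε / (1 - ε)` times a directional slope bounded by `hbar`
  have hu := hg (uniformDist A) uniformDist_mem
  have hlin : (1 - t) * ∑ a, g a * (x a - z a) + t * ∑ a, g a * (y a - z a) =
      -(ε / (1 - ε) * ∑ a, g a * (uniformDist A a - z a)) := by
    have h1 : 1 - ε ≠ 0 := by linarith [hε.2]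
    simp only [Finset.mul_sum, ← Finset.sum_add_distrib, ← Finset.sum_neg_distrib]
    refine Finset.sum_congr rfl fun a _ => ?_
    simp only [hz, hm, Pi.add_apply, Pi.smul_apply, smul_eq_mul]
    field_simp
    ring
  have hslope : ∑ a, g a * (uniformDist A a - z a) ≤ R.hbar := by
    have h1 := (R.mapsTo hzΔ).1
    have h2 := (R.mapsTo (uniformDist_mem (A := A))).2
    linarith
  have hε' : 0 ≤ ε / (1 - ε) := div_nonneg hε.1.le (by linarith [hε.2])
  have h3 := mul_le_mul_of_nonneg_left hslope hε'
  have h4 := mul_le_mul_of_nonneg_left hqx (show 0 ≤ 1 - t by linarith [ht.2])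
  have h5 := mul_le_mul_of_nonneg_left hqy ht.1
  have h6 := mul_le_mul_of_nonneg_left hq (show 0 ≤ μ / 2 by linarith [hμ.1])
  nlinarith

/-- Quadratic growth at a minimizer of a linear perturbation of the regularizer. -/
theorem Regularizer.StronglyConvex.growth (hμ : R.StronglyConvex d μ) {q x y : A → ℝ}
    (hx : x ∈ stdSimplex ℝ A) (hy : y ∈ stdSimplex ℝ A)
    (hmin : ∀ z ∈ stdSimplex ℝ A, ∑ a, q a * x a + R.h x ≤ ∑ a, q a * z a + R.h z) :
    ∑ a, q a * x a + R.h x + μ / 2 * (∑ a, |x a - y a|) ^ 2 ≤ ∑ a, q a * y a + R.h y := by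
  refine le_of_forall_le_add_mul (c := μ / 2 * (∑ a, |x a - y a|) ^ 2) fun t ht => ?_
  have h1 := hμ.combination_le hx hy ⟨ht.1.le, ht.2.le⟩
  have h2 := hmin _ (convex_stdSimplex ℝ A hx hy (by linarith [ht.2]) ht.1.le
    (show 1 - t + t = 1 by ring))
  have h3 : ∑ a, q a * ((1 - t) • x + t • y) a =
      (1 - t) * ∑ a, q a * x a + t * ∑ a, q a * y a := by
    simp only [Finset.mul_sum, ← Finset.sum_add_distrib]
    refine Finset.sum_congr rfl fun a _ => ?_
    simp only [Pi.add_apply, Pi.smul_apply, smul_eq_mul]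
    ring
  rw [h3] at h2
  refine le_of_mul_le_mul_left ?_ ht.1
  nlinarith

/-- The `ℓ₁`-diameter of a nontrivial simplex is `2`, which bounds `μ` by the range of `h`. -/
theorem Regularizer.StronglyConvex.le_hbar [Nontrivial A] (hμ : R.StronglyConvex d μ) :
    μ ≤ 2 * R.hbar := by
  classical
  obtain ⟨i, j, hij⟩ := exists_pair_ne A
  have hi := single_mem_stdSimplex ℝ i
  have hj := single_mem_stdSimplex ℝ j
  have h := hμ.combination_le hi hj (t := 1 / 2) (by norm_num)
  have hm := (R.mapsTo (convex_stdSimplex ℝ A hi hj (by norm_num : (0 : ℝ) ≤ 1 - 1 / 2)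
    (by norm_num) (by norm_num : (1 : ℝ) - 1 / 2 + 1 / 2 = 1))).1
  have h1 := (R.mapsTo hi).2
  have h2 := (R.mapsTo hj).2
  have hl : (2 : ℝ) ≤ ∑ a, |(Pi.single i 1 : A → ℝ) a - (Pi.single j 1 : A → ℝ) a| := by
    calc (2 : ℝ) = ∑ a ∈ ({i, j} : Finset A),
          |(Pi.single i 1 : A → ℝ) a - (Pi.single j 1 : A → ℝ) a| := by
          rw [Finset.sum_pair hij]
          simp [hij, hij.symm]
          norm_num
      _ ≤ _ := Finset.sum_le_sum_of_subset_of_nonneg (Finset.subset_univ _)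
          fun _ _ _ => abs_nonneg _
  have h4 : (2 : ℝ) ^ 2 ≤ (∑ a, |(Pi.single i 1 : A → ℝ) a - (Pi.single j 1 : A → ℝ) a|) ^ 2 :=
    pow_le_pow_left₀ (by norm_num) hl 2
  have h5 := mul_le_mul_of_nonneg_left h4 (show 0 ≤ μ / 2 * (1 / 2 * (1 - 1 / 2)) by
    linarith [hμ.1])
  linarith

end Simplex

/-! ### Policy evaluation and the Bellman equation -/

section Kernel

variable {S A : Type*} [Fintype S] [Fintype A]

theorem sum_mul_le_of_mem_stdSimplex {ι : Type*} [Fintype ι] {p : ι → ℝ}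
    (hp : p ∈ stdSimplex ℝ ι) {f : ι → ℝ} {b : ℝ} (hf : ∀ i, f i ≤ b) : ∑ i, p i * f i ≤ b := by
  calc ∑ i, p i * f i ≤ ∑ i, p i * b :=
        Finset.sum_le_sum fun i _ => mul_le_mul_of_nonneg_left (hf i) (hp.1 i)
    _ = b := by rw [← Finset.sum_mul, hp.2, one_mul]

theorem le_sum_mul_of_mem_stdSimplex {ι : Type*} [Fintype ι] {p : ι → ℝ}
    (hp : p ∈ stdSimplex ℝ ι) {f : ι → ℝ} {b : ℝ} (hf : ∀ i, b ≤ f i) : b ≤ ∑ i, p i * f i := by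
  calc b = ∑ i, p i * b := by rw [← Finset.sum_mul, hp.2, one_mul]
    _ ≤ _ := Finset.sum_le_sum fun i _ => mul_le_mul_of_nonneg_left (hf i) (hp.1 i)

/-- Comparison principle for a discounted stochastic matrix. -/
theorem le_of_le_discounted [Nonempty S] {γ κ : ℝ} (h0 : 0 ≤ γ) (h1 : γ < 1) {K : S → S → ℝ}
    (hK : ∀ s, K s ∈ stdSimplex ℝ S) {Z : S → ℝ}
    (h : ∀ s, Z s ≤ γ * ∑ s', K s s' * Z s' + κ) (s : S) : Z s ≤ κ / (1 - γ) := by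
  obtain ⟨m, hm⟩ := Finite.exists_max Z
  have h2 := mul_le_mul_of_nonneg_left (sum_mul_le_of_mem_stdSimplex (hK m) hm) h0
  have h3 : Z m ≤ κ / (1 - γ) := by
    rw [le_div_iff₀ (by linarith)]
    have := h m
    linarith
  exact (hm s).trans h3

theorem kernelMatrix_mem {P : S → A → S → ℝ} (hP : ∀ s a, P s a ∈ stdSimplex ℝ S)
    {p : S → A → ℝ} (hp : IsPolicy p) (s : S) : kernelMatrix P p s ∈ stdSimplex ℝ S := by
  refine ⟨fun s' => Finset.sum_nonneg fun a _ => mul_nonneg ((hp s).1 a) ((hP s a).1 s'), ?_⟩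
  simp only [kernelMatrix, Matrix.of_apply]
  rw [Finset.sum_comm]
  simp only [← Finset.mul_sum, (hP s _).2, mul_one, (hp s).2]

theorem sum_kernelMatrix_mul (P : S → A → S → ℝ) (p : S → A → ℝ) (V : S → ℝ) (s : S) :
    ∑ s', kernelMatrix P p s s' * V s' = ∑ a, p s a * ∑ s', P s a s' * V s' := by
  simp only [kernelMatrix, Matrix.of_apply, Finset.sum_mul, Finset.mul_sum]
  rw [Finset.sum_comm]
  simp only [mul_assoc]

/-- The action values `c + γ P V`. -/
def qValue (γ : ℝ) (c : S → A → ℝ) (P : S → A → S → ℝ) (V : S → ℝ) (s : S) (a : A) : ℝ :=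
  c s a + γ * ∑ s', P s a s' * V s'

/-- The one-step regularized cost `⟨c + γ P V, x⟩ + h x` of the action distribution `x` in the
state `s`, when `V` is the cost-to-go. -/
def backup (R : Regularizer A) (γ : ℝ) (c : S → A → ℝ) (P : S → A → S → ℝ) (V : S → ℝ) (s : S)
    (x : A → ℝ) : ℝ :=
  ∑ a, qValue γ c P V s a * x a + R.h x

theorem backup_eq (R : Regularizer A) (γ : ℝ) (c : S → A → ℝ) (P : S → A → S → ℝ) (V : S → ℝ)
    (s : S) (p : S → A → ℝ) : backup R γ c P V s (p s) =
      ∑ a, p s a * c s a + R.h (p s) + γ * ∑ s', kernelMatrix P p s s' * V s' := by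
  rw [sum_kernelMatrix_mul]
  simp only [backup, qValue, add_mul, Finset.sum_add_distrib, Finset.mul_sum]
  have h1 : ∑ a, c s a * p s a = ∑ a, p s a * c s a := Finset.sum_congr rfl fun a _ => mul_comm _ _
  have h2 : ∑ a, (∑ s', γ * (P s a s' * V s')) * p s a =
      ∑ a, ∑ s', γ * (p s a * (P s a s' * V s')) := by
    refine Finset.sum_congr rfl fun a _ => ?_
    rw [Finset.sum_mul]
    exact Finset.sum_congr rfl fun s' _ => by ring
  rw [h1, h2]
  ring

theorem backup_sub (R : Regularizer A) (γ : ℝ) (c : S → A → ℝ) (P : S → A → S → ℝ) (V W : S → ℝ)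
    (s : S) (p : S → A → ℝ) : backup R γ c P V s (p s) =
      backup R γ c P W s (p s) + γ * ∑ s', kernelMatrix P p s s' * (V s' - W s') := by
  simp only [backup_eq, mul_sub, Finset.sum_sub_distrib]
  ring

theorem backup_mono (R : Regularizer A) {γ : ℝ} (hγ : 0 ≤ γ) (c : S → A → ℝ)
    {P : S → A → S → ℝ} (hP : ∀ s a, P s a ∈ stdSimplex ℝ S) {V W : S → ℝ} (h : ∀ s, V s ≤ W s)
    (s : S) {x : A → ℝ} (hx : x ∈ stdSimplex ℝ A) :
    backup R γ c P V s x ≤ backup R γ c P W s x := by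
  refine add_le_add_left (Finset.sum_le_sum fun a _ => mul_le_mul_of_nonneg_right ?_ (hx.1 a)) _
  exact add_le_add_right (mul_le_mul_of_nonneg_left (Finset.sum_le_sum fun s' _ =>
    mul_le_mul_of_nonneg_left (h s') ((hP s a).1 s')) hγ) _

/-- `1 - γ K` is invertible for a stochastic matrix `K`, so its inverse solves the discounted
evaluation equation. -/
theorem resolvent_eq [DecidableEq S] [Nonempty S] {γ : ℝ} (h0 : 0 ≤ γ) (h1 : γ < 1)
    {K : Matrix S S ℝ} (hK : ∀ s, K s ∈ stdSimplex ℝ S) (r : S → ℝ) (s : S) :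
    (((1 : Matrix S S ℝ) - γ • K)⁻¹.mulVec r) s =
      r s + γ * ∑ s', K s s' * (((1 : Matrix S S ℝ) - γ • K)⁻¹.mulVec r) s' := by
  have hmul : ∀ (v : S → ℝ) s, (((1 : Matrix S S ℝ) - γ • K).mulVec v) s =
      v s - γ * ∑ s', K s s' * v s' := by
    intro v s
    rw [Matrix.sub_mulVec, Matrix.one_mulVec, Matrix.smul_mulVec]
    simp [Matrix.mulVec, dotProduct]
  have hinj : Function.Injective ((1 : Matrix S S ℝ) - γ • K).mulVec := by
    intro v w hvw
    have hz : ∀ s, v s - w s = γ * ∑ s', K s s' * (v s' - w s') := by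
      intro s
      have := congrFun hvw s
      rw [hmul, hmul] at this
      simp only [mul_sub, Finset.sum_sub_distrib]
      linarith
    ext s
    have h2 := le_of_le_discounted h0 h1 hK (Z := fun s => v s - w s) (κ := 0)
      (fun s => by rw [add_zero]; exact (hz s).le) s
    have h3 := le_of_le_discounted h0 h1 hK (Z := fun s => -(v s - w s)) (κ := 0)
      (fun s => by
        simp only [mul_neg, Finset.sum_neg_distrib, add_zero]
        exact (neg_le_neg_iff.2 (hz s).ge)) s
    rw [zero_div] at h2 h3
    linarith
  have hu := Matrix.mulVec_injective_iff_isUnit.1 hinj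
  have h4 : ((1 : Matrix S S ℝ) - γ • K).mulVec (((1 : Matrix S S ℝ) - γ • K)⁻¹.mulVec r) = r := by
    rw [Matrix.mulVec_mulVec, Matrix.mul_nonsing_inv _ ((Matrix.isUnit_iff_isUnit_det _).1 hu),
      Matrix.one_mulVec]
  have := congrFun h4 s
  rw [hmul] at this
  linarith

end Kernel

section Value

variable {S A : Type*} [Fintype S] [Fintype A] (M : DMDP S A) (R : Regularizer A)

theorem stageCost_mem {p : S → A → ℝ} (hp : IsPolicy p) (s : S) :
    stageCost M R p s ∈ Set.Icc 0 (1 + R.hbar) := by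
  have h1 := le_sum_mul_of_mem_stdSimplex (hp s) fun a => (M.c_mem s a).1
  have h2 := sum_mul_le_of_mem_stdSimplex (hp s) fun a => (M.c_mem s a).2
  have h3 := R.mapsTo (hp s)
  exact ⟨add_nonneg h1 h3.1, add_le_add h2 h3.2⟩

theorem policyValue_eq_backup [DecidableEq S] {p : S → A → ℝ} (hp : IsPolicy p) (s : S) :
    policyValue M R p s = backup R M.γ M.c M.P (policyValue M R p) s (p s) := by
  set f : ℕ → S → ℝ := fun t s =>
    M.γ ^ t * ∑ s', (kernelMatrix M.P p ^ t) s s' * stageCost M R p s' with hf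
  have hK := kernelMatrix_mem M.P_mem hp
  have h0 : ∀ s, f 0 s = stageCost M R p s := by
    intro s
    simp [hf, Matrix.one_apply]
  have hsucc : ∀ t s, f (t + 1) s = M.γ * ∑ s', kernelMatrix M.P p s s' * f t s' := by
    intro t s
    simp only [hf, pow_succ' (kernelMatrix M.P p), Matrix.mul_apply, Finset.sum_mul]
    rw [Finset.sum_comm, pow_succ]
    simp only [Finset.mul_sum]
    exact Finset.sum_congr rfl fun i _ => Finset.sum_congr rfl fun j _ => by ring
  have hbd : ∀ t s, |f t s| ≤ M.γ ^ t * (1 + R.hbar) := by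
    intro t
    induction t with
    | zero =>
      intro s
      have := stageCost_mem M R hp s
      rw [h0, abs_of_nonneg this.1]
      simpa using this.2
    | succ t ih =>
      intro s
      rw [hsucc, abs_mul, abs_of_pos M.γ_mem.1, pow_succ', mul_assoc]
      refine mul_le_mul_of_nonneg_left ?_ M.γ_mem.1.le
      refine abs_le.2 ⟨le_sum_mul_of_mem_stdSimplex (hK s) fun i => (abs_le.1 (ih i)).1,
        sum_mul_le_of_mem_stdSimplex (hK s) fun i => (abs_le.1 (ih i)).2⟩
  have hsum : ∀ s, Summable fun t => f t s := fun s =>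
    Summable.of_norm_bounded
      ((summable_geometric_of_lt_one M.γ_mem.1.le M.γ_mem.2).mul_right (1 + R.hbar))
      fun t => by simpa using hbd t s
  have hval : ∀ s, policyValue M R p s = ∑' t, f t s := fun s => rfl
  rw [backup_eq, hval, (hsum s).tsum_eq_zero_add, h0]
  simp only [hsucc, hval, tsum_mul_left]
  rw [Summable.tsum_finsetSum fun i _ => (hsum i).mul_left _]
  simp only [tsum_mul_left]
  rfl

variable {M R}

/-- Every solution of the evaluation equation of a policy with costs in `[0, b]` lies between `0`
and `b / (1 - γ)`. -/
theorem mem_Icc_of_eq_discounted [Nonempty S] {γ b : ℝ} (h0 : 0 ≤ γ) (h1 : γ < 1)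
    {K : S → S → ℝ} (hK : ∀ s, K s ∈ stdSimplex ℝ S) {r V : S → ℝ}
    (hr : ∀ s, r s ∈ Set.Icc 0 b) (hV : ∀ s, V s = r s + γ * ∑ s', K s s' * V s') (s : S) :
    V s ∈ Set.Icc 0 (b / (1 - γ)) := by
  refine ⟨?_, le_of_le_discounted h0 h1 hK (fun s => ?_) s⟩
  · have := le_of_le_discounted h0 h1 hK (Z := fun s => -V s) (κ := 0) (fun s => by
      simp only [mul_neg, Finset.sum_neg_distrib, add_zero]
      have := hV s
      have := (hr s).1
      linarith) s
    rw [zero_div] at this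
    linarith
  · have := hV s
    have := (hr s).2
    linarith

theorem policyValue_mem [Nonempty S] [DecidableEq S] {p : S → A → ℝ} (hp : IsPolicy p) (s : S) :
    policyValue M R p s ∈ Set.Icc 0 ((1 + R.hbar) / (1 - M.γ)) :=
  mem_Icc_of_eq_discounted M.γ_mem.1.le M.γ_mem.2 (kernelMatrix_mem M.P_mem hp)
    (stageCost_mem M R hp) (fun s => by
      conv_lhs => rw [policyValue_eq_backup M R hp, backup_eq]
      rfl) s

theorem bellman_spec [Nonempty A] (V : S → ℝ) (s : S) :
    (∃ x ∈ stdSimplex ℝ A, bellman M R V s = backup R M.γ M.c M.P V s x) ∧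
      ∀ x ∈ stdSimplex ℝ A, bellman M R V s ≤ backup R M.γ M.c M.P V s x := by
  have heq : bellman M R V s = sInf (backup R M.γ M.c M.P V s '' stdSimplex ℝ A) := by
    unfold bellman backup qValue
    congr 2
    ext x
    congr 1
    exact Finset.sum_congr rfl fun a _ => mul_comm _ _
  have hc : ContinuousOn (backup R M.γ M.c M.P V s) (stdSimplex ℝ A) := by
    unfold backup
    have := R.cont
    fun_prop
  obtain ⟨x, hx, hmin⟩ := (isCompact_stdSimplex ℝ A).exists_isMinOn
    ⟨_, uniformDist_mem⟩ hc
  have hleast : IsLeast (backup R M.γ M.c M.P V s '' stdSimplex ℝ A)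
      (backup R M.γ M.c M.P V s x) := by
    refine ⟨⟨x, hx, rfl⟩, ?_⟩
    rintro _ ⟨y, hy, rfl⟩
    exact hmin hy
  rw [heq, hleast.csInf_eq]
  exact ⟨⟨x, hx, rfl⟩, fun y hy => hmin hy⟩

/-- `Vstar` solves the Bellman equation and the policy `pstar` attains the minimum in it. -/
def IsBellmanPair (M : DMDP S A) (R : Regularizer A) (pstar : S → A → ℝ) (Vstar : S → ℝ) : Prop :=
  IsPolicy pstar ∧ (∀ s, Vstar s = backup R M.γ M.c M.P Vstar s (pstar s)) ∧
    ∀ s, ∀ x ∈ stdSimplex ℝ A, Vstar s ≤ backup R M.γ M.c M.P Vstar s x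

theorem exists_bellman_fixedPoint [Nonempty A] : ∃ V, bellman M R V = V := by
  have hle : ∀ V W : S → ℝ, ∀ s, bellman M R V s ≤ bellman M R W s + M.γ * dist V W := by
    intro V W s
    obtain ⟨⟨x, hx, hxe⟩, -⟩ := bellman_spec (M := M) (R := R) W s
    have h1 := (bellman_spec (M := M) (R := R) V s).2 x hx
    have hp : IsPolicy fun _ : S => x := fun _ => hx
    have h2 := backup_sub R M.γ M.c M.P V W s fun _ => x
    have h3 := sum_mul_le_of_mem_stdSimplex (kernelMatrix_mem M.P_mem hp s)
      (f := fun s' => V s' - W s') (b := dist V W) fun s' =>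
        (le_abs_self _).trans (dist_le_pi_dist V W s')
    have h4 := mul_le_mul_of_nonneg_left h3 M.γ_mem.1.le
    rw [hxe]
    linarith
  have hcon : ContractingWith ⟨M.γ, M.γ_mem.1.le⟩ (bellman M R) := by
    refine ⟨M.γ_mem.2, LipschitzWith.of_dist_le_mul fun V W => ?_⟩
    refine (dist_pi_le_iff (mul_nonneg M.γ_mem.1.le dist_nonneg)).2 fun s => ?_
    rw [Real.dist_eq, abs_le]
    have h1 := hle V W s
    have h2 := hle W V s
    rw [dist_comm W V] at h2
    change -(M.γ * _) ≤ _ ∧ _ ≤ M.γ * _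
    constructor <;> linarith
  exact ⟨_, hcon.fixedPoint_isFixedPt⟩

theorem exists_isBellmanPair [Nonempty A] {V : S → ℝ} (hV : bellman M R V = V) :
    ∃ p, IsBellmanPair M R p V := by
  choose p hp hpe using fun s => (bellman_spec (M := M) (R := R) V s).1
  refine ⟨p, hp, fun s => ?_, fun s x hx => ?_⟩
  · rw [← hpe, hV]
  · have := (bellman_spec (M := M) (R := R) V s).2 x hx
    rwa [hV] at this

theorem IsBellmanPair.le_policyValue [Nonempty S] [DecidableEq S] {pstar : S → A → ℝ}
    {Vstar : S → ℝ} (h : IsBellmanPair M R pstar Vstar) {p : S → A → ℝ} (hp : IsPolicy p) (s : S) :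
    Vstar s ≤ policyValue M R p s := by
  have := le_of_le_discounted M.γ_mem.1.le M.γ_mem.2 (kernelMatrix_mem M.P_mem hp)
    (Z := fun s => Vstar s - policyValue M R p s) (κ := 0) (fun s => by
      have h1 := h.2.2 s (p s) (hp s)
      rw [backup_sub R M.γ M.c M.P Vstar (policyValue M R p),
        ← policyValue_eq_backup M R hp] at h1
      linarith) s
  rw [zero_div] at this
  linarith

theorem IsBellmanPair.policyValue_eq [Nonempty S] [DecidableEq S] {pstar : S → A → ℝ}
    {Vstar : S → ℝ} (h : IsBellmanPair M R pstar Vstar) (s : S) :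
    policyValue M R pstar s = Vstar s := by
  refine le_antisymm ?_ (h.le_policyValue h.1 s)
  have := le_of_le_discounted M.γ_mem.1.le M.γ_mem.2 (kernelMatrix_mem M.P_mem h.1)
    (Z := fun s => policyValue M R pstar s - Vstar s) (κ := 0) (fun s => by
      have h1 := h.2.1 s
      have h2 := policyValue_eq_backup M R h.1 s
      rw [backup_sub R M.γ M.c M.P _ Vstar] at h2
      linarith) s
  rw [zero_div] at this
  linarith

/-- An optimal policy attains the minimum in the Bellman equation. -/
theorem IsOptimalPolicy.isBellmanPair [Nonempty S] [Nonempty A] [DecidableEq S]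
    {pstar : S → A → ℝ} (h : IsOptimalPolicy M R pstar) {V : S → ℝ} (hV : bellman M R V = V) :
    IsBellmanPair M R pstar V := by
  obtain ⟨p, hp⟩ := exists_isBellmanPair hV
  have heq : policyValue M R pstar = V := by
    ext s
    refine le_antisymm ?_ (hp.le_policyValue h.1 s)
    rw [← hp.policyValue_eq]
    exact h.2 p hp.1 s
  refine ⟨h.1, fun s => ?_, hp.2.2⟩
  have := policyValue_eq_backup M R h.1 s
  rwa [heq] at this

end Value

section Perturbation

variable {S A : Type*} [Fintype S] [Fintype A] {M : DMDP S A} {R : Regularizer A}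

/-! ### Perturbing the costs -/

theorem abs_sum_mul_le {ι : Type*} [Fintype ι] {g x : ι → ℝ} {b : ℝ} (hg : ∀ i, |g i| ≤ b) :
    |∑ i, g i * x i| ≤ b * ∑ i, |x i| := by
  rw [Finset.mul_sum]
  refine (Finset.abs_sum_le_sum_abs _ _).trans (Finset.sum_le_sum fun i _ => ?_)
  rw [abs_mul]
  exact mul_le_mul_of_nonneg_right (hg i) (abs_nonneg _)

theorem abs_sum_mul_le_of_mem_stdSimplex {ι : Type*} [Fintype ι] {g x : ι → ℝ} {b : ℝ}
    (hg : ∀ i, |g i| ≤ b) (hx : x ∈ stdSimplex ℝ ι) : |∑ i, g i * x i| ≤ b := by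
  have := abs_sum_mul_le (x := x) hg
  have h2 : ∑ i, |x i| = 1 := by
    rw [← hx.2]
    exact Finset.sum_congr rfl fun i _ => abs_of_nonneg (hx.1 i)
  rwa [h2, mul_one] at this

/-- Every policy has a value for arbitrary real costs. -/
theorem exists_eq_backup [Nonempty S] (M : DMDP S A) (R : Regularizer A) (c : S → A → ℝ)
    {p : S → A → ℝ} (hp : IsPolicy p) : ∃ W, ∀ s, W s = backup R M.γ c M.P W s (p s) := by
  classical
  refine ⟨((1 : Matrix S S ℝ) - M.γ • kernelMatrix M.P p)⁻¹.mulVec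
    fun s => ∑ a, p s a * c s a + R.h (p s), fun s => ?_⟩
  rw [backup_eq]
  exact resolvent_eq M.γ_mem.1.le M.γ_mem.2 (kernelMatrix_mem M.P_mem hp)
    (fun s => ∑ a, p s a * c s a + R.h (p s)) s

/-- Let `W` be the value of the optimal policy `pstar` for the costs `c'`.  Its Bellman residual at
another action distribution `x` is the suboptimality gap of `x` for the true costs, up to an error
that is first order in the distance of `x` from `pstar` and is absorbed by the strong convexity of
the gap; what remains is the second-order quantity `E`. -/
theorem IsBellmanPair.residual_bounds [Nonempty S] [Nonempty A] {d : DistGen A} {μ : ℝ}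
    (hμ : R.StronglyConvex d μ) {pstar : S → A → ℝ} {Vstar : S → ℝ}
    (hstar : IsBellmanPair M R pstar Vstar) {c' : S → A → ℝ} {ε₀ E : ℝ}
    (hc : ∀ s a, |c' s a - M.c s a| ≤ ε₀)
    (hE : ∀ x ∈ stdSimplex ℝ A, ∀ y ∈ stdSimplex ℝ A, ε₀ / (1 - M.γ) * ∑ a, |x a - y a| ≤
      μ / 16 * (∑ a, |x a - y a|) ^ 2 + (1 - M.γ) * E)
    {W : S → ℝ} (hW : ∀ s, W s = backup R M.γ c' M.P W s (pstar s))
    (s : S) {x : A → ℝ} (hx : x ∈ stdSimplex ℝ A) :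
    7 / 8 * (backup R M.γ M.c M.P Vstar s x - Vstar s) - (1 - M.γ) * E ≤
        backup R M.γ c' M.P W s x - W s ∧
      backup R M.γ c' M.P W s x - W s ≤
        9 / 8 * (backup R M.γ M.c M.P Vstar s x - Vstar s) + (1 - M.γ) * E := by
  obtain ⟨hγ0, hγ1⟩ := M.γ_mem
  have h1γ : 0 < 1 - M.γ := by linarith
  set g : S → A → ℝ := fun s a =>
    (c' s a - M.c s a) + M.γ * ∑ s', M.P s a s' * (W s' - Vstar s') with hg
  have hsplit : ∀ s, ∀ y : A → ℝ, backup R M.γ c' M.P W s y =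
      backup R M.γ M.c M.P Vstar s y + ∑ a, g s a * y a := by
    intro s y
    simp only [backup, qValue, hg, mul_sub, Finset.sum_sub_distrib]
    have : ∀ a, (c' s a + M.γ * ∑ s', M.P s a s' * W s') * y a =
        (M.c s a + M.γ * ∑ s', M.P s a s' * Vstar s') * y a + (c' s a - M.c s a +
          (M.γ * ∑ s', M.P s a s' * W s' - M.γ * ∑ s', M.P s a s' * Vstar s')) * y a :=
      fun a => by ring
    simp only [this, Finset.sum_add_distrib]
    ring
  have hdiff : ∀ s, W s - Vstar s = ∑ a, pstar s a * g s a := by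
    intro s
    have h1 := hW s
    have h2 := hstar.2.1 s
    rw [hsplit] at h1
    have : ∑ a, pstar s a * g s a = ∑ a, g s a * pstar s a :=
      Finset.sum_congr rfl fun a _ => mul_comm _ _
    linarith
  have hpg : ∀ s, ∑ a, pstar s a * g s a = ∑ a, pstar s a * (c' s a - M.c s a) +
      M.γ * ∑ s', kernelMatrix M.P pstar s s' * (W s' - Vstar s') := by
    intro s
    rw [sum_kernelMatrix_mul, Finset.mul_sum, ← Finset.sum_add_distrib]
    exact Finset.sum_congr rfl fun a _ => by simp only [hg]; ring
  have hup := le_of_le_discounted hγ0.le hγ1 (kernelMatrix_mem M.P_mem hstar.1)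
    (Z := fun s => W s - Vstar s) (κ := ε₀) fun s => by
      have := sum_mul_le_of_mem_stdSimplex (hstar.1 s) fun a => (abs_le.1 (hc s a)).2
      rw [hdiff, hpg]
      linarith
  have hlo := le_of_le_discounted hγ0.le hγ1 (kernelMatrix_mem M.P_mem hstar.1)
    (Z := fun s => -(W s - Vstar s)) (κ := ε₀) fun s => by
      have := le_sum_mul_of_mem_stdSimplex (hstar.1 s) fun a => (abs_le.1 (hc s a)).1
      simp only [mul_neg, Finset.sum_neg_distrib]
      rw [hdiff, hpg]
      linarith
  have hgb : ∀ a, |g s a| ≤ ε₀ / (1 - M.γ) := by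
    intro a
    have h1 := sum_mul_le_of_mem_stdSimplex (M.P_mem s a) hup
    have h2 := le_sum_mul_of_mem_stdSimplex (M.P_mem s a) (f := fun s' => W s' - Vstar s')
      fun s' => neg_le.1 (hlo s')
    have h3 := abs_le.1 (hc s a)
    have h4 : ε₀ / (1 - M.γ) = ε₀ + M.γ * (ε₀ / (1 - M.γ)) := by
      field_simp
      ring
    have h5 := mul_le_mul_of_nonneg_left h1 hγ0.le
    have h6 := mul_le_mul_of_nonneg_left h2 hγ0.le
    rw [abs_le, h4]
    simp only [hg]
    constructor <;> linarith
  have hres : backup R M.γ c' M.P W s x - W s =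
      (backup R M.γ M.c M.P Vstar s x - Vstar s) + ∑ a, g s a * (x a - pstar s a) := by
    have h1 := hdiff s
    have h2 : ∑ a, pstar s a * g s a = ∑ a, g s a * pstar s a :=
      Finset.sum_congr rfl fun a _ => mul_comm _ _
    rw [hsplit, sum_mul_sub]
    linarith
  have hlin := abs_sum_mul_le (x := fun a => x a - pstar s a) hgb
  have hgrow := hμ.growth (hstar.1 s) hx (q := qValue M.γ M.c M.P Vstar s) fun z hz => by
    have h1 := hstar.2.2 s z hz
    rw [hstar.2.1 s] at h1
    exact h1
  change backup R M.γ M.c M.P Vstar s (pstar s) + _ ≤ backup R M.γ M.c M.P Vstar s x at hgrow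
  rw [← hstar.2.1 s] at hgrow
  have hH := hE x hx (pstar s) (hstar.1 s)
  have hcomm : ∑ a, |pstar s a - x a| = ∑ a, |x a - pstar s a| :=
    Finset.sum_congr rfl fun a _ => abs_sub_comm _ _
  rw [hcomm] at hgrow
  have := abs_le.1 hlin
  rw [hres]
  constructor <;> linarith

variable [Nonempty S] [DecidableEq S] {pstar : S → A → ℝ} {Vstar : S → ℝ}
  {c' : S → A → ℝ} {W : S → ℝ} {E : ℝ}

/-- If the Bellman residual of `p` for the costs `c'` is at most `9 / 8` of its suboptimality gap,
its value `Y` for these costs exceeds `W` by at most `9 / 8` of its true suboptimality. -/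
theorem value_sub_le_of_residual {p : S → A → ℝ} (hp : IsPolicy p)
    (hres : ∀ s, backup R M.γ c' M.P W s (p s) - W s ≤
      9 / 8 * (backup R M.γ M.c M.P Vstar s (p s) - Vstar s) + (1 - M.γ) * E)
    {Y : S → ℝ} (hY : ∀ s, Y s = backup R M.γ c' M.P Y s (p s)) (s : S) :
    Y s - W s ≤ 9 / 8 * (policyValue M R p s - Vstar s) + E := by
  have h1γ : 0 < 1 - M.γ := by linarith [M.γ_mem.2]
  have := le_of_le_discounted M.γ_mem.1.le M.γ_mem.2 (kernelMatrix_mem M.P_mem hp)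
    (Z := fun s => (Y s - W s) - 9 / 8 * (policyValue M R p s - Vstar s))
    (κ := (1 - M.γ) * E) (fun s => by
      have h1 := hY s
      have h2 := policyValue_eq_backup M R hp s
      have h3 := hres s
      rw [backup_sub R M.γ c' M.P Y W] at h1
      rw [backup_sub R M.γ M.c M.P _ Vstar] at h2
      have h4 : ∑ s', kernelMatrix M.P p s s' *
          ((Y s' - W s') - 9 / 8 * (policyValue M R p s' - Vstar s')) =
          ∑ s', kernelMatrix M.P p s s' * (Y s' - W s') -
            9 / 8 * ∑ s', kernelMatrix M.P p s s' * (policyValue M R p s' - Vstar s') := by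
        rw [Finset.mul_sum, ← Finset.sum_sub_distrib]
        exact Finset.sum_congr rfl fun s' _ => by ring
      rw [h4]
      linarith) s
  rw [mul_div_cancel_left₀ _ h1γ.ne'] at this
  linarith

/-- If the Bellman residual of `p` for the costs `c'` is at least `7 / 8` of its suboptimality gap,
a near super-solution `Y` of its evaluation equation for these costs bounds its true
suboptimality. -/
theorem policyValue_sub_le_of_residual {p : S → A → ℝ} (hp : IsPolicy p) {ξ : ℝ}
    (hres : ∀ s, 7 / 8 * (backup R M.γ M.c M.P Vstar s (p s) - Vstar s) - (1 - M.γ) * E ≤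
      backup R M.γ c' M.P W s (p s) - W s)
    {Y : S → ℝ} (hY : ∀ s, backup R M.γ c' M.P Y s (p s) ≤ Y s + ξ) (s : S) :
    7 / 8 * (policyValue M R p s - Vstar s) ≤ Y s - W s + ξ / (1 - M.γ) + E := by
  have h1γ : 0 < 1 - M.γ := by linarith [M.γ_mem.2]
  have := le_of_le_discounted M.γ_mem.1.le M.γ_mem.2 (kernelMatrix_mem M.P_mem hp)
    (Z := fun s => 7 / 8 * (policyValue M R p s - Vstar s) - (Y s - W s))
    (κ := ξ + (1 - M.γ) * E) (fun s => by
      have h1 := hY s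
      have h2 := policyValue_eq_backup M R hp s
      have h3 := hres s
      rw [backup_sub R M.γ c' M.P Y W] at h1
      rw [backup_sub R M.γ M.c M.P _ Vstar] at h2
      have h4 : ∑ s', kernelMatrix M.P p s s' *
          (7 / 8 * (policyValue M R p s' - Vstar s') - (Y s' - W s')) =
          7 / 8 * ∑ s', kernelMatrix M.P p s s' * (policyValue M R p s' - Vstar s') -
            ∑ s', kernelMatrix M.P p s s' * (Y s' - W s') := by
        rw [Finset.mul_sum, ← Finset.sum_sub_distrib]
        exact Finset.sum_congr rfl fun s' _ => by ring
      rw [h4]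
      linarith) s
  rw [add_div, mul_div_cancel_left₀ _ h1γ.ne'] at this
  linarith

end Perturbation

/-! ### Value mirror descent with bounded errors -/

/-- `p, V` is a run of value mirror descent for the costs `c'` and the true kernel, in which the
action values of iteration `t` carry the error `n t`.  The initial value is a super-solution of the
evaluation equation of the initial policy. -/
structure IsNoisyEpoch {S A : Type*} [Fintype S] [Fintype A] (M : DMDP S A) (R : Regularizer A)
    (d : DistGen A) (μ : ℝ) (c' : S → A → ℝ) (n : ℕ → S → A → ℝ) (p : ℕ → S → A → ℝ)
    (V : ℕ → S → ℝ) : Prop where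
  init_mem : ∀ s, p 0 s ∈ subdiffDomain d.w
  prox : ∀ t s, p (t + 1) s = proxStep R d (2 / (μ * ((t : ℝ) + 1)))
    (fun a => qValue M.γ c' M.P (V t) s a + n t s a) (p t s)
  value : ∀ t s, V (t + 1) s = min (backup R M.γ c' M.P (V t) s (p (t + 1) s) +
    ∑ a, n t s a * p (t + 1) s a) (V t s)
  init_le : ∀ s, backup R M.γ c' M.P (V 0) s (p 0 s) ≤ V 0 s

namespace IsNoisyEpoch

variable {S A : Type*} [Fintype S] [Fintype A] {M : DMDP S A}
  {R : Regularizer A} {d : DistGen A} {μ : ℝ} {c' : S → A → ℝ} {n : ℕ → S → A → ℝ}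
  {p : ℕ → S → A → ℝ} {V : ℕ → S → ℝ}

theorem succ_le (h : IsNoisyEpoch M R d μ c' n p V) (t : ℕ) (s : S) : V (t + 1) s ≤ V t s := by
  rw [h.value]
  exact min_le_right _ _

theorem antitone (h : IsNoisyEpoch M R d μ c' n p V) (s : S) : Antitone fun t => V t s :=
  antitone_nat_of_succ_le fun t => h.succ_le t s

/-- Summation by parts: moving the index costs only a boundary term, since the values decrease. -/
theorem weighted_sum_shift (h : IsNoisyEpoch M R d μ c' n p V) {W : S → ℝ} {z₀ : ℝ}
    (hz : ∀ s, V 0 s - W s ≤ z₀) (s : S) (N : ℕ) :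
    ∑ t ∈ Finset.range N, ((t : ℝ) + 2) * (V t s - W s) ≤
      ∑ t ∈ Finset.range N, ((t : ℝ) + 2) * (V (t + 1) s - W s) +
        (N + 1) * (z₀ - (V N s - W s)) := by
  induction N with
  | zero =>
    have := hz s
    simp
    linarith
  | succ N ih =>
    rw [Finset.sum_range_succ, Finset.sum_range_succ]
    have h1 : V N s ≤ V 0 s := h.antitone s (Nat.zero_le N)
    have h2 := hz s
    push_cast
    linarith

theorem weighted_sum_ge (h : IsNoisyEpoch M R d μ c' n p V) (W : S → ℝ) (s : S) (N : ℕ) :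
    (N * (N + 3) / 2 : ℝ) * (V N s - W s) ≤
      ∑ t ∈ Finset.range N, ((t : ℝ) + 2) * (V (t + 1) s - W s) := by
  have hsum : ∑ t ∈ Finset.range N, ((t : ℝ) + 2) = N * (N + 3) / 2 := by
    clear h
    induction N with
    | zero => simp
    | succ N ih =>
      rw [Finset.sum_range_succ, ih]
      push_cast
      ring
  rw [← hsum, Finset.sum_mul]
  refine Finset.sum_le_sum fun t ht => mul_le_mul_of_nonneg_left ?_ (by positivity)
  have : V N s ≤ V (t + 1) s := h.antitone s (by simpa using ht)
  linarith

variable [Nonempty A]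

theorem mem (h : IsNoisyEpoch M R d μ c' n p V) (hμ : R.StronglyConvex d μ) (t : ℕ) (s : S) :
    p t s ∈ subdiffDomain d.w := by
  cases t with
  | zero => exact h.init_mem s
  | succ t =>
    rw [h.prox]
    have := hμ.1
    exact (proxStep_optimality hμ (by positivity) _ _).1

theorem isPolicy (h : IsNoisyEpoch M R d μ c' n p V) (hμ : R.StronglyConvex d μ) (t : ℕ) :
    IsPolicy (p t) := fun s => (h.mem hμ t s).1

/-- The prox inequality with the stepsize `2 / (μ (t + 1))` inserted. -/
theorem three_point (h : IsNoisyEpoch M R d μ c' n p V) (hμ : R.StronglyConvex d μ) (t : ℕ) (s : S)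
    {y : A → ℝ} (hy : y ∈ stdSimplex ℝ A) :
    backup R M.γ c' M.P (V t) s (p (t + 1) s) + ∑ a, n t s a * p (t + 1) s a +
        μ * (t + 1) / 2 * d.breg (p t s) (p (t + 1) s) +
        μ * (t + 3) / 2 * d.breg (p (t + 1) s) y ≤
      backup R M.γ c' M.P (V t) s y + ∑ a, n t s a * y a +
        μ * (t + 1) / 2 * d.breg (p t s) y := by
  have hμ0 := hμ.1
  have h1 := (proxStep_optimality hμ (η := 2 / (μ * ((t : ℝ) + 1))) (by positivity)
    (fun a => qValue M.γ c' M.P (V t) s a + n t s a) (p t s)).2 y hy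
  rw [← h.prox] at h1
  have h2 := mul_le_mul_of_nonneg_left h1 (show 0 ≤ μ * ((t : ℝ) + 1) / 2 by positivity)
  have hq : ∀ x : A → ℝ, ∑ a, (qValue M.γ c' M.P (V t) s a + n t s a) * x a =
      ∑ a, qValue M.γ c' M.P (V t) s a * x a + ∑ a, n t s a * x a := fun x => by
    simp only [add_mul, Finset.sum_add_distrib]
  have e1 : ∀ b D : ℝ, μ * ((t : ℝ) + 1) / 2 * (2 / (μ * ((t : ℝ) + 1)) * b + D) =
      b + μ * (t + 1) / 2 * D := fun b D => by field_simp
  have e2 : ∀ D : ℝ, μ * ((t : ℝ) + 1) / 2 * ((1 + 2 / (μ * ((t : ℝ) + 1)) * μ) * D) =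
      μ * (t + 3) / 2 * D := fun D => by field_simp; ring
  rw [mul_add, e1, e1, e2, hq, hq] at h2
  simp only [backup]
  linarith

/-- The error bound may presuppose `V 0 - V t ≤ U`: this and the lower bound for `V t` are
propagated together. -/
theorem lower_bound [Nonempty S] (h : IsNoisyEpoch M R d μ c' n p V)
    (hμ : R.StronglyConvex d μ) {T : ℕ} {W : S → ℝ} {β E U z₀ : ℝ} (hβ : 0 ≤ β)
    (hW : ∀ s, ∀ x ∈ stdSimplex ℝ A, W s - (1 - M.γ) * E ≤ backup R M.γ c' M.P W s x)
    (hz : ∀ s, V 0 s - W s ≤ z₀) (hU : z₀ + (β / (1 - M.γ) + E) ≤ U)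
    (hn : ∀ t < T, (∀ s, V 0 s - V t s ≤ U) → ∀ s a, |n t s a| ≤ β) :
    ∀ t ≤ T, ∀ s, W s - (β / (1 - M.γ) + E) ≤ V t s := by
  obtain ⟨hγ0, hγ1⟩ := M.γ_mem
  have h1γ : 0 < 1 - M.γ := by linarith
  set ζ := β / (1 - M.γ) + E with hζ
  have hζe : ζ = β + (1 - M.γ) * E + M.γ * ζ := by
    rw [hζ]
    field_simp
    ring
  intro t
  induction t with
  | zero =>
    intro _ s
    have := le_of_le_discounted hγ0.le hγ1 (kernelMatrix_mem M.P_mem (h.isPolicy hμ 0))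
      (Z := fun s => W s - V 0 s) (κ := (1 - M.γ) * E) (fun s => by
        have h1 := hW s (p 0 s) (h.isPolicy hμ 0 s)
        have h2 := h.init_le s
        rw [backup_sub R M.γ c' M.P W (V 0)] at h1
        linarith) s
    rw [mul_div_cancel_left₀ _ h1γ.ne'] at this
    have := div_nonneg hβ h1γ.le
    linarith
  | succ t ih =>
    intro ht s
    have hlow := ih (by omega)
    have hnb := hn t (by omega) fun s => by linarith [hlow s, hz s]
    rw [h.value]
    refine le_min ?_ (hlow s)
    have h1 := hW s (p (t + 1) s) (h.isPolicy hμ (t + 1) s)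
    have h2 := backup_sub R M.γ c' M.P (V t) W s (p (t + 1))
    have h3 := le_sum_mul_of_mem_stdSimplex
      (kernelMatrix_mem M.P_mem (h.isPolicy hμ (t + 1)) s) (f := fun s' => V t s' - W s')
      (b := -ζ) fun s' => by linarith [hlow s']
    have h4 := mul_le_mul_of_nonneg_left h3 hγ0.le
    have h5 := (abs_le.1 (abs_sum_mul_le_of_mem_stdSimplex (hnb s) (h.isPolicy hμ (t + 1) s))).1
    linarith

/-- The last value is nearly a super-solution for the last policy.  The error enters through
`⟨n, p t - p (t + 1)⟩`, which the Bregman terms of the prox-mapping turn into a summable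
second-order quantity. -/
theorem backup_le (h : IsNoisyEpoch M R d μ c' n p V) (hμ : R.StronglyConvex d μ) {T : ℕ} {β : ℝ}
    (hβ : 0 ≤ β) (hn : ∀ t < T, ∀ s a, |n t s a| ≤ β) :
    ∀ t ≤ T, ∀ s, backup R M.γ c' M.P (V t) s (p t s) ≤
      V t s + (β + β ^ 2 / (2 * μ) * ∑ j ∈ Finset.range t, 1 / ((j : ℝ) + 2)) := by
  have hμ0 := hμ.1
  intro t
  induction t with
  | zero =>
    intro _ s
    have := h.init_le s
    simp only [Finset.range_zero, Finset.sum_empty, mul_zero]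
    linarith
  | succ t ih =>
    intro ht s
    have hpt := h.mem hμ t s
    have hpt' := h.mem hμ (t + 1) s
    have hmono := backup_mono R M.γ_mem.1.le c' M.P_mem (fun s => h.succ_le t s) s hpt'.1
    have hnb := hn t (by omega) s
    have h3 := h.three_point hμ t s hpt.1
    rw [breg_self, mul_zero, add_zero] at h3
    set l := ∑ a, |p t s a - p (t + 1) s a| with hl
    have hD1 := breg_ge d hpt hpt'.1
    have hcomm : ∑ a, |p (t + 1) s a - p t s a| = l :=
      Finset.sum_congr rfl fun a _ => abs_sub_comm _ _
    rw [hcomm] at hD1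
    have hD2 := breg_ge d hpt' hpt.1
    rw [← hl] at hD2
    have hlin := (abs_le.1 (abs_sum_mul_le (x := fun a => p t s a - p (t + 1) s a) hnb)).2
    rw [sum_mul_sub] at hlin
    have h4 := mul_le_mul_of_nonneg_left hD1 (show 0 ≤ μ * ((t : ℝ) + 1) / 2 by positivity)
    have h5 := mul_le_mul_of_nonneg_left hD2 (show 0 ≤ μ * ((t : ℝ) + 3) / 2 by positivity)
    have hamgm : β * l - μ * ((t : ℝ) + 2) / 2 * l ^ 2 ≤ β ^ 2 / (2 * μ) * (1 / ((t : ℝ) + 2)) := by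
      have : β ^ 2 / (2 * μ) * (1 / ((t : ℝ) + 2)) - (β * l - μ * ((t : ℝ) + 2) / 2 * l ^ 2) =
          (β - μ * ((t : ℝ) + 2) * l) ^ 2 / (2 * μ * ((t : ℝ) + 2)) := by
        field_simp
        ring
      have : 0 ≤ (β - μ * ((t : ℝ) + 2) * l) ^ 2 / (2 * μ * ((t : ℝ) + 2)) := by positivity
      linarith
    have h6 := ih (by omega) s
    have h7 := (abs_le.1 (abs_sum_mul_le_of_mem_stdSimplex hnb hpt'.1)).1
    have hsum : 0 ≤ β ^ 2 / (2 * μ) * ∑ j ∈ Finset.range (t + 1), 1 / ((j : ℝ) + 2) :=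
      mul_nonneg (by positivity) (Finset.sum_nonneg fun j _ => by positivity)
    have hstep : backup R M.γ c' M.P (V t) s (p (t + 1) s) ≤
        V t s + (β + β ^ 2 / (2 * μ) * ∑ j ∈ Finset.range (t + 1), 1 / ((j : ℝ) + 2)) := by
      rw [Finset.sum_range_succ, mul_add]
      nlinarith
    rw [h.value]
    rcases min_choice (backup R M.γ c' M.P (V t) s (p (t + 1) s) + ∑ a, n t s a * p (t + 1) s a)
      (V t s) with hm | hm <;> rw [hm] <;> linarith

/-- The telescoped prox inequalities, weighted by `t + 2`, which makes the divergences cancel. -/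
theorem weighted_sum_le (h : IsNoisyEpoch M R d μ c' n p V) (hμ : R.StronglyConvex d μ) {T : ℕ}
    {β : ℝ} (hn : ∀ t < T, ∀ s a, |n t s a| ≤ β) {pstar : S → A → ℝ} (hp : IsPolicy pstar)
    {W : S → ℝ} (hW : ∀ s, W s = backup R M.γ c' M.P W s (pstar s)) :
    ∀ N ≤ T, ∀ s, ∑ t ∈ Finset.range N, ((t : ℝ) + 2) * (V (t + 1) s - W s) +
        μ / 2 * (N + 1) * (N + 2) * d.breg (p N s) (pstar s) ≤
      M.γ * ∑ s', kernelMatrix M.P pstar s s' *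
          ∑ t ∈ Finset.range N, ((t : ℝ) + 2) * (V t s' - W s') +
        β * (N * (N + 3) / 2) + μ * d.breg (p 0 s) (pstar s) := by
  have hμ0 := hμ.1
  intro N
  induction N with
  | zero =>
    intro _ s
    simp
  | succ N ih =>
    intro hN s
    have h1 := ih (by omega) s
    have h2 := h.three_point hμ N s (hp s)
    have h3 := (abs_le.1 (abs_sum_mul_le_of_mem_stdSimplex (hn N (by omega) s) (hp s))).2
    have h4 := breg_ge d (h.mem hμ N s) (h.mem hμ (N + 1) s).1
    have h5 : 0 ≤ d.breg (p N s) (p (N + 1) s) := le_trans (by positivity) h4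
    have h6 : 0 ≤ μ * ((N : ℝ) + 1) / 2 * d.breg (p N s) (p (N + 1) s) := by positivity
    have h7 : V (N + 1) s ≤ _ := (h.value N s).trans_le (min_le_left _ _)
    have h8 := hW s
    rw [backup_sub R M.γ c' M.P (V N) W s pstar] at h2
    have h9 : V (N + 1) s - W s + μ * (N + 3) / 2 * d.breg (p (N + 1) s) (pstar s) ≤
        M.γ * ∑ s', kernelMatrix M.P pstar s s' * (V N s' - W s') + β +
          μ * (N + 1) / 2 * d.breg (p N s) (pstar s) := by linarith
    have h10 := mul_le_mul_of_nonneg_left h9 (show (0 : ℝ) ≤ (N : ℝ) + 2 by positivity)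
    have h11 : ∑ s', kernelMatrix M.P pstar s s' *
        ∑ t ∈ Finset.range (N + 1), ((t : ℝ) + 2) * (V t s' - W s') =
        ∑ s', kernelMatrix M.P pstar s s' *
          ∑ t ∈ Finset.range N, ((t : ℝ) + 2) * (V t s' - W s') +
        ((N : ℝ) + 2) * ∑ s', kernelMatrix M.P pstar s s' * (V N s' - W s') := by
      rw [Finset.mul_sum, ← Finset.sum_add_distrib]
      refine Finset.sum_congr rfl fun s' _ => ?_
      rw [Finset.sum_range_succ]
      ring
    rw [h11, Finset.sum_range_succ]
    push_cast
    linarith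

/-- Bounds at the end of the epoch.  The weighted sum of the values satisfies a discounted
inequality up to the shift of the index, and the last value is below the weighted average because
the values decrease. -/
theorem final_bounds [Nonempty S] (h : IsNoisyEpoch M R d μ c' n p V)
    (hμ : R.StronglyConvex d μ) {T : ℕ} {β z₀ ζ D₀ : ℝ} (hn : ∀ t < T, ∀ s a, |n t s a| ≤ β)
    {pstar : S → A → ℝ} (hp : IsPolicy pstar)
    {W : S → ℝ} (hW : ∀ s, W s = backup R M.γ c' M.P W s (pstar s))
    (hz : ∀ s, V 0 s - W s ≤ z₀) (hζ : ∀ s, W s - ζ ≤ V T s)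
    (hD : ∀ s, μ * d.breg (p 0 s) (pstar s) ≤ D₀) (s : S) :
    (T * (T + 3) / 2 : ℝ) * (V T s - W s) ≤
        (M.γ * ((T + 1) * (z₀ + ζ)) + β * (T * (T + 3) / 2) + D₀) / (1 - M.γ) ∧
      μ / 2 * (T + 1) * (T + 2) * d.breg (p T s) (pstar s) ≤
        (M.γ * ((T + 1) * (z₀ + ζ)) + β * (T * (T + 3) / 2) + D₀) / (1 - M.γ) +
          T * (T + 3) / 2 * ζ := by
  obtain ⟨hγ0, hγ1⟩ := M.γ_mem
  have h1γ : 0 < 1 - M.γ := by linarith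
  have hμ0 := hμ.1
  set κ := M.γ * ((T + 1) * (z₀ + ζ)) + β * (T * (T + 3) / 2) + D₀ with hκ
  set B : S → ℝ := fun s => ∑ t ∈ Finset.range T, ((t : ℝ) + 2) * (V (t + 1) s - W s) with hB
  have hBD : ∀ s, B s + μ / 2 * (T + 1) * (T + 2) * d.breg (p T s) (pstar s) ≤
      M.γ * ∑ s', kernelMatrix M.P pstar s s' * B s' + κ := by
    intro s
    have h1 := h.weighted_sum_le hμ hn hp hW T le_rfl s
    have h2 : ∑ s', kernelMatrix M.P pstar s s' *
        ∑ t ∈ Finset.range T, ((t : ℝ) + 2) * (V t s' - W s') ≤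
        ∑ s', kernelMatrix M.P pstar s s' * B s' + (T + 1) * (z₀ + ζ) := by
      have hK := kernelMatrix_mem M.P_mem hp s
      calc _ ≤ ∑ s', kernelMatrix M.P pstar s s' * (B s' + (T + 1) * (z₀ + ζ)) := by
            refine Finset.sum_le_sum fun s' _ => mul_le_mul_of_nonneg_left ?_ (hK.1 s')
            refine (h.weighted_sum_shift hz s' T).trans (add_le_add_right ?_ _)
            refine mul_le_mul_of_nonneg_left ?_ (by positivity)
            linarith [hζ s']
        _ = _ := by
            simp only [mul_add, Finset.sum_add_distrib, ← Finset.sum_mul]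
            rw [hK.2]
            ring
    have h3 := mul_le_mul_of_nonneg_left h2 hγ0.le
    have h4 := hD s
    rw [mul_add] at h3
    linarith
  have hDnn : ∀ s, 0 ≤ μ / 2 * (T + 1) * (T + 2) * d.breg (p T s) (pstar s) := fun s =>
    mul_nonneg (by positivity) (le_trans (by positivity) (breg_ge d (h.mem hμ T s) (hp s)))
  have hBu := le_of_le_discounted hγ0.le hγ1 (kernelMatrix_mem M.P_mem hp) (Z := B) (κ := κ)
    fun s => by linarith [hBD s, hDnn s]
  have hBl := h.weighted_sum_ge W s T
  refine ⟨hBl.trans (hBu s), ?_⟩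
  have h1 := sum_mul_le_of_mem_stdSimplex (kernelMatrix_mem M.P_mem hp s) hBu
  have h2 := mul_le_mul_of_nonneg_left h1 hγ0.le
  have h3 : κ / (1 - M.γ) = κ + M.γ * (κ / (1 - M.γ)) := by
    field_simp
    ring
  have h4 : (T * (T + 3) / 2 : ℝ) * (-ζ) ≤ (T * (T + 3) / 2 : ℝ) * (V T s - W s) :=
    mul_le_mul_of_nonneg_left (by linarith [hζ s]) (by positivity)
  linarith [hBD s]

/-- One epoch halves the bound `u` on the suboptimality and on the divergence to an optimal policy,
if the errors are small: `β` bounds the errors of the action values as long as the values stay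
within `6 / 5 * u` of the initial one, and `E` is the second-order effect of the perturbed costs. -/
theorem halving [Nonempty S] [DecidableEq S] (h : IsNoisyEpoch M R d μ c' n p V)
    (hμ : R.StronglyConvex d μ) {T : ℕ} {u β E : ℝ} (hu : 0 < u) (hβ : 0 ≤ β)
    (hT : 18 / (1 - M.γ) ≤ T) (hE0 : 0 ≤ E) (hE : E ≤ u / 100)
    (hβ1 : β ≤ (1 - M.γ) * (11 / 200 * u))
    (hβ2 : β ^ 2 / (2 * μ) * (1 + Real.log T) ≤ (1 - M.γ) * (u / 100))
    (hn : ∀ t < T, (∀ s, V 0 s - V t s ≤ 6 / 5 * u) → ∀ s a, |n t s a| ≤ β)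
    {pstar : S → A → ℝ} (hp : IsPolicy pstar) {Vstar W : S → ℝ}
    (hW : ∀ s, W s = backup R M.γ c' M.P W s (pstar s))
    (hopt : ∀ s, ∀ x ∈ stdSimplex ℝ A, Vstar s ≤ backup R M.γ M.c M.P Vstar s x)
    (hres : ∀ s, ∀ x ∈ stdSimplex ℝ A,
      7 / 8 * (backup R M.γ M.c M.P Vstar s x - Vstar s) - (1 - M.γ) * E ≤
        backup R M.γ c' M.P W s x - W s)
    (hz : ∀ s, V 0 s - W s ≤ 9 / 8 * u + E)
    (hD : ∀ s, μ * d.breg (p 0 s) (pstar s) ≤ u) (s : S) :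
    policyValue M R (p T) s - Vstar s ≤ u / 2 ∧ μ * d.breg (p T s) (pstar s) ≤ u / 2 := by
  obtain ⟨hγ0, hγ1⟩ := M.γ_mem
  have h1γ : 0 < 1 - M.γ := by linarith
  have hμ0 := hμ.1
  have hβ' : β / (1 - M.γ) ≤ 11 / 200 * u := by
    rw [div_le_iff₀ h1γ]
    linarith
  have hlow := h.lower_bound hμ (T := T) (U := 6 / 5 * u) (E := E) (W := W) hβ
    (fun s x hx => by linarith [hres s x hx, hopt s x hx]) hz (by linarith) hn
  set ζ := β / (1 - M.γ) + E with hζ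
  have hζu : ζ ≤ 13 / 200 * u := by linarith
  have hζ0 : 0 ≤ ζ := add_nonneg (div_nonneg hβ h1γ.le) hE0
  have hnb : ∀ t < T, ∀ s a, |n t s a| ≤ β := fun t ht =>
    hn t ht fun s => by linarith [hlow t ht.le s, hz s]
  obtain ⟨hV, hB⟩ := h.final_bounds hμ hnb hp hW hz (hlow T le_rfl) hD s
  have hT18 : 18 ≤ (1 - M.γ) * T := by
    rw [div_le_iff₀ h1γ] at hT
    linarith
  have hT18' : (18 : ℝ) ≤ T := hT18.trans (mul_le_of_le_one_left (by positivity) (by linarith))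
  set N : ℝ := T * (T + 3) / 2 with hN
  have hN0 : 0 < N := by positivity
  have hN9 : 9 * (T + 3) ≤ (1 - M.γ) * N := by
    have := mul_le_mul_of_nonneg_right hT18 (show (0 : ℝ) ≤ (T + 3) / 2 by positivity)
    rw [hN]
    linarith
  have hκ : (M.γ * ((T + 1) * (9 / 8 * u + E + ζ)) + β * N + u) / (1 - M.γ) ≤
      97 / 500 * u * N := by
    rw [div_le_iff₀ h1γ]
    have h1 : M.γ * ((T + 1) * (9 / 8 * u + E + ζ)) ≤ (T + 3) * (6 / 5 * u) := by
      have h2 : (T + 1) * (9 / 8 * u + E + ζ) ≤ (T + 3) * (6 / 5 * u) :=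
        mul_le_mul (by linarith) (by linarith) (by positivity) (by positivity)
      refine le_trans ?_ h2
      exact mul_le_of_le_one_left (by positivity) hγ1.le
    have h3 := mul_le_mul_of_nonneg_right hβ1 hN0.le
    have h4 := mul_le_mul_of_nonneg_left hN9 hu.le
    have h5 : u * 21 ≤ u * (T + 3) := mul_le_mul_of_nonneg_left (by linarith) hu.le
    nlinarith
  have hVT : V T s - W s ≤ 97 / 500 * u := by
    have := hV.trans hκ
    refine le_of_mul_le_mul_left ?_ hN0
    linarith
  constructor
  · have hharm : ∑ j ∈ Finset.range T, 1 / ((j : ℝ) + 2) ≤ 1 + Real.log T := by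
      refine le_trans ?_ (harmonic_le_one_add_log T)
      simp only [harmonic, Rat.cast_sum, Rat.cast_inv, Rat.cast_natCast]
      refine Finset.sum_le_sum fun j _ => ?_
      rw [one_div]
      push_cast
      exact inv_anti₀ (by positivity) (by linarith)
    have h1 := mul_le_mul_of_nonneg_left hharm (show 0 ≤ β ^ 2 / (2 * μ) by positivity)
    have h2 := policyValue_sub_le_of_residual (Y := V T) (W := W) (h.isPolicy hμ T)
      (fun s => hres s _ (h.isPolicy hμ T s)) (ξ := β + (1 - M.γ) * (u / 100)) (fun s => by
        have := h.backup_le hμ hβ hnb T le_rfl s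
        linarith) s
    rw [add_div, mul_div_cancel_left₀ _ h1γ.ne'] at h2
    linarith
  · have h1 : (N + 1) * (μ * d.breg (p T s) (pstar s)) ≤ N * (259 / 1000 * u) := by
      have h2 : (N + 1) * (μ * d.breg (p T s) (pstar s)) =
          μ / 2 * (T + 1) * (T + 2) * d.breg (p T s) (pstar s) := by
        rw [hN]
        ring
      rw [h2]
      have h3 := mul_le_mul_of_nonneg_left hζu hN0.le
      linarith
    by_contra hcon
    have := mul_le_mul_of_nonneg_left (not_le.1 hcon).le (show 0 ≤ N + 1 by positivity)
    nlinarith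

end IsNoisyEpoch

/-! ### One epoch of the algorithm -/

section Epoch

variable {S A : Type*} [Fintype S] {M : DMDP S A}

/-- The difference `⟨Q(·|s,a) - P(·|s,a), f⟩` of the expectations of `f` under the kernel `Q` and
under the kernel of the process. -/
def kernelError (M : DMDP S A) (Q : S → A → S → ℝ) (s : S) (a : A) (f : S → ℝ) : ℝ :=
  ∑ s', (Q s a s' - M.P s a s') * f s'

theorem kernelError_eq (Q : S → A → S → ℝ) (s : S) (a : A) (f : S → ℝ) :
    kernelError M Q s a f = ∑ s', Q s a s' * f s' - ∑ s', M.P s a s' * f s' := by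
  rw [← Finset.sum_sub_distrib]
  exact Finset.sum_congr rfl fun s' _ => by ring

theorem abs_kernelError_le {Q : S → A → S → ℝ} (hQ : ∀ s a, Q s a ∈ stdSimplex ℝ S) {f : S → ℝ}
    {b : ℝ} (hf : ∀ s, f s ∈ Set.Icc 0 b) (s : S) (a : A) : |kernelError M Q s a f| ≤ b := by
  have h1 := le_sum_mul_of_mem_stdSimplex (hQ s a) fun s' => (hf s').1
  have h2 := sum_mul_le_of_mem_stdSimplex (hQ s a) fun s' => (hf s').2
  have h3 := le_sum_mul_of_mem_stdSimplex (M.P_mem s a) fun s' => (hf s').1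
  have h4 := sum_mul_le_of_mem_stdSimplex (M.P_mem s a) fun s' => (hf s').2
  rw [kernelError_eq, abs_le]
  constructor <;> linarith

/-- The costs that absorb the error of the reference kernel: with them and the true kernel, the
cost-to-go `V₀` gives the same action values as the true costs and the kernel `Q`. -/
def perturbedCost (M : DMDP S A) (Q : S → A → S → ℝ) (V₀ : S → ℝ) (s : S) (a : A) : ℝ :=
  M.c s a + M.γ * kernelError M Q s a V₀

theorem qValue_perturbedCost (Q : S → A → S → ℝ) (V₀ V : S → ℝ) (s : S) (a : A) :
    qValue M.γ (perturbedCost M Q V₀) M.P V s a =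
      M.c s a + M.γ * (∑ s', Q s a s' * V₀ s' + ∑ s', M.P s a s' * (V s' - V₀ s')) := by
  simp only [qValue, perturbedCost, kernelError_eq, mul_sub, Finset.sum_sub_distrib]
  ring

/-- The kernel `Q` with the row of `(s₀, a₀)` replaced by the true one. -/
def replaceRow (M : DMDP S A) (Q : S → A → S → ℝ) (s₀ : S) (a₀ : A) : S → A → S → ℝ :=
  open Classical in fun s a => if s = s₀ ∧ a = a₀ then M.P s a else Q s a

theorem replaceRow_mem {Q : S → A → S → ℝ} (hQ : ∀ s a, Q s a ∈ stdSimplex ℝ S) (s₀ : S) (a₀ : A)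
    (s : S) (a : A) : replaceRow M Q s₀ a₀ s a ∈ stdSimplex ℝ S := by
  unfold replaceRow
  split_ifs
  · exact M.P_mem s a
  · exact hQ s a

variable [Fintype A] {R : Regularizer A} {d : DistGen A} {μ : ℝ}

theorem backup_perturbedCost (Q : S → A → S → ℝ) (V₀ : S → ℝ) (s : S) (x : A → ℝ) :
    backup R M.γ (perturbedCost M Q V₀) M.P V₀ s x = backup R M.γ M.c Q V₀ s x := by
  simp only [backup, qValue_perturbedCost, sub_self, mul_zero, Finset.sum_const_zero, add_zero]
  rfl

/-- An epoch of the algorithm is value mirror descent for the perturbed costs.  Its action values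
are exact in iteration `0`; in the later ones only the increment `V_t - V₀` is estimated with
error. -/
theorem isNoisyEpoch_svmdEpoch {Q : ℕ → S → A → S → ℝ} {p₀ : S → A → ℝ} {V₀ : S → ℝ}
    (hp₀ : ∀ s, p₀ s ∈ subdiffDomain d.w)
    (hinit : ∀ s, backup R M.γ M.c (Q 0) V₀ s (p₀ s) ≤ V₀ s) :
    IsNoisyEpoch M R d μ (perturbedCost M (Q 0) V₀)
      (fun t s a => if t = 0 then 0 else M.γ * kernelError M (Q t) s a fun s' =>
        (svmdEpoch M R d (fun t => 2 / (μ * ((t : ℝ) + 1))) Q p₀ V₀ t).2 s' - V₀ s')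
      (fun t => (svmdEpoch M R d (fun t => 2 / (μ * ((t : ℝ) + 1))) Q p₀ V₀ t).1)
      (fun t => (svmdEpoch M R d (fun t => 2 / (μ * ((t : ℝ) + 1))) Q p₀ V₀ t).2) := by
  set e := svmdEpoch M R d (fun t => 2 / (μ * ((t : ℝ) + 1))) Q p₀ V₀ with he
  have hq : ∀ t s a, M.c s a + M.γ * (if t = 0 then ∑ s', Q 0 s a s' * V₀ s'
        else ∑ s', Q 0 s a s' * V₀ s' + ∑ s', Q t s a s' * ((e t).2 s' - V₀ s')) =
      qValue M.γ (perturbedCost M (Q 0) V₀) M.P (e t).2 s a +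
        (if t = 0 then 0 else M.γ * kernelError M (Q t) s a fun s' => (e t).2 s' - V₀ s') := by
    intro t s a
    rw [qValue_perturbedCost]
    split_ifs with h
    · subst h
      simp [he, svmdEpoch]
    · rw [kernelError_eq]
      ring
  have hprox : ∀ t s, (e (t + 1)).1 s = proxStep R d (2 / (μ * ((t : ℝ) + 1)))
      (fun a => M.c s a + M.γ * (if t = 0 then ∑ s', Q 0 s a s' * V₀ s'
        else ∑ s', Q 0 s a s' * V₀ s' + ∑ s', Q t s a s' * ((e t).2 s' - V₀ s')))
      ((e t).1 s) := fun t s => rfl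
  refine ⟨hp₀, fun t s => ?_, fun t s => ?_, fun s => ?_⟩
  · rw [hprox]
    simp only [hq]
  · have : (e (t + 1)).2 s = min (∑ a, (M.c s a + M.γ * (if t = 0 then ∑ s', Q 0 s a s' * V₀ s'
        else ∑ s', Q 0 s a s' * V₀ s' + ∑ s', Q t s a s' * ((e t).2 s' - V₀ s'))) *
        (e (t + 1)).1 s a + R.h ((e (t + 1)).1 s)) ((e t).2 s) := rfl
    rw [this]
    simp only [hq, add_mul, Finset.sum_add_distrib, backup]
    congr 1
    ring
  · exact (backup_perturbedCost (M := M) (R := R) (Q 0) V₀ s (p₀ s)).trans_le (hinit s)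

/-- One epoch halves the suboptimality and the divergence to an optimal policy.  The number `ρ`
bounds the relative errors of the kernels of the later iterations; the error of the reference
kernel enters through `hE`. -/
theorem svmdEpoch_halving [Nonempty S] [Nonempty A] [DecidableEq S] (hμ : R.StronglyConvex d μ)
    {T : ℕ} {u H E ε₀ ρ : ℝ} (hu : 0 < u) (huH : u ≤ H / (1 - M.γ)) (hH : 0 < H)
    (hT : 18 / (1 - M.γ) ≤ T)
    (hρ0 : 0 ≤ ρ)
    (hρ : ρ ^ 2 * (2 * (400 * H / μ * (Real.log T + 1) + 16)) ≤ (1 - M.γ) ^ 4)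
    (hE0 : 0 ≤ E) (hEu : E ≤ u / 100)
    (hE : ∀ x ∈ stdSimplex ℝ A, ∀ y ∈ stdSimplex ℝ A, ε₀ / (1 - M.γ) * ∑ a, |x a - y a| ≤
      μ / 16 * (∑ a, |x a - y a|) ^ 2 + (1 - M.γ) * E)
    {Q : ℕ → S → A → S → ℝ} {p₀ : S → A → ℝ} {V₀ : S → ℝ}
    (hp₀ : ∀ s, p₀ s ∈ subdiffDomain d.w)
    (hinit : ∀ s, backup R M.γ M.c (Q 0) V₀ s (p₀ s) ≤ V₀ s)
    (hc : ∀ s a, |perturbedCost M (Q 0) V₀ s a - M.c s a| ≤ ε₀)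
    (hn : ∀ t < T, t ≠ 0 → ∀ s a, |kernelError M (Q t) s a fun s' =>
        (svmdEpoch M R d (fun t => 2 / (μ * ((t : ℝ) + 1))) Q p₀ V₀ t).2 s' - V₀ s'| ≤
      ρ * ‖V₀ - (svmdEpoch M R d (fun t => 2 / (μ * ((t : ℝ) + 1))) Q p₀ V₀ t).2‖)
    {pstar : S → A → ℝ} {Vstar W : S → ℝ} (hstar : IsBellmanPair M R pstar Vstar)
    (hW : ∀ s, W s = backup R M.γ (perturbedCost M (Q 0) V₀) M.P W s (pstar s))
    (hz : ∀ s, V₀ s - W s ≤ 9 / 8 * u + E)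
    (hD : ∀ s, μ * d.breg (p₀ s) (pstar s) ≤ u) (s : S) :
    policyValue M R (svmdEpoch M R d (fun t => 2 / (μ * ((t : ℝ) + 1))) Q p₀ V₀ T).1 s -
        Vstar s ≤ u / 2 ∧
      μ * d.breg ((svmdEpoch M R d (fun t => 2 / (μ * ((t : ℝ) + 1))) Q p₀ V₀ T).1 s)
        (pstar s) ≤ u / 2 := by
  obtain ⟨hγ0, hγ1⟩ := M.γ_mem
  have h1γ : 0 < 1 - M.γ := by linarith
  have hμ0 := hμ.1
  have h := isNoisyEpoch_svmdEpoch (μ := μ) hp₀ hinit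
  have hT1 : (1 : ℝ) ≤ T := by
    refine le_trans ?_ hT
    rw [le_div_iff₀ h1γ]
    linarith
  have hlog : 0 ≤ Real.log T := Real.log_nonneg hT1
  set β := M.γ * (ρ * (6 / 5 * u)) with hβ
  have hβ0 : 0 ≤ β := by positivity
  have hρ1 : ρ ≤ (1 - M.γ) ^ 2 * (9 / 50) := by
    refine abs_le_of_sq_le_sq' ?_ (by positivity) |>.2
    have h1 : 0 ≤ ρ ^ 2 * (2 * (400 * H / μ * (Real.log T + 1))) := by positivity
    have h2 : 0 ≤ (1 - M.γ) ^ 4 := by positivity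
    have h3 : ((1 - M.γ) ^ 2 * (9 / 50)) ^ 2 = (1 - M.γ) ^ 4 * (81 / 2500) := by ring
    rw [h3]
    linarith
  have hβ1 : β ≤ (1 - M.γ) * (11 / 200 * u) := by
    have h1 : M.γ * (1 - M.γ) ≤ 1 / 4 := by nlinarith [sq_nonneg (M.γ - 1 / 2)]
    calc β ≤ M.γ * ((1 - M.γ) ^ 2 * (9 / 50) * (6 / 5 * u)) := by
          refine mul_le_mul_of_nonneg_left (mul_le_mul_of_nonneg_right hρ1 ?_) hγ0.le
          positivity
      _ = M.γ * (1 - M.γ) * ((1 - M.γ) * (27 / 125 * u)) := by ring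
      _ ≤ 1 / 4 * ((1 - M.γ) * (27 / 125 * u)) :=
          mul_le_mul_of_nonneg_right h1 (by positivity)
      _ ≤ _ := by
          have : 0 ≤ (1 - M.γ) * u := by positivity
          linarith
  have hβ2 : β ^ 2 / (2 * μ) * (1 + Real.log T) ≤ (1 - M.γ) * (u / 100) := by
    have h1 : ρ ^ 2 * (800 * H / μ * (Real.log T + 1)) ≤ (1 - M.γ) ^ 4 := by
      have : 0 ≤ ρ ^ 2 * 32 := by positivity
      have h2 : ρ ^ 2 * (2 * (400 * H / μ * (Real.log T + 1) + 16)) =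
        ρ ^ 2 * (800 * H / μ * (Real.log T + 1)) + ρ ^ 2 * 32 := by ring
      linarith
    have h3 : β ^ 2 ≤ ρ ^ 2 * (36 / 25 * u ^ 2) := by
      have h4 : β ≤ ρ * (6 / 5 * u) := mul_le_of_le_one_left (by positivity) hγ1.le
      calc β ^ 2 ≤ (ρ * (6 / 5 * u)) ^ 2 := pow_le_pow_left₀ hβ0 h4 2
        _ = _ := by ring
    have h5 : u * (1 - M.γ) ≤ H := by rwa [le_div_iff₀ h1γ] at huH
    have h6 : (1 - M.γ) ^ 3 ≤ 1 - M.γ := pow_le_of_le_one h1γ.le (by linarith) (by norm_num)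
    calc β ^ 2 / (2 * μ) * (1 + Real.log T)
        ≤ ρ ^ 2 * (36 / 25 * u ^ 2) / (2 * μ) * (1 + Real.log T) := by gcongr
      _ = ρ ^ 2 * (800 * H / μ * (Real.log T + 1)) * (9 / 10000 * u ^ 2 / H) := by
          field_simp
          ring
      _ ≤ (1 - M.γ) ^ 4 * (9 / 10000 * u ^ 2 / H) :=
          mul_le_mul_of_nonneg_right h1 (by positivity)
      _ = (1 - M.γ) ^ 3 * (9 / 10000 * u) * (u * (1 - M.γ) / H) := by ring
      _ ≤ (1 - M.γ) ^ 3 * (9 / 10000 * u) * 1 := by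
          refine mul_le_mul_of_nonneg_left ?_ (by positivity)
          rwa [div_le_one hH]
      _ ≤ (1 - M.γ) * (9 / 10000 * u) * 1 := by gcongr
      _ ≤ _ := by
          have : 0 ≤ (1 - M.γ) * u := by positivity
          linarith
  refine h.halving hμ hu hβ0 hT hE0 hEu hβ1 hβ2 (fun t ht hV s a => ?_) hstar.1 hW hstar.2.2
    (fun s x hx => (hstar.residual_bounds hμ hc hE hW s hx).1) hz hD s
  split_ifs with h0
  · simpa using hβ0
  · rw [abs_mul, abs_of_pos hγ0]
    refine mul_le_mul_of_nonneg_left ((hn t ht h0 s a).trans ?_) hγ0.le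
    refine mul_le_mul_of_nonneg_left ?_ hρ0
    refine (pi_norm_le_iff_of_nonneg (by positivity)).2 fun s' => ?_
    have h1 := hV s'
    have h2 := h.antitone s' (Nat.zero_le t)
    rw [Real.norm_eq_abs, abs_le]
    change _ ≤ V₀ s' - _ ∧ V₀ s' - _ ≤ _
    change V₀ s' - _ ≤ _ at h1
    change _ ≤ V₀ s' at h2
    constructor <;> linarith

theorem sum_kernelMatrix_eq_replaceRow [DecidableEq S] (Q : S → A → S → ℝ) (p : S → A → ℝ)
    (s₀ : S) (a₀ : A) (V : S → ℝ) (s : S) :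
    ∑ s', kernelMatrix Q p s s' * V s' =
      ∑ s', kernelMatrix (replaceRow M Q s₀ a₀) p s s' * V s' +
        p s₀ a₀ * kernelError M Q s₀ a₀ V * (if s = s₀ then 1 else 0) := by
  classical
  rw [sum_kernelMatrix_mul, sum_kernelMatrix_mul]
  by_cases hs : s = s₀
  · subst hs
    have : ∀ a, p s a * ∑ s', Q s a s' * V s' =
        p s a * ∑ s', replaceRow M Q s a₀ s a s' * V s' +
          (if a = a₀ then p s a₀ * kernelError M Q s a₀ V else 0) := by
      intro a
      by_cases ha : a = a₀
      · subst ha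
        simp only [replaceRow, true_and, ite_true, kernelError_eq]
        ring
      · simp [replaceRow, ha]
    simp only [this, Finset.sum_add_distrib]
    simp
  · simp [replaceRow, hs]

/-- Values of the policy `p` for the state costs `r` and the kernel `Q` with the row of
`(s₀, a₀)` replaced by the true one. -/
def leaveOneOutValue [DecidableEq S] (M : DMDP S A) (Q : S → A → S → ℝ) (p : S → A → ℝ) (s₀ : S)
    (a₀ : A) (r : S → ℝ) : S → ℝ :=
  ((1 : Matrix S S ℝ) - M.γ • kernelMatrix (replaceRow M Q s₀ a₀) p)⁻¹.mulVec r

theorem leaveOneOutValue_eq [DecidableEq S] [Nonempty S] {Q : S → A → S → ℝ}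
    (hQ : ∀ s a, Q s a ∈ stdSimplex ℝ S) {p : S → A → ℝ} (hp : IsPolicy p) (s₀ : S) (a₀ : A)
    (r : S → ℝ) (s : S) : leaveOneOutValue M Q p s₀ a₀ r s =
      r s + M.γ * ∑ s', kernelMatrix (replaceRow M Q s₀ a₀) p s s' *
        leaveOneOutValue M Q p s₀ a₀ r s' :=
  resolvent_eq M.γ_mem.1.le M.γ_mem.2 (kernelMatrix_mem (replaceRow_mem hQ s₀ a₀) hp) r s

theorem leaveOneOutValue_mem [DecidableEq S] [Nonempty S] {Q : S → A → S → ℝ}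
    (hQ : ∀ s a, Q s a ∈ stdSimplex ℝ S) {p : S → A → ℝ} (hp : IsPolicy p) (s₀ : S) (a₀ : A)
    {r : S → ℝ} {b : ℝ} (hr : ∀ s, r s ∈ Set.Icc 0 b) (s : S) :
    leaveOneOutValue M Q p s₀ a₀ r s ∈ Set.Icc 0 (b / (1 - M.γ)) :=
  mem_Icc_of_eq_discounted M.γ_mem.1.le M.γ_mem.2
    (kernelMatrix_mem (replaceRow_mem hQ s₀ a₀) hp) hr (leaveOneOutValue_eq hQ hp s₀ a₀ r) s

/-- Decoupling of a row of the kernel from the value it determines: replacing the row is a rank-one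
update, so by the Sherman–Morrison formula the error of the row at `V` is its error at the
leave-one-out value, divided by `1 - γ p(s₀, a₀) e` for the error `e` at the leave-one-out
occupancy. -/
theorem abs_kernelError_le_leaveOneOut [DecidableEq S] [Nonempty S] {Q : S → A → S → ℝ}
    (hQ : ∀ s a, Q s a ∈ stdSimplex ℝ S) {p : S → A → ℝ} (hp : IsPolicy p) {r V : S → ℝ}
    (hV : ∀ s, V s = r s + M.γ * ∑ s', kernelMatrix Q p s s' * V s') (s₀ : S) (a₀ : A)
    (hocc : |kernelError M Q s₀ a₀ (leaveOneOutValue M Q p s₀ a₀ (Pi.single s₀ 1))| ≤ 1 / 2) :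
    |kernelError M Q s₀ a₀ V| ≤ 2 * |kernelError M Q s₀ a₀ (leaveOneOutValue M Q p s₀ a₀ r)| := by
  set X := kernelError M Q s₀ a₀ V with hX
  set V' := leaveOneOutValue M Q p s₀ a₀ r with hV'
  set w := leaveOneOutValue M Q p s₀ a₀ (Pi.single s₀ 1) with hw
  set K := kernelMatrix (replaceRow M Q s₀ a₀) p with hK
  have hKmem : ∀ s, K s ∈ stdSimplex ℝ S := kernelMatrix_mem (replaceRow_mem hQ s₀ a₀) hp
  set z := M.γ * p s₀ a₀ * X with hzdef
  have hdiff : ∀ s, V s - (V' s + z * w s) =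
      M.γ * ∑ s', K s s' * (V s' - (V' s' + z * w s')) := by
    intro s
    have h1 := hV s
    rw [sum_kernelMatrix_eq_replaceRow (M := M) Q p s₀ a₀] at h1
    have h2 : V' s = _ := leaveOneOutValue_eq hQ hp s₀ a₀ r s
    have h3 : w s = _ := leaveOneOutValue_eq hQ hp s₀ a₀ (Pi.single s₀ 1) s
    have h4 : (Pi.single s₀ 1 : S → ℝ) s = if s = s₀ then 1 else 0 := by
      rw [Pi.single_apply]
    rw [h4] at h3
    have h5 : ∑ s', K s s' * (V s' - (V' s' + z * w s')) =
        ∑ s', K s s' * V s' - (∑ s', K s s' * V' s' + z * ∑ s', K s s' * w s') := by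
      rw [Finset.mul_sum, ← Finset.sum_add_distrib, ← Finset.sum_sub_distrib]
      exact Finset.sum_congr rfl fun s' _ => by ring
    rw [h5, h1, h2, h3]
    simp only [← hK, ← hX, ← hV', ← hw]
    rw [hzdef]
    ring
  have heq : ∀ s, V s = V' s + z * w s := by
    intro s
    have h1 := le_of_le_discounted M.γ_mem.1.le M.γ_mem.2 hKmem
      (Z := fun s => V s - (V' s + z * w s)) (κ := 0)
      (fun s => by rw [add_zero]; exact (hdiff s).le) s
    have h2 := le_of_le_discounted M.γ_mem.1.le M.γ_mem.2 hKmem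
      (Z := fun s => -(V s - (V' s + z * w s))) (κ := 0)
      (fun s => by
        simp only [mul_neg, Finset.sum_neg_distrib, add_zero]
        exact neg_le_neg_iff.2 (hdiff s).ge) s
    rw [zero_div] at h1 h2
    linarith
  have hXe : X = kernelError M Q s₀ a₀ V' + z * kernelError M Q s₀ a₀ w := by
    rw [hX]
    simp only [kernelError]
    rw [Finset.mul_sum, ← Finset.sum_add_distrib]
    exact Finset.sum_congr rfl fun s' _ => by rw [heq s']; ring
  have hp1 : p s₀ a₀ ≤ 1 := by
    rw [← (hp s₀).2]
    exact Finset.single_le_sum (fun a _ => (hp s₀).1 a) (Finset.mem_univ a₀)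
  have hp0 := (hp s₀).1 a₀
  have hz : |z| ≤ |X| := by
    rw [hzdef, abs_mul, abs_mul, abs_of_pos M.γ_mem.1, abs_of_nonneg hp0]
    refine mul_le_of_le_one_left (abs_nonneg _) ?_
    exact mul_le_one₀ M.γ_mem.2.le hp0 hp1
  have h1 : |X| ≤ |kernelError M Q s₀ a₀ V'| + |z| * |kernelError M Q s₀ a₀ w| := by
    rw [← abs_mul]
    conv_lhs => rw [hXe]
    exact abs_add_le _ _
  have h2 := mul_le_mul hz hocc (abs_nonneg _) (abs_nonneg _)
  linarith

/-- The error of the reference kernel is of second order.  If `τ` is so large that the occupancy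
errors are not controlled, then `u` exceeds every possible value by far, as `μ ≤ 2 hbar` unless
there is only one action. -/
theorem exists_perturbation_bound [DecidableEq S] [Nonempty S] [Nonempty A]
    (hμ : R.StronglyConvex d μ) {u τ : ℝ} (hu : 0 < u)
    (hτ : 25600 * (1 + R.hbar) ^ 2 * τ ^ 2 ≤ μ * (1 - M.γ) ^ 5 * u)
    {Q : S → A → S → ℝ} (hQ : ∀ s a, Q s a ∈ stdSimplex ℝ S) {p : S → A → ℝ} (hp : IsPolicy p)
    {V : S → ℝ}
    (hV : ∀ s, V s = stageCost M R p s + M.γ * ∑ s', kernelMatrix Q p s s' * V s')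
    (hval : ∀ s a, |kernelError M Q s a (leaveOneOutValue M Q p s a (stageCost M R p))| ≤
      (1 + R.hbar) / (1 - M.γ) * τ)
    (hocc : ∀ s a, |kernelError M Q s a (leaveOneOutValue M Q p s a (Pi.single s 1))| ≤
      1 / (1 - M.γ) * τ) :
    ∃ ε₀, (∀ s a, |perturbedCost M Q V s a - M.c s a| ≤ ε₀) ∧
      ∀ x ∈ stdSimplex ℝ A, ∀ y ∈ stdSimplex ℝ A, ε₀ / (1 - M.γ) * ∑ a, |x a - y a| ≤
        μ / 16 * (∑ a, |x a - y a|) ^ 2 + (1 - M.γ) * (u / 100) := by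
  obtain ⟨hγ0, hγ1⟩ := M.γ_mem
  have h1γ : 0 < 1 - M.γ := by linarith
  have hμ0 := hμ.1
  have hbar0 := R.hbar_nonneg
  have hpert : ∀ s a, |perturbedCost M Q V s a - M.c s a| ≤ |kernelError M Q s a V| := by
    intro s a
    simp only [perturbedCost, add_sub_cancel_left]
    rw [abs_mul, abs_of_pos hγ0]
    exact mul_le_of_le_one_left (abs_nonneg _) hγ1.le
  by_cases hcase : 1 / (1 - M.γ) * τ ≤ 1 / 2
  · refine ⟨2 * ((1 + R.hbar) / (1 - M.γ) * τ), fun s a => ?_, fun x _ y _ => ?_⟩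
    · have h1 := abs_kernelError_le_leaveOneOut hQ hp hV s a ((hocc s a).trans hcase)
      have h2 := hval s a
      have h3 := hpert s a
      linarith
    · set l := ∑ a, |x a - y a|
      set b := 2 * ((1 + R.hbar) / (1 - M.γ) * τ) / (1 - M.γ) with hb
      have h1 : 4 * b ^ 2 / μ ≤ (1 - M.γ) * (u / 100) := by
        have h2 : 4 * b ^ 2 / μ = 25600 * (1 + R.hbar) ^ 2 * τ ^ 2 / (1600 * μ * (1 - M.γ) ^ 4) := by
          rw [hb]
          field_simp
          ring
        rw [h2, div_le_iff₀ (by positivity)]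
        refine hτ.trans ?_
        have : (1 - M.γ) * (u / 100) * (1600 * μ * (1 - M.γ) ^ 4) =
          16 * (μ * (1 - M.γ) ^ 5 * u) := by ring
        rw [this]
        have : 0 ≤ μ * (1 - M.γ) ^ 5 * u := by positivity
        linarith
      have h3 : μ / 16 * l ^ 2 + 4 * b ^ 2 / μ - b * l = (μ * l - 8 * b) ^ 2 / (16 * μ) := by
        field_simp
        ring
      have h4 : 0 ≤ (μ * l - 8 * b) ^ 2 / (16 * μ) := by positivity
      linarith
  · have hV0 : ∀ s, V s ∈ Set.Icc 0 ((1 + R.hbar) / (1 - M.γ)) :=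
      mem_Icc_of_eq_discounted hγ0.le hγ1 (kernelMatrix_mem hQ hp) (stageCost_mem M R hp) hV
    refine ⟨(1 + R.hbar) / (1 - M.γ), fun s a =>
      (hpert s a).trans (abs_kernelError_le hQ hV0 s a), fun x hx y hy => ?_⟩
    rcases subsingleton_or_nontrivial A with hA | hA
    · have hxy : x = y := by
        have h1 := hx.2
        have h2 := hy.2
        ext a
        have : (Finset.univ : Finset A) = {a} := by
          ext b
          simp [Subsingleton.elim b a]
        rw [this, Finset.sum_singleton] at h1 h2
        rw [h1, h2]
      rw [hxy]
      simp only [sub_self, abs_zero, Finset.sum_const_zero, mul_zero]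
      positivity
    · have h1 := hμ.le_hbar
      have h2 : (1 - M.γ) / 2 < τ := by
        rw [not_le, one_div_mul_eq_div, lt_div_iff₀ h1γ] at hcase
        linarith
      have h3 : ((1 - M.γ) / 2) ^ 2 ≤ τ ^ 2 := pow_le_pow_left₀ (by positivity) h2.le 2
      have h4 : 25600 * (1 + R.hbar) ^ 2 * ((1 - M.γ) / 2) ^ 2 ≤
          2 * (1 + R.hbar) * (1 - M.γ) ^ 5 * u := by
        refine (mul_le_mul_of_nonneg_left h3 (by positivity)).trans (hτ.trans ?_)
        have : 0 ≤ (1 - M.γ) ^ 5 * u := by positivity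
        nlinarith
      have h5 : 3200 * (1 + R.hbar) ≤ (1 - M.γ) ^ 3 * u := by
        refine le_of_mul_le_mul_left ?_ (show 0 < 2 * (1 + R.hbar) * (1 - M.γ) ^ 2 by positivity)
        nlinarith
      have h6 : ∑ a, |x a - y a| ≤ 2 := by
        calc ∑ a, |x a - y a| ≤ ∑ a, (x a + y a) := Finset.sum_le_sum fun a _ => by
              rw [abs_le]
              constructor <;> linarith [hx.1 a, hy.1 a]
          _ = 2 := by rw [Finset.sum_add_distrib, hx.2, hy.2]; norm_num
      have h7 : (1 + R.hbar) / (1 - M.γ) / (1 - M.γ) * 2 ≤ (1 - M.γ) * (u / 100) := by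
        rw [div_div, div_mul_eq_mul_div, div_le_iff₀ (by positivity)]
        have : (1 - M.γ) * (u / 100) * ((1 - M.γ) * (1 - M.γ)) = (1 - M.γ) ^ 3 * u / 100 := by ring
        rw [this]
        linarith
      have h8 : (1 + R.hbar) / (1 - M.γ) / (1 - M.γ) * ∑ a, |x a - y a| ≤
          (1 + R.hbar) / (1 - M.γ) / (1 - M.γ) * 2 :=
        mul_le_mul_of_nonneg_left h6 (by positivity)
      have h9 : 0 ≤ μ / 16 * (∑ a, |x a - y a|) ^ 2 := by positivity
      linarith

end Epoch

/-! ### Concentration of empirical means -/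

section Concentration

open MeasureTheory ProbabilityTheory

variable {Ω ι S : Type*} [MeasurableSpace Ω] {ν : Measure Ω} [IsProbabilityMeasure ν]
  [Fintype S] [MeasurableSpace S] [MeasurableSingletonClass S]

theorem integral_comp_eq_sum {X : Ω → S} (hX : Measurable X) {q : S → ℝ}
    (hq : ∀ s, ν.real {ω | X ω = s} = q s) (f : S → ℝ) : ∫ ω, f (X ω) ∂ν = ∑ s, q s * f s := by
  have hf : Measurable f := measurable_of_finite f
  rw [← integral_map hX.aemeasurable hf.aestronglyMeasurable]
  have : IsProbabilityMeasure (ν.map X) := Measure.isProbabilityMeasure_map hX.aemeasurable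
  rw [integral_fintype (Integrable.of_finite)]
  refine Finset.sum_congr rfl fun s _ => ?_
  rw [map_measureReal_apply hX (measurableSet_singleton s), smul_eq_mul, ← hq]
  rfl

/-- One-sided Hoeffding inequality for independent samples of a law `q` on a finite type. -/
theorem measure_mean_sub_ge_le {X : ι → Ω → S} (hX : ∀ j, Measurable (X j)) (hind : iIndepFun X ν)
    {B : Finset ι} {q : S → ℝ} (hq : ∀ j ∈ B, ∀ s, ν.real {ω | X j ω = s} = q s)
    (hB : B.Nonempty) {f : S → ℝ} {lo r L : ℝ} (hr : 0 < r) (hL : 0 ≤ L)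
    (hf : ∀ s, f s ∈ Set.Icc lo (lo + r)) :
    ν.real {ω | r * √(L / (2 * B.card)) ≤
      (1 / (B.card : ℝ)) * ∑ j ∈ B, f (X j ω) - ∑ s, q s * f s} ≤ Real.exp (-L) := by
  have hfm : Measurable f := measurable_of_finite f
  have hm : (0 : ℝ) < B.card := by exact_mod_cast hB.card_pos
  set μ₀ := ∑ s, q s * f s
  have hind' : iIndepFun (fun j ω => f (X j ω) - ∫ ω', f (X j ω') ∂ν) ν :=
    hind.comp (fun j x => f x - ∫ ω', f (X j ω') ∂ν) fun j => measurable_of_finite _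
  have hsub : ∀ j ∈ B, HasSubgaussianMGF (fun ω => f (X j ω) - ∫ ω', f (X j ω') ∂ν)
      ((‖lo + r - lo‖₊ / 2) ^ 2) ν := fun j _ =>
    hasSubgaussianMGF_of_mem_Icc (hfm.comp (hX j)).aemeasurable
      (Filter.Eventually.of_forall fun ω => hf (X j ω))
  have hcoef : 0 ≤ B.card * (r * √(L / (2 * B.card))) := by positivity
  have h := HasSubgaussianMGF.measure_sum_ge_le_of_iIndepFun hind' (s := B) hsub hcoef
  have hset : {ω | r * √(L / (2 * B.card)) ≤ (1 / (B.card : ℝ)) * ∑ j ∈ B, f (X j ω) - μ₀} =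
      {ω | B.card * (r * √(L / (2 * B.card))) ≤
        ∑ j ∈ B, (f (X j ω) - ∫ ω', f (X j ω') ∂ν)} := by
    ext ω
    have h1 : ∑ j ∈ B, (f (X j ω) - ∫ ω', f (X j ω') ∂ν) =
        B.card * ((1 / (B.card : ℝ)) * ∑ j ∈ B, f (X j ω) - μ₀) := by
      rw [Finset.sum_sub_distrib, Finset.sum_congr rfl fun j hj =>
        integral_comp_eq_sum (hX j) (hq j hj) f, Finset.sum_const, nsmul_eq_mul]
      field_simp
      rfl
    simp only [Set.mem_ofPred_eq, h1]
    exact (mul_le_mul_iff_right₀ hm).symm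
  rw [hset]
  refine h.trans (le_of_eq ?_)
  congr 1
  simp only [Finset.sum_const, nsmul_eq_mul]
  push_cast
  rw [add_sub_cancel_left, Real.norm_of_nonneg hr.le, mul_pow, mul_pow,
    Real.sq_sqrt (by positivity)]
  field_simp

/-- Two-sided Hoeffding inequality, with failure probability `2 exp (-L)`. -/
theorem measure_lt_abs_mean_sub_le {X : ι → Ω → S} (hX : ∀ j, Measurable (X j))
    (hind : iIndepFun X ν) {B : Finset ι} {q : S → ℝ} (hq1 : ∑ s, q s = 1)
    (hq : ∀ j ∈ B, ∀ s, ν.real {ω | X j ω = s} = q s)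
    (hB : B.Nonempty) {f : S → ℝ} {lo r L : ℝ} (hr : 0 ≤ r) (hL : 0 ≤ L)
    (hf : ∀ s, f s ∈ Set.Icc lo (lo + r)) :
    ν.real {ω | r * √(L / (2 * B.card)) <
      |(1 / (B.card : ℝ)) * ∑ j ∈ B, f (X j ω) - ∑ s, q s * f s|} ≤ 2 * Real.exp (-L) := by
  -- a constant test function is treated apart: the tail bound needs a positive range
  rcases hr.eq_or_lt with h0 | hr
  · have hconst : ∀ s, f s = lo := fun s => by
      have := hf s
      rw [← h0, add_zero] at this
      exact le_antisymm this.2 this.1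
    have hm : (B.card : ℝ) ≠ 0 := by exact_mod_cast hB.card_pos.ne'
    have hz : ∀ ω, (1 / (B.card : ℝ)) * ∑ j ∈ B, f (X j ω) - ∑ s, q s * f s = 0 := by
      intro ω
      simp only [hconst, Finset.sum_const, nsmul_eq_mul, ← Finset.sum_mul, hq1]
      field_simp
      ring
    simp only [hz, ← h0]
    simp
    positivity
  · have h1 := measure_mean_sub_ge_le hX hind hq hB hr hL hf
    have h2 := measure_mean_sub_ge_le hX hind hq hB (f := fun s => -f s) (lo := -(lo + r)) hr hL
      (fun s => ⟨by linarith [(hf s).2], by linarith [(hf s).1]⟩)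
    have hsub : {ω | r * √(L / (2 * B.card)) <
        |(1 / (B.card : ℝ)) * ∑ j ∈ B, f (X j ω) - ∑ s, q s * f s|} ⊆
        {ω | r * √(L / (2 * B.card)) ≤
          (1 / (B.card : ℝ)) * ∑ j ∈ B, f (X j ω) - ∑ s, q s * f s} ∪
        {ω | r * √(L / (2 * B.card)) ≤
          (1 / (B.card : ℝ)) * ∑ j ∈ B, -f (X j ω) - ∑ s, q s * -f s} := by
      intro ω hω
      simp only [Set.mem_ofPred_eq, Set.mem_union, Finset.sum_neg_distrib, mul_neg] at hω ⊢
      rcases lt_abs.1 hω with h | h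
      · exact Or.inl h.le
      · right
        linarith
    refine (measureReal_mono hsub).trans ((measureReal_union_le _ _).trans ?_)
    linarith

/-- Hoeffding's inequality for a random test function `F` that depends only on samples outside the
batch `B`: condition on those samples. -/
theorem measure_lt_abs_mean_sub_le_of_dependsOn [Nonempty S] {X : ι → Ω → S}
    (hX : ∀ j, Measurable (X j)) (hind : iIndepFun X ν) {B I : Finset ι} (hBI : Disjoint I B)
    {q : S → ℝ} (hq1 : ∑ s, q s = 1)
    (hq : ∀ j ∈ B, ∀ s, ν.real {ω | X j ω = s} = q s) (hB : B.Nonempty)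
    {F : (ι → S) → S → ℝ} {r : (ι → S) → ℝ} {L : ℝ} (hF : DependsOn F (I : Set ι))
    (hrd : DependsOn r (I : Set ι)) (hL : 0 ≤ L)
    (hFr : ∀ x, ∃ lo, ∀ s, F x s ∈ Set.Icc lo (lo + r x)) :
    ν.real {ω | r (fun j => X j ω) * √(L / (2 * B.card)) <
      |(1 / (B.card : ℝ)) * ∑ j ∈ B, F (fun j => X j ω) (X j ω) -
        ∑ s, q s * F (fun j => X j ω) s|} ≤ 2 * Real.exp (-L) := by
  classical
  obtain ⟨s₀⟩ := ‹Nonempty S›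
  let ext : (I → S) → ι → S := fun z j => if h : j ∈ I then z ⟨j, h⟩ else s₀
  let Z : Ω → I → S := fun ω i => X i ω
  let Y : Ω → B → S := fun ω i => X i ω
  have hext : ∀ ω, ∀ j ∈ (I : Set ι), (fun j => X j ω) j = ext (Z ω) j := by
    intro ω j hj
    have hj' : j ∈ I := hj
    simp [ext, Z, hj']
  have hFe : ∀ ω, F (fun j => X j ω) = F (ext (Z ω)) := fun ω => hF (hext ω)
  have hre : ∀ ω, r (fun j => X j ω) = r (ext (Z ω)) := fun ω => hrd (hext ω)
  have hZY : IndepFun Z Y ν := hind.indepFun_finset I B hBI hX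
  have hZm : Measurable Z := measurable_pi_lambda _ fun i => hX i
  let bad : (I → S) → Set (B → S) := fun z => {y | r (ext z) * √(L / (2 * B.card)) <
    |(1 / (B.card : ℝ)) * ∑ j, F (ext z) (y j) - ∑ s, q s * F (ext z) s|}
  have hbad : ∀ z, ν.real (Y ⁻¹' bad z) ≤ 2 * Real.exp (-L) := by
    intro z
    obtain ⟨lo, hlo⟩ := hFr (ext z)
    have hr0 : 0 ≤ r (ext z) := by
      have := (hlo s₀).1.trans (hlo s₀).2
      linarith
    refine le_trans (le_of_eq ?_) (measure_lt_abs_mean_sub_le hX hind hq1 hq hB hr0 hL hlo)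
    congr 1
    ext ω
    simp only [bad, Y, Set.mem_preimage, Set.mem_ofPred_eq]
    rw [Finset.sum_coe_sort B fun j => F (ext z) (X j ω)]
  have hcover : {ω | r (fun j => X j ω) * √(L / (2 * B.card)) <
      |(1 / (B.card : ℝ)) * ∑ j ∈ B, F (fun j => X j ω) (X j ω) -
        ∑ s, q s * F (fun j => X j ω) s|} ⊆ ⋃ z, Z ⁻¹' {z} ∩ Y ⁻¹' bad z := by
    intro ω hω
    simp only [Set.mem_ofPred_eq, hFe, hre] at hω
    refine Set.mem_iUnion.2 ⟨Z ω, rfl, ?_⟩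
    simp only [bad, Y, Set.mem_preimage, Set.mem_ofPred_eq]
    rwa [Finset.sum_coe_sort B fun j => F (ext (Z ω)) (X j ω)]
  have hprod : ∀ z, ν.real (Z ⁻¹' {z} ∩ Y ⁻¹' bad z) =
      ν.real (Z ⁻¹' {z}) * ν.real (Y ⁻¹' bad z) := by
    intro z
    simp only [measureReal_def]
    rw [hZY.measure_inter_preimage_eq_mul _ _ (measurableSet_singleton z)
      (Set.toFinite _).measurableSet, ENNReal.toReal_mul]
  calc _ ≤ ∑ z, ν.real (Z ⁻¹' {z} ∩ Y ⁻¹' bad z) :=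
        (measureReal_mono hcover).trans (measureReal_iUnion_fintype_le _)
    _ ≤ ∑ z, ν.real (Z ⁻¹' {z}) * (2 * Real.exp (-L)) := Finset.sum_le_sum fun z _ => by
        rw [hprod]
        exact mul_le_mul_of_nonneg_left (hbad z) measureReal_nonneg
    _ = 2 * Real.exp (-L) := by
        rw [← Finset.sum_mul]
        have h1 := integral_comp_eq_sum (ν := ν) hZm (q := fun z => ν.real (Z ⁻¹' {z}))
          (fun z => rfl) fun _ => (1 : ℝ)
        simp only [integral_const, probReal_univ, smul_eq_mul, mul_one] at h1
        rw [← h1, one_mul]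

end Concentration

/-! ### The accuracy sequence -/

theorem uSeq_succ (γ hbar μ D0 : ℝ) (k : ℕ) :
    uSeq γ hbar μ D0 (k + 1) = uSeq γ hbar μ D0 k / 2 := by
  unfold uSeq
  rw [pow_succ]
  field_simp

theorem uSeq_pos {γ hbar : ℝ} (hγ : γ < 1) (hh : 0 ≤ hbar) (μ D0 : ℝ) (k : ℕ) :
    0 < uSeq γ hbar μ D0 k := by
  have h1 : 0 < 1 - γ := by linarith
  unfold uSeq
  have : 0 < max ((1 + hbar) / (1 - γ)) (μ * D0) := lt_max_of_lt_left (by positivity)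
  positivity

theorem uSeq_le {γ hbar μ D0 : ℝ} (hγ0 : 0 ≤ γ) (hγ : γ < 1) (hh : 0 ≤ hbar) (hμD : 0 ≤ μ * D0)
    (k : ℕ) : uSeq γ hbar μ D0 k ≤ (1 + hbar + μ * D0) / (1 - γ) := by
  have h1 : 0 < 1 - γ := by linarith
  have h4 : max ((1 + hbar) / (1 - γ)) (μ * D0) ≤ (1 + hbar + μ * D0) / (1 - γ) := by
    refine max_le (div_le_div_of_nonneg_right (by linarith) h1.le) ?_
    rw [le_div_iff₀ h1]
    have := mul_le_of_le_one_right hμD (show 1 - γ ≤ 1 by linarith)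
    linarith
  refine le_trans ?_ h4
  unfold uSeq
  have h5 : (0 : ℝ) ≤ max ((1 + hbar) / (1 - γ)) (μ * D0) := le_max_of_le_right hμD
  refine mul_le_of_le_one_left h5 ?_
  rw [div_le_one (by positivity)]
  exact one_le_pow₀ (by norm_num)

/-! ### Runs of the algorithm on given samples -/

section Run

variable {S A : Type*} [DecidableEq S]

/-- The empirical kernel of iteration `t` of epoch `k`. -/
def epochKernel (m1 m2 : ℕ → ℕ) (x : ℕ → ℕ → S → A → ℕ → S) (k t : ℕ) : S → A → S → ℝ :=
  empirical (batch m1 m2 k t) (x k t)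

theorem epochKernel_row_congr {m1 m2 : ℕ → ℕ} {x x' : ℕ → ℕ → S → A → ℕ → S} {k t : ℕ} {s : S}
    {a : A} (h : ∀ i < batch m1 m2 k t, x k t s a i = x' k t s a i) :
    epochKernel m1 m2 x k t s a = epochKernel m1 m2 x' k t s a := by
  ext s'
  simp only [epochKernel, empirical]
  congr 1
  exact Finset.sum_congr rfl fun i hi => by rw [h i (Finset.mem_range.1 hi)]

variable [Fintype S]

theorem sum_empirical_mul (m : ℕ) (x : S → A → ℕ → S) (s : S) (a : A) (f : S → ℝ) :
    ∑ s', empirical m x s a s' * f s' = (1 / (m : ℝ)) * ∑ i ∈ Finset.range m, f (x s a i) := by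
  simp only [empirical, mul_assoc, ← Finset.mul_sum, Finset.sum_mul]
  rw [Finset.sum_comm]
  simp

theorem empirical_mem {m : ℕ} (hm : 0 < m) (x : S → A → ℕ → S) (s : S) (a : A) :
    empirical m x s a ∈ stdSimplex ℝ S := by
  refine ⟨fun s' => ?_, ?_⟩
  · unfold empirical
    exact mul_nonneg (by positivity) (Finset.sum_nonneg fun i _ => by split_ifs <;> norm_num)
  · have := sum_empirical_mul m x s a fun _ => 1
    simp only [mul_one, Finset.sum_const, Finset.card_range, nsmul_eq_mul] at this
    rw [this]
    field_simp

variable [Fintype A] (M : DMDP S A) (R : Regularizer A) (d : DistGen A) (μ : ℝ) (T : ℕ)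
  (m1 m2 : ℕ → ℕ) (x : ℕ → ℕ → S → A → ℕ → S)

/-- The policy after `k` epochs with the stepsizes `2 / (μ (t + 1))`. -/
def runPolicy (k : ℕ) : S → A → ℝ :=
  svmdPolicy M R d T (fun _ t => 2 / (μ * ((t : ℝ) + 1))) m1 m2 x k

/-- The value with which epoch `k` starts. -/
def runInit (k : ℕ) : S → ℝ :=
  svmdInit M R k (epochKernel m1 m2 x k 0) (runPolicy M R d μ T m1 m2 x k)

/-- The policy and the value after `t` iterations of epoch `k`. -/
def runEpoch (k t : ℕ) : (S → A → ℝ) × (S → ℝ) :=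
  svmdEpoch M R d (fun t => 2 / (μ * ((t : ℝ) + 1))) (epochKernel m1 m2 x k)
    (runPolicy M R d μ T m1 m2 x k) (runInit M R d μ T m1 m2 x k) t

theorem runPolicy_succ (k : ℕ) :
    runPolicy M R d μ T m1 m2 x (k + 1) = (runEpoch M R d μ T m1 m2 x k T).1 := rfl

/-- The samples in `x` are good: the relevant errors of the empirical kernels obey Hoeffding
bounds with the relative accuracies `τ k` for the reference kernel and `ρ k` for the later ones. -/
structure GoodSamples (K : ℕ) (τ ρ : ℕ → ℝ) : Prop where
  value : ∀ k < K, k ≠ 0 → ∀ s a, |kernelError M (epochKernel m1 m2 x k 0) s a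
    (leaveOneOutValue M (epochKernel m1 m2 x k 0) (runPolicy M R d μ T m1 m2 x k) s a
      (stageCost M R (runPolicy M R d μ T m1 m2 x k)))| ≤ (1 + R.hbar) / (1 - M.γ) * τ k
  occupancy : ∀ k < K, k ≠ 0 → ∀ s a, |kernelError M (epochKernel m1 m2 x k 0) s a
    (leaveOneOutValue M (epochKernel m1 m2 x k 0) (runPolicy M R d μ T m1 m2 x k) s a
      (Pi.single s 1))| ≤ 1 / (1 - M.γ) * τ k
  increment : ∀ k < K, ∀ t < T, t ≠ 0 → ∀ s a, |kernelError M (epochKernel m1 m2 x k t) s a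
    fun s' => (runEpoch M R d μ T m1 m2 x k t).2 s' - runInit M R d μ T m1 m2 x k s'| ≤
      ‖runInit M R d μ T m1 m2 x k - (runEpoch M R d μ T m1 m2 x k t).2‖ * ρ k

variable {M R d μ T m1 m2 x}

theorem runPolicy_mem [Nonempty A] (hμ : R.StronglyConvex d μ) (k : ℕ) (s : S) :
    runPolicy M R d μ T m1 m2 x k s ∈ subdiffDomain d.w := by
  induction k with
  | zero => exact uniformDist_mem_subdiffDomain d
  | succ k ih =>
    rw [runPolicy_succ]
    cases T with
    | zero => exact ih
    | succ t =>
      have := hμ.1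
      exact (proxStep_optimality hμ (η := 2 / (μ * ((t : ℝ) + 1))) (by positivity) _ _).1

theorem runEpoch_le_runInit (k t : ℕ) (s : S) :
    (runEpoch M R d μ T m1 m2 x k t).2 s ≤ runInit M R d μ T m1 m2 x k s := by
  induction t with
  | zero => exact le_rfl
  | succ t ih => exact (min_le_right _ _).trans ih

/-- The constant initial value of the first epoch is not affected by the empirical kernel. -/
theorem perturbedCost_runInit_zero (hm : 0 < m1 0) (s : S) (a : A) :
    perturbedCost M (epochKernel m1 m2 x 0 0) (runInit M R d μ T m1 m2 x 0) s a = M.c s a := by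
  have h1 : ∀ s, runInit M R d μ T m1 m2 x 0 s = (1 + R.hbar) / (1 - M.γ) := fun _ => rfl
  have h2 := (empirical_mem (m := batch m1 m2 0 0) (by simpa [batch] using hm) (x 0 0) s a).2
  have h3 := (M.P_mem s a).2
  rw [perturbedCost, kernelError_eq]
  simp only [h1, ← Finset.sum_mul]
  rw [epochKernel, h2, h3]
  ring

variable {D0 : ℝ} [Nonempty S] [Nonempty A]

/-- In the first epoch the constant initial value makes the perturbation vanish; in the later ones
`exists_perturbation_bound` controls it. -/
theorem GoodSamples.halving {K : ℕ} {τ ρ : ℕ → ℝ} (hgood : GoodSamples M R d μ T m1 m2 x K τ ρ)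
    (hμ : R.StronglyConvex d μ) (hT : 18 / (1 - M.γ) ≤ T) {k : ℕ} (hk : k < K) (hm : 0 < m1 k)
    (hD0 : 0 ≤ D0)
    (hρ0 : 0 ≤ ρ k)
    (hρ : ρ k ^ 2 * (2 * (400 * (1 + R.hbar + μ * D0) / μ * (Real.log T + 1) + 16)) ≤
      (1 - M.γ) ^ 4)
    (hτ : 25600 * (1 + R.hbar) ^ 2 * τ k ^ 2 ≤ μ * (1 - M.γ) ^ 5 * uSeq M.γ R.hbar μ D0 k)
    {pstar : S → A → ℝ} {Vstar : S → ℝ} (hstar : IsBellmanPair M R pstar Vstar)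
    (hV : ∀ s, policyValue M R (runPolicy M R d μ T m1 m2 x k) s - Vstar s ≤
      uSeq M.γ R.hbar μ D0 k)
    (hD : ∀ s, μ * d.breg (runPolicy M R d μ T m1 m2 x k s) (pstar s) ≤ uSeq M.γ R.hbar μ D0 k)
    (s : S) :
    policyValue M R (runPolicy M R d μ T m1 m2 x (k + 1)) s - Vstar s ≤
        uSeq M.γ R.hbar μ D0 (k + 1) ∧
      μ * d.breg (runPolicy M R d μ T m1 m2 x (k + 1) s) (pstar s) ≤
        uSeq M.γ R.hbar μ D0 (k + 1) := by
  obtain ⟨hγ0, hγ1⟩ := M.γ_mem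
  have h1γ : 0 < 1 - M.γ := by linarith
  have hμ0 := hμ.1
  have hbar := R.hbar_nonneg
  have hu := uSeq_pos hγ1 hbar μ D0 k
  have huH := uSeq_le hγ0.le hγ1 hbar (mul_nonneg hμ0.le hD0) k
  have hH : 0 < 1 + R.hbar + μ * D0 := by positivity
  set u := uSeq M.γ R.hbar μ D0 k with hudef
  have hpX := runPolicy_mem (M := M) (T := T) (m1 := m1) (m2 := m2) (x := x) hμ k
  have hp : IsPolicy (runPolicy M R d μ T m1 m2 x k) := fun s => (hpX s).1
  have hQ : ∀ s a, epochKernel m1 m2 x k 0 s a ∈ stdSimplex ℝ S := fun s a =>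
    empirical_mem (by simpa [batch] using hm) _ s a
  have hn : ∀ t < T, t ≠ 0 → ∀ s a, |kernelError M (epochKernel m1 m2 x k t) s a
      fun s' => (runEpoch M R d μ T m1 m2 x k t).2 s' - runInit M R d μ T m1 m2 x k s'| ≤
      ρ k * ‖runInit M R d μ T m1 m2 x k - (runEpoch M R d μ T m1 m2 x k t).2‖ := by
    intro t ht h0 s a
    rw [mul_comm]
    exact hgood.increment k hk t ht h0 s a
  rw [uSeq_succ, ← hudef, runPolicy_succ]
  rcases Nat.eq_zero_or_pos k with rfl | hkpos
  · have hinit : ∀ s, runInit M R d μ T m1 m2 x 0 s = (1 + R.hbar) / (1 - M.γ) := fun _ => rfl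
    have hc : perturbedCost M (epochKernel m1 m2 x 0 0) (runInit M R d μ T m1 m2 x 0) = M.c := by
      ext s a
      exact perturbedCost_runInit_zero hm s a
    have hV0 : ∀ s, 0 ≤ Vstar s := fun s => by
      rw [← hstar.policyValue_eq]
      exact (policyValue_mem hstar.1 s).1
    have hu0 : (1 + R.hbar) / (1 - M.γ) ≤ u := by
      rw [hudef]
      unfold uSeq
      simp
    refine svmdEpoch_halving hμ hu huH hH hT hρ0 hρ (E := 0) (ε₀ := 0) le_rfl (by positivity)
      (fun x _ y _ => by rw [zero_div, zero_mul]; positivity) hpX (fun s => ?_) (fun s a => ?_) hn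
      hstar (W := Vstar) (fun s => ?_) (fun s => ?_) hD s
    · rw [backup_eq]
      simp only [hinit, ← Finset.sum_mul]
      rw [(kernelMatrix_mem hQ hp s).2]
      have h1 := (stageCost_mem M R hp s).2
      unfold stageCost at h1
      have h2 : (1 + R.hbar) / (1 - M.γ) =
          1 + R.hbar + M.γ * (1 * ((1 + R.hbar) / (1 - M.γ))) := by
        field_simp
        ring
      linarith
    · rw [hc]
      simp
    · rw [hc]
      exact hstar.2.1 s
    · have := hV0 s
      rw [hinit]
      linarith
  · have hVeq : ∀ s, runInit M R d μ T m1 m2 x k s =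
        stageCost M R (runPolicy M R d μ T m1 m2 x k) s + M.γ * ∑ s',
          kernelMatrix (epochKernel m1 m2 x k 0) (runPolicy M R d μ T m1 m2 x k) s s' *
            runInit M R d μ T m1 m2 x k s' := by
      intro s
      simp only [runInit, svmdInit, hkpos.ne', if_false]
      exact resolvent_eq hγ0.le hγ1 (kernelMatrix_mem hQ hp) _ s
    obtain ⟨ε₀, hε, hE⟩ := exists_perturbation_bound hμ hu hτ hQ hp hVeq
      (hgood.value k hk hkpos.ne') (hgood.occupancy k hk hkpos.ne')
    obtain ⟨W, hW⟩ := exists_eq_backup M R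
      (perturbedCost M (epochKernel m1 m2 x k 0) (runInit M R d μ T m1 m2 x k)) hstar.1
    have hbk : ∀ s, backup R M.γ M.c (epochKernel m1 m2 x k 0) (runInit M R d μ T m1 m2 x k) s
        (runPolicy M R d μ T m1 m2 x k s) = runInit M R d μ T m1 m2 x k s := by
      intro s
      rw [backup_eq, hVeq s]
      rfl
    refine svmdEpoch_halving hμ hu huH hH hT hρ0 hρ (E := u / 100) (ε₀ := ε₀) (by positivity)
      le_rfl hE hpX (fun s => (hbk s).le) hε hn hstar hW (fun s => ?_) hD s
    have h1 := value_sub_le_of_residual hp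
      (fun s => (hstar.residual_bounds hμ hε hE hW s (hp s)).2)
      (Y := runInit M R d μ T m1 m2 x k)
      (fun s => by rw [backup_perturbedCost, hbk]) s
    have h2 := hV s
    linarith

/-- On good samples the suboptimality and the divergence from any optimal policy are halved in every
epoch. -/
theorem GoodSamples.bounds {K : ℕ} {τ ρ : ℕ → ℝ} (hgood : GoodSamples M R d μ T m1 m2 x K τ ρ)
    (hμ : R.StronglyConvex d μ) (hT : 18 / (1 - M.γ) ≤ T) (hm : ∀ k < K, 0 < m1 k)
    (hD0 : ∀ y ∈ stdSimplex ℝ A, d.breg (uniformDist A) y ≤ D0)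
    (hρ0 : ∀ k < K, 0 ≤ ρ k)
    (hρ : ∀ k < K, ρ k ^ 2 *
      (2 * (400 * (1 + R.hbar + μ * D0) / μ * (Real.log T + 1) + 16)) ≤ (1 - M.γ) ^ 4)
    (hτ : ∀ k < K,
      25600 * (1 + R.hbar) ^ 2 * τ k ^ 2 ≤ μ * (1 - M.γ) ^ 5 * uSeq M.γ R.hbar μ D0 k)
    {pstar : S → A → ℝ} {Vstar : S → ℝ} (hstar : IsBellmanPair M R pstar Vstar) :
    ∀ k ≤ K, ∀ s,
      policyValue M R (runPolicy M R d μ T m1 m2 x k) s - Vstar s ≤ uSeq M.γ R.hbar μ D0 k ∧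
      μ * d.breg (runPolicy M R d μ T m1 m2 x k s) (pstar s) ≤ uSeq M.γ R.hbar μ D0 k := by
  have hD0' : 0 ≤ D0 := by
    have := hD0 _ (uniformDist_mem (A := A))
    rwa [breg_self] at this
  intro k
  induction k with
  | zero =>
    intro _ s
    have h1 := (policyValue_mem (M := M) (R := R) (fun s : S =>
      (runPolicy_mem (M := M) (T := T) (m1 := m1) (m2 := m2) (x := x) hμ 0 s).1) s).2
    have h2 := (policyValue_mem (M := M) (R := R) hstar.1 s).1
    rw [hstar.policyValue_eq] at h2
    have h3 : uSeq M.γ R.hbar μ D0 0 = max ((1 + R.hbar) / (1 - M.γ)) (μ * D0) := by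
      simp [uSeq]
    rw [h3]
    refine ⟨le_max_of_le_left ?_, le_max_of_le_right ?_⟩
    · change policyValue M R (runPolicy M R d μ T m1 m2 x 0) s ≤ _ at h1
      linarith
    · exact mul_le_mul_of_nonneg_left (hD0 _ (hstar.1 s)) hμ.1.le
  | succ k ih =>
    intro hk s
    exact hgood.halving hμ hT hk (hm k hk) hD0' (hρ0 k hk) (hρ k hk) (hτ k hk) hstar
      (fun s => (ih (by omega) s).1) (fun s => (ih (by omega) s).2) s

end Run

/-! ### Dependence of a run on the samples -/

section Congruence

variable {S A : Type*} [Fintype S] [Fintype A] {M : DMDP S A} {R : Regularizer A} {d : DistGen A}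

theorem svmdEpoch_congr {η : ℕ → ℝ} {Q Q' : ℕ → S → A → S → ℝ} (p₀ : S → A → ℝ) (V₀ : S → ℝ)
    {t : ℕ} (h : ∀ t' < t, Q t' = Q' t') :
    svmdEpoch M R d η Q p₀ V₀ t = svmdEpoch M R d η Q' p₀ V₀ t := by
  induction t with
  | zero => rfl
  | succ t ih =>
    have h1 := ih fun t' ht' => h t' (by omega)
    have h2 := h 0 (by omega)
    have h3 := h t (by omega)
    simp only [svmdEpoch, h1, h2, h3]

variable [DecidableEq S] {μ : ℝ} {T : ℕ} {m1 m2 : ℕ → ℕ} {x x' : ℕ → ℕ → S → A → ℕ → S}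

theorem runPolicy_congr (hT : 0 < T) {k : ℕ}
    (h : ∀ k' < k, ∀ t < T, epochKernel m1 m2 x k' t = epochKernel m1 m2 x' k' t) :
    runPolicy M R d μ T m1 m2 x k = runPolicy M R d μ T m1 m2 x' k := by
  induction k with
  | zero => rfl
  | succ k ih =>
    have h1 := ih fun k' hk' => h k' (by omega)
    rw [runPolicy_succ, runPolicy_succ, runEpoch, runEpoch, runInit, runInit, h1,
      h k (by omega) 0 hT]
    rw [svmdEpoch_congr _ _ fun t ht => h k (by omega) t ht]

theorem runEpoch_congr (hT : 0 < T) {k t : ℕ} (ht : t ≠ 0)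
    (h : ∀ k' < k, ∀ t < T, epochKernel m1 m2 x k' t = epochKernel m1 m2 x' k' t)
    (h' : ∀ t' < t, epochKernel m1 m2 x k t' = epochKernel m1 m2 x' k t') :
    runInit M R d μ T m1 m2 x k = runInit M R d μ T m1 m2 x' k ∧
      runEpoch M R d μ T m1 m2 x k t = runEpoch M R d μ T m1 m2 x' k t := by
  have h1 := runPolicy_congr (M := M) (R := R) (d := d) (μ := μ) hT h
  have h2 : runInit M R d μ T m1 m2 x k = runInit M R d μ T m1 m2 x' k := by
    rw [runInit, runInit, h1, h' 0 (by omega)]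
  refine ⟨h2, ?_⟩
  rw [runEpoch, runEpoch, h1, h2]
  exact svmdEpoch_congr _ _ h'

theorem leaveOneOutValue_congr {Q Q' : S → A → S → ℝ} (p : S → A → ℝ) (s₀ : S) (a₀ : A)
    (r : S → ℝ) (h : ∀ s a, ¬(s = s₀ ∧ a = a₀) → Q s a = Q' s a) :
    leaveOneOutValue M Q p s₀ a₀ r = leaveOneOutValue M Q' p s₀ a₀ r := by
  have : replaceRow M Q s₀ a₀ = replaceRow M Q' s₀ a₀ := by
    ext s a s'
    unfold replaceRow
    split_ifs with hc
    · rfl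
    · rw [h s a hc]
  rw [leaveOneOutValue, leaveOneOutValue, this]

end Congruence

/-! ### Good samples are likely -/

section Likely

open MeasureTheory ProbabilityTheory

variable {S A : Type*} [Fintype S] [DecidableEq S] [Nonempty S] [MeasurableSpace S]
  [MeasurableSingletonClass S] [Fintype A] {M : DMDP S A}
  {Ω : Type*} [MeasurableSpace Ω] {ν : Measure Ω} [IsProbabilityMeasure ν]
  {X : ℕ → ℕ → S → A → ℕ → Ω → S} {K T : ℕ} {m1 m2 : ℕ → ℕ}

/-- Hoeffding's inequality for the empirical kernel of the batch drawn from `(s, a)` in iteration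
`t` of epoch `k`, and a test function that depends only on the other batches. -/
theorem measure_kernelError_le (hX : ∀ k t s a i, Measurable (X k t s a i))
    (hlaw : ∀ k t s a i s', ν.real {ω | X k t s a i ω = s'} = M.P s a s')
    (hind : iIndepFun (fun j : ℕ × ℕ × S × A × ℕ => X j.1 j.2.1 j.2.2.1 j.2.2.2.1 j.2.2.2.2) ν)
    {k t : ℕ} (hm : 0 < batch m1 m2 k t) (s : S) (a : A)
    {F : (ℕ → ℕ → S → A → ℕ → S) → S → ℝ} {r : (ℕ → ℕ → S → A → ℕ → S) → ℝ} {L : ℝ} (hL : 0 ≤ L)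
    (hdep : ∀ x x' : ℕ → ℕ → S → A → ℕ → S,
      (∀ k' < K, ∀ t' < T, ∀ s' a', ¬(k' = k ∧ t' = t ∧ s' = s ∧ a' = a) →
        epochKernel m1 m2 x k' t' s' a' = epochKernel m1 m2 x' k' t' s' a') →
      F x = F x' ∧ r x = r x')
    (hFr : ∀ x, ∃ lo, ∀ s', F x s' ∈ Set.Icc lo (lo + r x)) :
    ν.real {ω | r (fun k t s a i => X k t s a i ω) * √(L / (2 * batch m1 m2 k t)) <
      |kernelError M (epochKernel m1 m2 (fun k t s a i => X k t s a i ω) k t) s a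
        (F fun k t s a i => X k t s a i ω)|} ≤ 2 * Real.exp (-L) := by
  classical
  -- `N` bounds all batch sizes, so `I` contains all samples outside the batch that `F` can use
  set N := ∑ k ∈ Finset.range K, ∑ t ∈ Finset.range T, batch m1 m2 k t with hN
  have hbN : ∀ k' < K, ∀ t' < T, batch m1 m2 k' t' ≤ N := by
    intro k' hk' t' ht'
    refine le_trans ?_ (Finset.single_le_sum (f := fun k => ∑ t ∈ Finset.range T, batch m1 m2 k t)
      (fun _ _ => Nat.zero_le _) (Finset.mem_range.2 hk'))
    exact Finset.single_le_sum (f := fun t => batch m1 m2 k' t)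
      (fun _ _ => Nat.zero_le _) (Finset.mem_range.2 ht')
  let B : Finset (ℕ × ℕ × S × A × ℕ) :=
    (Finset.range (batch m1 m2 k t)).image fun i => (k, t, s, a, i)
  let I : Finset (ℕ × ℕ × S × A × ℕ) :=
    (Finset.range K ×ˢ Finset.range T ×ˢ Finset.univ ×ˢ Finset.univ ×ˢ Finset.range N).filter
      fun j => ¬(j.1 = k ∧ j.2.1 = t ∧ j.2.2.1 = s ∧ j.2.2.2.1 = a)
  have hinj : Function.Injective fun i : ℕ => (k, t, s, a, i) := fun i j h => by
    simpa using h
  have hBcard : B.card = batch m1 m2 k t := by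
    rw [Finset.card_image_of_injective _ hinj, Finset.card_range]
  have hBI : Disjoint I B := by
    rw [Finset.disjoint_left]
    intro j hj hjB
    obtain ⟨i, -, rfl⟩ := Finset.mem_image.1 hjB
    exact (Finset.mem_filter.1 hj).2 ⟨rfl, rfl, rfl, rfl⟩
  have hdep' : ∀ z z' : ℕ × ℕ × S × A × ℕ → S, (∀ j ∈ (I : Set _), z j = z' j) →
      F (fun k t s a i => z (k, t, s, a, i)) = F (fun k t s a i => z' (k, t, s, a, i)) ∧
      r (fun k t s a i => z (k, t, s, a, i)) = r (fun k t s a i => z' (k, t, s, a, i)) := by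
    intro z z' hz
    refine hdep _ _ fun k' hk' t' ht' s' a' hne => epochKernel_row_congr fun i hi => ?_
    refine hz _ (Finset.mem_coe.2 (Finset.mem_filter.2 ⟨?_, hne⟩))
    simp only [Finset.mem_product, Finset.mem_range, Finset.mem_univ, true_and]
    exact ⟨hk', ht', hi.trans_le (hbN k' hk' t' ht')⟩
  have h := measure_lt_abs_mean_sub_le_of_dependsOn (X := fun j : ℕ × ℕ × S × A × ℕ =>
      X j.1 j.2.1 j.2.2.1 j.2.2.2.1 j.2.2.2.2) (fun j => hX _ _ _ _ _) hind hBI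
    (q := M.P s a) (M.P_mem s a).2 (fun j hj s' => by
      obtain ⟨i, -, rfl⟩ := Finset.mem_image.1 hj
      exact hlaw _ _ _ _ _ _) (by rw [← Finset.card_pos, hBcard]; exact hm)
    (F := fun z => F fun k t s a i => z (k, t, s, a, i))
    (r := fun z => r fun k t s a i => z (k, t, s, a, i))
    (fun z z' hz => (hdep' z z' hz).1) (fun z z' hz => (hdep' z z' hz).2) hL
    (fun z => hFr _)
  refine le_trans (le_of_eq ?_) h
  congr 1
  ext ω
  rw [hBcard]
  simp only [Set.mem_ofPred_eq]
  rw [kernelError_eq, epochKernel, sum_empirical_mul, Finset.sum_image fun i _ j _ h => hinj h]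

variable {R : Regularizer A} {d : DistGen A} {μ : ℝ} [Nonempty A]

/-- Union bound: two events of probability `2 exp (-L1)` for each reference kernel row and one of
probability `2 exp (-L2)` for each later row.  In the first epoch the two conditions of `GoodSamples`
on the reference kernel are void, but counting them does no harm. -/
theorem one_sub_le_measure_goodSamples (hμ : R.StronglyConvex d μ)
    (hX : ∀ k t s a i, Measurable (X k t s a i))
    (hlaw : ∀ k t s a i s', ν.real {ω | X k t s a i ω = s'} = M.P s a s')
    (hind : iIndepFun (fun j : ℕ × ℕ × S × A × ℕ => X j.1 j.2.1 j.2.2.1 j.2.2.2.1 j.2.2.2.2) ν)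
    (hT : 0 < T) (hm1 : ∀ k < K, 0 < m1 k) (hm2 : ∀ k < K, 0 < m2 k) {L1 L2 : ℝ} (hL1 : 0 ≤ L1)
    (hL2 : 0 ≤ L2) :
    1 - K * Fintype.card S * Fintype.card A *
        (4 * Real.exp (-L1) + ((T : ℝ) - 1) * (2 * Real.exp (-L2))) ≤
      ν.real {ω | GoodSamples M R d μ T m1 m2 (fun k t s a i => X k t s a i ω) K
        (fun k => √(L1 / (2 * m1 k))) (fun k => √(L2 / (2 * m2 k)))} := by
  classical
  obtain ⟨hγ0, hγ1⟩ := M.γ_mem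
  have h1γ : 0 < 1 - M.γ := by linarith
  set x : Ω → ℕ → ℕ → S → A → ℕ → S := fun ω k t s a i => X k t s a i ω with hx
  have hbar := R.hbar_nonneg
  let bad1 : ℕ × S × A → Set Ω := fun j => {ω | (1 + R.hbar) / (1 - M.γ) * √(L1 / (2 * m1 j.1)) <
    |kernelError M (epochKernel m1 m2 (x ω) j.1 0) j.2.1 j.2.2
      (leaveOneOutValue M (epochKernel m1 m2 (x ω) j.1 0) (runPolicy M R d μ T m1 m2 (x ω) j.1)
        j.2.1 j.2.2 (stageCost M R (runPolicy M R d μ T m1 m2 (x ω) j.1)))|}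
  let bad2 : ℕ × S × A → Set Ω := fun j => {ω | 1 / (1 - M.γ) * √(L1 / (2 * m1 j.1)) <
    |kernelError M (epochKernel m1 m2 (x ω) j.1 0) j.2.1 j.2.2
      (leaveOneOutValue M (epochKernel m1 m2 (x ω) j.1 0) (runPolicy M R d μ T m1 m2 (x ω) j.1)
        j.2.1 j.2.2 (Pi.single j.2.1 1))|}
  let bad3 : ℕ × ℕ × S × A → Set Ω := fun j =>
    {ω | ‖runInit M R d μ T m1 m2 (x ω) j.1 - (runEpoch M R d μ T m1 m2 (x ω) j.1 j.2.1).2‖ *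
        √(L2 / (2 * m2 j.1)) <
      |kernelError M (epochKernel m1 m2 (x ω) j.1 j.2.1) j.2.2.1 j.2.2.2 fun s' =>
        (runEpoch M R d μ T m1 m2 (x ω) j.1 j.2.1).2 s' - runInit M R d μ T m1 m2 (x ω) j.1 s'|}
  let I1 : Finset (ℕ × S × A) := Finset.range K ×ˢ Finset.univ ×ˢ Finset.univ
  let I3 : Finset (ℕ × ℕ × S × A) :=
    Finset.range K ×ˢ (Finset.range T).erase 0 ×ˢ Finset.univ ×ˢ Finset.univ
  have hb0 : ∀ k, batch m1 m2 k 0 = m1 k := fun k => by simp [batch]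
  have hpol : ∀ y k, IsPolicy (runPolicy M R d μ T m1 m2 y k) := fun y k s =>
    (runPolicy_mem hμ k s).1
  have hcongr : ∀ k < K, ∀ (s : S) (a : A) (y y' : ℕ → ℕ → S → A → ℕ → S),
      (∀ k' < K, ∀ t' < T, ∀ s' a', ¬(k' = k ∧ t' = 0 ∧ s' = s ∧ a' = a) →
        epochKernel m1 m2 y k' t' s' a' = epochKernel m1 m2 y' k' t' s' a') →
      runPolicy M R d μ T m1 m2 y k = runPolicy M R d μ T m1 m2 y' k ∧
      ∀ r, leaveOneOutValue M (epochKernel m1 m2 y k 0) (runPolicy M R d μ T m1 m2 y k) s a r =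
        leaveOneOutValue M (epochKernel m1 m2 y' k 0) (runPolicy M R d μ T m1 m2 y k) s a r := by
    intro k hk s a y y' h
    refine ⟨runPolicy_congr hT fun k' hk' t' ht' => ?_, fun r => ?_⟩
    · ext s' a' : 2
      exact h k' (by omega) t' ht' s' a' (by omega)
    · exact leaveOneOutValue_congr _ _ _ _ fun s' a' hne =>
        h k hk 0 hT s' a' fun hc => hne ⟨hc.2.2.1, hc.2.2.2⟩
  have hQ : ∀ k < K, ∀ y : ℕ → ℕ → S → A → ℕ → S, ∀ s a,
      epochKernel m1 m2 y k 0 s a ∈ stdSimplex ℝ S := fun k hk y s a =>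
    empirical_mem (by rw [hb0]; exact hm1 k hk) _ s a
  have h1 : ∀ j ∈ I1, ν.real (bad1 j) ≤ 2 * Real.exp (-L1) := by
    rintro ⟨k, s, a⟩ hj
    have hk : k < K := Finset.mem_range.1 (Finset.mem_product.1 hj).1
    have := measure_kernelError_le (K := K) (T := T) (m1 := m1) (m2 := m2) hX hlaw hind
      (k := k) (t := 0)
      (by rw [hb0]; exact hm1 k hk) s a (F := fun y => leaveOneOutValue M (epochKernel m1 m2 y k 0)
        (runPolicy M R d μ T m1 m2 y k) s a (stageCost M R (runPolicy M R d μ T m1 m2 y k)))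
      (r := fun _ => (1 + R.hbar) / (1 - M.γ)) hL1
      (fun y y' h => by
        obtain ⟨e1, e2⟩ := hcongr k hk s a y y' h
        refine ⟨?_, rfl⟩
        rw [e2, e1])
      (fun y => ⟨0, fun s' => by
        rw [zero_add]
        exact leaveOneOutValue_mem (hQ k hk y) (hpol y k) s a (stageCost_mem M R (hpol y k)) s'⟩)
    rwa [hb0] at this
  have h2 : ∀ j ∈ I1, ν.real (bad2 j) ≤ 2 * Real.exp (-L1) := by
    rintro ⟨k, s, a⟩ hj
    have hk : k < K := Finset.mem_range.1 (Finset.mem_product.1 hj).1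
    have := measure_kernelError_le (K := K) (T := T) (m1 := m1) (m2 := m2) hX hlaw hind
      (k := k) (t := 0)
      (by rw [hb0]; exact hm1 k hk) s a (F := fun y => leaveOneOutValue M (epochKernel m1 m2 y k 0)
        (runPolicy M R d μ T m1 m2 y k) s a (Pi.single s 1))
      (r := fun _ => 1 / (1 - M.γ)) hL1
      (fun y y' h => by
        obtain ⟨e1, e2⟩ := hcongr k hk s a y y' h
        refine ⟨?_, rfl⟩
        rw [e2, e1])
      (fun y => ⟨0, fun s' => by
        rw [zero_add]
        refine leaveOneOutValue_mem (hQ k hk y) (hpol y k) s a (fun s'' => ?_) s'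
        rw [Pi.single_apply]
        split_ifs <;> norm_num⟩)
    rwa [hb0] at this
  have h3 : ∀ j ∈ I3, ν.real (bad3 j) ≤ 2 * Real.exp (-L2) := by
    rintro ⟨k, t, s, a⟩ hj
    simp only [I3, Finset.mem_product, Finset.mem_range, Finset.mem_erase] at hj
    obtain ⟨hk, ⟨ht0, htT⟩, -⟩ := hj
    have hbt : batch m1 m2 k t = m2 k := by simp [batch, ht0]
    have := measure_kernelError_le (K := K) (T := T) (m1 := m1) (m2 := m2) hX hlaw hind
      (k := k) (t := t) (by rw [hbt]; exact hm2 k hk) s a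
      (F := fun y s' => (runEpoch M R d μ T m1 m2 y k t).2 s' - runInit M R d μ T m1 m2 y k s')
      (r := fun y => ‖runInit M R d μ T m1 m2 y k - (runEpoch M R d μ T m1 m2 y k t).2‖) hL2
      (fun y y' h => by
        obtain ⟨e1, e2⟩ := runEpoch_congr (M := M) (R := R) (d := d) (μ := μ) (m1 := m1)
          (m2 := m2) (x := y) (x' := y') hT (k := k) ht0
          (fun k' hk' t' ht' => by
            ext s' a' : 2
            exact h k' (by omega) t' ht' s' a' (by omega))
          (fun t' ht' => by
            ext s' a' : 2
            exact h k hk t' (by omega) s' a' (by omega))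
        rw [e1, e2]
        exact ⟨rfl, rfl⟩)
      (fun y => ⟨-‖runInit M R d μ T m1 m2 y k - (runEpoch M R d μ T m1 m2 y k t).2‖,
        fun s' => by
          have e1 := norm_le_pi_norm
            (runInit M R d μ T m1 m2 y k - (runEpoch M R d μ T m1 m2 y k t).2) s'
          rw [Pi.sub_apply, Real.norm_eq_abs] at e1
          have e2 := le_abs_self
            (runInit M R d μ T m1 m2 y k s' - (runEpoch M R d μ T m1 m2 y k t).2 s')
          have e3 := runEpoch_le_runInit (M := M) (R := R) (d := d) (μ := μ) (T := T) (m1 := m1)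
            (m2 := m2) (x := y) k t s'
          constructor <;> linarith⟩)
    rwa [hbt] at this
  set good := {ω | GoodSamples M R d μ T m1 m2 (x ω) K
        (fun k => √(L1 / (2 * m1 k))) (fun k => √(L2 / (2 * m2 k)))} with hgood
  have hcover : Set.univ ⊆ good ∪
      ((⋃ j ∈ I1, bad1 j) ∪ (⋃ j ∈ I1, bad2 j) ∪ ⋃ j ∈ I3, bad3 j) := by
    intro ω _
    by_contra hcon
    simp only [Set.mem_union, not_or, Set.mem_iUnion, not_exists] at hcon
    obtain ⟨hg, ⟨n1, n2⟩, n3⟩ := hcon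
    refine hg ⟨fun k hk _ s a => ?_, fun k hk _ s a => ?_, fun k hk t ht h0 s a => ?_⟩
    · exact not_lt.1 (n1 (k, s, a) (by simp [I1, hk]))
    · exact not_lt.1 (n2 (k, s, a) (by simp [I1, hk]))
    · exact not_lt.1 (n3 (k, t, s, a) (by simp [I3, hk, ht, h0]))
  have hc1 : (I1.card : ℝ) = K * Fintype.card S * Fintype.card A := by
    simp [I1, Finset.card_product, mul_assoc]
  have hc3 : (I3.card : ℝ) = K * Fintype.card S * Fintype.card A * ((T : ℝ) - 1) := by
    have : ((Finset.range T).erase 0).card = T - 1 := by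
      rw [Finset.card_erase_of_mem (Finset.mem_range.2 hT), Finset.card_range]
    simp only [I3, Finset.card_product, this, Finset.card_range, Finset.card_univ]
    push_cast [Nat.cast_sub (show 1 ≤ T from hT)]
    ring
  have hsum : ∀ bad : ℕ × S × A → Set Ω, (∀ j ∈ I1, ν.real (bad j) ≤ 2 * Real.exp (-L1)) →
      ν.real (⋃ j ∈ I1, bad j) ≤ I1.card * (2 * Real.exp (-L1)) := fun bad h =>
    (measureReal_biUnion_finset_le I1 bad).trans ((Finset.sum_le_sum h).trans (by
      rw [Finset.sum_const, nsmul_eq_mul]))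
  have e1 := hsum bad1 h1
  have e2 := hsum bad2 h2
  have e3 : ν.real (⋃ j ∈ I3, bad3 j) ≤ I3.card * (2 * Real.exp (-L2)) :=
    (measureReal_biUnion_finset_le I3 bad3).trans ((Finset.sum_le_sum h3).trans (by
      rw [Finset.sum_const, nsmul_eq_mul]))
  have e0 : (1 : ℝ) ≤ ν.real good + (ν.real (⋃ j ∈ I1, bad1 j) + ν.real (⋃ j ∈ I1, bad2 j) +
      ν.real (⋃ j ∈ I3, bad3 j)) := by
    calc (1 : ℝ) = ν.real Set.univ := probReal_univ.symm
      _ ≤ _ := (measureReal_mono hcover).trans ((measureReal_union_le _ _).trans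
        (add_le_add_right ((measureReal_union_le _ _).trans
          (add_le_add_left (measureReal_union_le _ _) _)) _))
  rw [hc1] at e1 e2
  rw [hc3] at e3
  linarith

end Likely

/-! ### The parameters of the algorithm -/

section Parameters

variable {γ hbar μ D0 ε δ : ℝ}

theorem uSeq_numEpochs_le (hγ : γ < 1) (hh : 0 ≤ hbar) (hε : 0 < ε) :
    uSeq γ hbar μ D0 (numEpochs γ hbar μ D0 ε) ≤ ε := by
  have hu := uSeq_pos hγ hh μ D0 0
  have h1 : Real.logb 2 (uSeq γ hbar μ D0 0 / ε) ≤ numEpochs γ hbar μ D0 ε := Nat.le_ceil _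
  rw [Real.logb_le_iff_le_rpow (by norm_num) (by positivity), Real.rpow_natCast,
    div_le_iff₀ hε] at h1
  have h2 : uSeq γ hbar μ D0 (numEpochs γ hbar μ D0 ε) =
      uSeq γ hbar μ D0 0 / 2 ^ numEpochs γ hbar μ D0 ε := by
    unfold uSeq
    simp
    ring
  rw [h2, div_le_iff₀ (by positivity)]
  linarith

theorem eighteen_lt_numIters (hγ0 : 0 < γ) (hγ : γ < 1) : 18 < numIters γ := by
  have h1 : 0 < 1 - γ := by linarith
  rw [numIters, Nat.lt_ceil, lt_div_iff₀ h1]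
  push_cast
  linarith

theorem numIters_le (hγ0 : 0 < γ) (hγ : γ < 1) : (numIters γ : ℝ) ≤ 19 * (1 - γ)⁻¹ := by
  have h1 : 0 < 1 - γ := by linarith
  have h2 := (Nat.ceil_lt_add_one (show 0 ≤ 18 / (1 - γ) by positivity)).le
  have h3 : 1 ≤ (1 - γ)⁻¹ := (one_le_inv₀ h1).2 (by linarith)
  rw [numIters]
  rw [div_eq_mul_inv] at h2
  rw [div_eq_mul_inv]
  linarith

theorem le_mOne_logArg {K nS nA : ℕ} (hnS : 0 < nS) (hnA : 0 < nA) (hδ : δ ∈ Set.Ioo (0 : ℝ) 1)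
    (hK : 0 < K) : 24 ≤ 24 * (K : ℝ) * nS * nA * δ⁻¹ := by
  have h1 : (1 : ℝ) ≤ K := by exact_mod_cast hK
  have h2 : (1 : ℝ) ≤ nS := by exact_mod_cast hnS
  have h3 : (1 : ℝ) ≤ nA := by exact_mod_cast hnA
  have h4 : 1 ≤ δ⁻¹ := (one_le_inv₀ hδ.1).2 hδ.2.le
  have h5 : 1 ≤ (K : ℝ) * nS * nA * δ⁻¹ :=
    one_le_mul_of_one_le_of_one_le (one_le_mul_of_one_le_of_one_le
      (one_le_mul_of_one_le_of_one_le h1 h2) h3) h4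
  linarith

theorem le_mTwo_logArg {K nS nA : ℕ} {t : ℝ} (hnS : 0 < nS) (hnA : 0 < nA)
    (hδ : δ ∈ Set.Ioo (0 : ℝ) 1) (hK : 0 < K) (ht : 1 ≤ t) :
    4 ≤ 4 * (K : ℝ) * t * nS * nA * δ⁻¹ := by
  have h1 := le_mOne_logArg hnS hnA hδ hK
  have h2 := mul_le_mul_of_nonneg_left ht (show 0 ≤ 4 * (K : ℝ) * nS * nA * δ⁻¹ by
    have := hδ.1
    positivity)
  linarith

/-- The relative accuracy `√(L / (2 m))` that the condition on `m_{k,1}` guarantees. -/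
theorem sq_sqrt_div_le_of_mOne_le {L m b v : ℝ} (hL : 0 < L) (hv : 0 < v)
    (hm : 12800 * b / v * L ≤ m) (hm0 : 0 < m) :
    25600 * b * √(L / (2 * m)) ^ 2 ≤ v := by
  rw [Real.sq_sqrt (by positivity)]
  have h1 : 12800 * b * L ≤ m * v := by
    rw [div_mul_eq_mul_div, div_le_iff₀ hv] at hm
    linarith
  have h2 : 25600 * b * (L / (2 * m)) = 12800 * b * L / m := by
    field_simp
    ring
  rw [h2, div_le_iff₀ hm0]
  linarith

/-- The relative accuracy `√(L / (2 m))` that the condition on `m_{k,2}` guarantees. -/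
theorem sq_sqrt_div_le_of_mTwo_le {L m c g : ℝ} (hL : 0 < L) (hg : 0 < g)
    (hm : c * g⁻¹ * L ≤ m) (hm0 : 0 < m) : √(L / (2 * m)) ^ 2 * (2 * c) ≤ g := by
  rw [Real.sq_sqrt (by positivity)]
  have h1 : c * L ≤ m * g := by
    rw [← div_eq_mul_inv, div_mul_eq_mul_div, div_le_iff₀ hg] at hm
    exact hm
  have h2 : L / (2 * m) * (2 * c) = c * L / m := by field_simp
  rw [h2, div_le_iff₀ hm0]
  linarith

end Parameters

/-! ### The guarantee of the output policy -/

section Guarantee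

open MeasureTheory ProbabilityTheory

/-- The required sample sizes are exactly what makes the Hoeffding bounds small enough for
`GoodSamples.bounds`, with failure probability at most `2 / 3 * δ`. -/
theorem one_sub_le_measure_epsOptimal {S : Type*} [Fintype S] [DecidableEq S] [Nonempty S]
    [MeasurableSpace S] [MeasurableSingletonClass S] {A : Type*} [Fintype A] [Nonempty A]
    {M : DMDP S A} {R : Regularizer A} {d : DistGen A} {μ D0 ε δ : ℝ}
    (hμ : R.StronglyConvex d μ) (hD0 : ∀ y ∈ stdSimplex ℝ A, d.breg (uniformDist A) y ≤ D0)
    (hε : 0 < ε) (hδ : δ ∈ Set.Ioo (0 : ℝ) 1) {m1 m2 : ℕ → ℕ}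
    (hm : ∀ k < numEpochs M.γ R.hbar μ D0 ε,
      mOne (Fintype.card S) (Fintype.card A) M.γ R.hbar μ D0 ε δ k ≤ m1 k ∧
      mTwo (Fintype.card S) (Fintype.card A) M.γ R.hbar μ D0 ε δ ≤ m2 k)
    {Ω : Type*} [MeasurableSpace Ω] {ν : Measure Ω} [IsProbabilityMeasure ν]
    {X : ℕ → ℕ → S → A → ℕ → Ω → S} (hX : ∀ k t s a i, Measurable (X k t s a i))
    (hlaw : ∀ k t s a i s', ν.real {ω | X k t s a i ω = s'} = M.P s a s')
    (hind : iIndepFun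
      (fun j : ℕ × ℕ × S × A × ℕ => X j.1 j.2.1 j.2.2.1 j.2.2.2.1 j.2.2.2.2) ν) :
    1 - δ ≤ ν.real {ω |
      let out : S → A → ℝ :=
        svmdPolicy M R d (numIters M.γ) (fun _ t => 2 / (μ * ((t : ℝ) + 1))) m1 m2
          (fun k t s a i => X k t s a i ω) (numEpochs M.γ R.hbar μ D0 ε)
      IsEpsOptimal M R ε out ∧
        ∀ pstar, IsOptimalPolicy M R pstar →
          ∀ s, d.breg (out s) (pstar s) ≤ ε / (μ * (1 - M.γ))} := by
  obtain ⟨hγ0, hγ1⟩ := M.γ_mem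
  have h1γ : 0 < 1 - M.γ := by linarith
  have hμ0 := hμ.1
  have hδ0 := hδ.1
  have hbar := R.hbar_nonneg
  have hD0' : 0 ≤ D0 := by
    have := hD0 _ (uniformDist_mem (A := A))
    rwa [breg_self] at this
  set K := numEpochs M.γ R.hbar μ D0 ε with hK
  set T := numIters M.γ with hT
  have hT18 : 18 < T := eighteen_lt_numIters hγ0 hγ1
  have hT1 : (1 : ℝ) ≤ (T : ℝ) - 1 := by
    have : (18 : ℝ) < T := by exact_mod_cast hT18
    linarith
  have hTγ : 18 / (1 - M.γ) ≤ T := Nat.le_ceil _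
  have hS := Fintype.card_pos (α := S)
  have hA := Fintype.card_pos (α := A)
  set L1 := Real.log (24 * K * Fintype.card S * Fintype.card A * δ⁻¹) with hL1
  set L2 := Real.log (4 * K * ((T : ℝ) - 1) * Fintype.card S * Fintype.card A * δ⁻¹) with hL2
  have hlogT : 0 ≤ Real.log T := Real.log_nonneg (by linarith)
  have hL1pos : 0 < K → 0 < L1 := fun h => Real.log_pos (by linarith [le_mOne_logArg hS hA hδ h])
  have hL2pos : 0 < K → 0 < L2 := fun h =>
    Real.log_pos (by linarith [le_mTwo_logArg hS hA hδ h hT1])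
  have hL1nn : 0 ≤ L1 := by
    rcases Nat.eq_zero_or_pos K with h | h
    · simp [hL1, h]
    · exact (hL1pos h).le
  have hL2nn : 0 ≤ L2 := by
    rcases Nat.eq_zero_or_pos K with h | h
    · simp [hL2, h]
    · exact (hL2pos h).le
  have hone : ∀ k < K, 200 * max (64 * (1 + R.hbar) ^ 2 / μ * ((1 - M.γ) ^ 5)⁻¹ *
      (uSeq M.γ R.hbar μ D0 k)⁻¹ * (Real.log T + 1)) 1 * L1 ≤ m1 k := fun k hk => (hm k hk).1
  have htwo : ∀ k < K, (400 * (1 + R.hbar + μ * D0) / μ * (Real.log T + 1) + 16) *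
      ((1 - M.γ) ^ 4)⁻¹ * L2 ≤ m2 k := fun k hk => (hm k hk).2
  have hm1 : ∀ k < K, 0 < m1 k := fun k hk => by
    have h1 := hL1pos (by omega)
    have h2 := hone k hk
    have h3 : 200 * 1 * L1 ≤ 200 * max (64 * (1 + R.hbar) ^ 2 / μ * ((1 - M.γ) ^ 5)⁻¹ *
      (uSeq M.γ R.hbar μ D0 k)⁻¹ * (Real.log T + 1)) 1 * L1 :=
      mul_le_mul_of_nonneg_right (mul_le_mul_of_nonneg_left (le_max_right _ _) (by norm_num)) h1.le
    have : (0 : ℝ) < m1 k := by linarith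
    exact_mod_cast this
  have hm2 : ∀ k < K, 0 < m2 k := fun k hk => by
    have h1 := hL2pos (by omega)
    have h2 := htwo k hk
    have : (0 : ℝ) < m2 k := lt_of_lt_of_le (by positivity) h2
    exact_mod_cast this
  have hprob := one_sub_le_measure_goodSamples (R := R) (d := d) (μ := μ) hμ hX hlaw hind
    (show 0 < T by omega) hm1 hm2 hL1nn hL2nn
  have hfail : (K : ℝ) * Fintype.card S * Fintype.card A *
      (4 * Real.exp (-L1) + ((T : ℝ) - 1) * (2 * Real.exp (-L2))) ≤ δ := by
    rcases Nat.eq_zero_or_pos K with h | h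
    · rw [h]
      simp
      exact hδ0.le
    · have hKr : (0 : ℝ) < K := by exact_mod_cast h
      have hSr : (0 : ℝ) < Fintype.card S := by exact_mod_cast hS
      have hAr : (0 : ℝ) < Fintype.card A := by exact_mod_cast hA
      have hTr : (0 : ℝ) < (T : ℝ) - 1 := by linarith
      rw [hL1, hL2, Real.exp_neg, Real.exp_neg, Real.exp_log (by positivity),
        Real.exp_log (by positivity)]
      have : (K : ℝ) * Fintype.card S * Fintype.card A *
          (4 * (24 * K * Fintype.card S * Fintype.card A * δ⁻¹)⁻¹ + ((T : ℝ) - 1) *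
            (2 * (4 * K * ((T : ℝ) - 1) * Fintype.card S * Fintype.card A * δ⁻¹)⁻¹)) =
          2 / 3 * δ := by
        field_simp
        ring
      rw [this]
      linarith
  refine le_trans (by linarith) (hprob.trans (measureReal_mono ?_))
  intro ω hgood
  obtain ⟨Vstar, hV⟩ := exists_bellman_fixedPoint (M := M) (R := R)
  have hbounds := fun pstar (hstar : IsBellmanPair M R pstar Vstar) =>
    GoodSamples.bounds hgood hμ hTγ hm1 hD0 (fun k _ => Real.sqrt_nonneg _)
    (fun k hk => sq_sqrt_div_le_of_mTwo_le (hL2pos (by omega)) (by positivity) (htwo k hk)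
      (by exact_mod_cast hm2 k hk))
    (fun k hk => by
      have hu := uSeq_pos hγ1 hbar μ D0 k
      have hL := hL1pos (by omega)
      refine sq_sqrt_div_le_of_mOne_le hL (by positivity) ?_ (by exact_mod_cast hm1 k hk)
      refine le_trans ?_ (hone k hk)
      refine mul_le_mul_of_nonneg_right ?_ hL.le
      have h1 : 64 * (1 + R.hbar) ^ 2 / μ * ((1 - M.γ) ^ 5)⁻¹ * (uSeq M.γ R.hbar μ D0 k)⁻¹ * 1 ≤
          64 * (1 + R.hbar) ^ 2 / μ * ((1 - M.γ) ^ 5)⁻¹ * (uSeq M.γ R.hbar μ D0 k)⁻¹ *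
            (Real.log T + 1) := mul_le_mul_of_nonneg_left (by linarith) (by positivity)
      have h2 := h1.trans (le_max_left _ 1)
      refine le_trans (le_of_eq ?_) (mul_le_mul_of_nonneg_left h2 (by norm_num : (0 : ℝ) ≤ 200))
      field_simp
      ring) hstar K le_rfl
  have huε : uSeq M.γ R.hbar μ D0 K ≤ ε := uSeq_numEpochs_le hγ1 hbar hε
  have hpol : IsPolicy (runPolicy M R d μ T m1 m2 (fun k t s a i => X k t s a i ω) K) :=
    fun s => (runPolicy_mem hμ K s).1
  obtain ⟨p, hp⟩ := exists_isBellmanPair hV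
  refine ⟨⟨hpol, Vstar, hV, fun s => ?_⟩, fun pstar hpstar s => ?_⟩
  · have h1 := hp.le_policyValue hpol s
    have h2 := (hbounds p hp s).1
    change |policyValue M R (runPolicy M R d μ T m1 m2 (fun k t s a i => X k t s a i ω) K) s -
      Vstar s| ≤ ε
    rw [abs_of_nonneg (by linarith)]
    linarith
  · have h2 := (hbounds pstar (hpstar.isBellmanPair hV) s).2
    change d.breg (runPolicy M R d μ T m1 m2 (fun k t s a i => X k t s a i ω) K s) (pstar s) ≤ _
    have h3 : ε ≤ ε / (1 - M.γ) := by
      rw [le_div_iff₀ h1γ]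
      exact mul_le_of_le_one_right hε.le (by linarith)
    rw [mul_comm, ← div_div, le_div_iff₀ hμ0, mul_comm]
    linarith

end Guarantee

/-! ### The number of observations -/

section Count

theorem numObservations_eq (S A : Type*) [Fintype S] [Fintype A] (K : ℕ) {T : ℕ} (hT : 0 < T)
    (m1 m2 : ℕ → ℕ) : (numObservations S A K T m1 m2 : ℝ) =
      Fintype.card S * Fintype.card A *
        ∑ k ∈ Finset.range K, ((m1 k : ℝ) + ((T : ℝ) - 1) * m2 k) := by
  obtain ⟨t, rfl⟩ := Nat.exists_eq_succ_of_ne_zero hT.ne'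
  have h : ∀ k, ∑ t ∈ Finset.range (t + 1), (batch m1 m2 k t : ℝ) = m1 k + t * m2 k := by
    intro k
    rw [Finset.sum_range_succ']
    simp [batch]
    ring
  unfold numObservations
  push_cast
  simp only [Finset.sum_const, Finset.card_univ, nsmul_eq_mul, ← Finset.mul_sum, h,
    Nat.succ_eq_add_one, add_sub_cancel_right]
  ring

theorem sum_inv_uSeq_le {γ hbar μ D0 : ℝ} (hγ : γ < 1) (hh : 0 ≤ hbar) (K : ℕ) :
    ∑ k ∈ Finset.range K, (uSeq γ hbar μ D0 k)⁻¹ ≤ 2 ^ K * (uSeq γ hbar μ D0 0)⁻¹ := by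
  have hu := uSeq_pos hγ hh μ D0 0
  have h : ∀ k, (uSeq γ hbar μ D0 k)⁻¹ = 2 ^ k * (uSeq γ hbar μ D0 0)⁻¹ := fun k => by
    simp [uSeq, mul_comm]
  rw [Finset.sum_congr rfl fun k _ => h k, ← Finset.sum_mul]
  refine mul_le_mul_of_nonneg_right ?_ (by positivity)
  induction K with
  | zero => simp
  | succ K ih =>
    rw [Finset.sum_range_succ, pow_succ]
    linarith

set_option maxHeartbeats 400000 in
/-- All logarithms, `K` and `log T` included, are bounded by multiples of the logarithmic factor `l`.
The first batches cost `∑ 1 / u_k ≤ 2 / ε` times `l ^ 2`.  The later ones are independent of `ε` up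
to the factor `K` and logarithms, and the number `T` of iterations gives them the fifth power of the
horizon. -/
theorem numObservations_le {S : Type*} [Fintype S] [Nonempty S] {A : Type*} [Fintype A]
    [Nonempty A] {γ hbar μ D0 ε δ : ℝ} (hγ0 : 0 < γ) (hγ1 : γ < 1) (hh : 0 ≤ hbar) (hμ : 0 < μ)
    (hD0 : 0 ≤ D0) (hε : 0 < ε) (hε1 : ε ≤ 1) (hδ : δ ∈ Set.Ioo (0 : ℝ) 1) :
    (numObservations S A (numEpochs γ hbar μ D0 ε) (numIters γ)
      (fun k => ⌈mOne (Fintype.card S) (Fintype.card A) γ hbar μ D0 ε δ k⌉₊)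
      (fun _ => ⌈mTwo (Fintype.card S) (Fintype.card A) γ hbar μ D0 ε δ⌉₊) : ℝ) ≤
    20000000 * ((1 + hbar) ^ 2 / μ + D0 + 1) *
      ((Fintype.card S : ℝ) * Fintype.card A * ((1 - γ) ^ 5)⁻¹ * ε⁻¹) *
      (1 + Real.log ((1 + hbar + μ * D0) * Fintype.card S * Fintype.card A /
        ((1 - γ) * ε * δ))) ^ 3 := by
  have h1γ : 0 < 1 - γ := by linarith
  have hδ0 := hδ.1
  have hnS : (1 : ℝ) ≤ Fintype.card S := by exact_mod_cast Fintype.card_pos (α := S)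
  have hnA : (1 : ℝ) ≤ Fintype.card A := by exact_mod_cast Fintype.card_pos (α := A)
  have hT18 : 18 < numIters γ := eighteen_lt_numIters hγ0 hγ1
  have hTle := numIters_le hγ0 hγ1
  rw [numObservations_eq S A _ (by omega)]
  set K := numEpochs γ hbar μ D0 ε with hK
  set T := numIters γ with hT
  set nS : ℝ := ((Fintype.card S : ℕ) : ℝ) with hnSdef
  set nA : ℝ := ((Fintype.card A : ℕ) : ℝ) with hnAdef
  set H := 1 + hbar + μ * D0 with hH
  set g := (1 - γ)⁻¹ with hg
  have hT18r : (18 : ℝ) < T := by exact_mod_cast hT18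
  have hg1 : 1 ≤ g := (one_le_inv₀ h1γ).2 (by linarith)
  have hε1' : 1 ≤ ε⁻¹ := (one_le_inv₀ hε).2 hε1
  have hδ1 : 1 ≤ δ⁻¹ := (one_le_inv₀ hδ0).2 hδ.2.le
  have hH1 : 1 ≤ H := by
    have : 0 ≤ μ * D0 := by positivity
    linarith
  have harg : H * nS * nA / ((1 - γ) * ε * δ) = (H * g * ε⁻¹) * (nS * nA * δ⁻¹) := by
    rw [hg]
    field_simp
  rw [harg]
  set a1 := H * g * ε⁻¹ with ha1
  set a2 := nS * nA * δ⁻¹ with ha2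
  have hHg : 1 ≤ H * g := one_le_mul_of_one_le_of_one_le hH1 hg1
  have ha1' : 1 ≤ a1 := one_le_mul_of_one_le_of_one_le hHg hε1'
  have ha2' : 1 ≤ a2 :=
    one_le_mul_of_one_le_of_one_le (one_le_mul_of_one_le_of_one_le hnS hnA) hδ1
  have hga : g ≤ a1 := by
    have h1 : g ≤ H * g := le_mul_of_one_le_left (by linarith) hH1
    exact h1.trans (le_mul_of_one_le_right (by linarith) hε1')
  rw [Real.log_mul (by linarith) (by linarith)]
  have hl1 : 0 ≤ Real.log a1 := Real.log_nonneg ha1'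
  have hl2 : 0 ≤ Real.log a2 := Real.log_nonneg ha2'
  set l := 1 + (Real.log a1 + Real.log a2) with hl
  have hl1' : 1 ≤ l := by linarith
  rcases Nat.eq_zero_or_pos K with hK0 | hKpos
  · rw [hK0]
    simp only [Finset.range_zero, Finset.sum_empty, mul_zero]
    positivity
  have hKr : (1 : ℝ) ≤ K := by exact_mod_cast hKpos
  have hu := uSeq_pos hγ1 hh μ D0 0
  have huH : uSeq γ hbar μ D0 0 ≤ H * g := by
    rw [hg, ← div_eq_mul_inv]
    exact uSeq_le hγ0.le hγ1 hh (by positivity) 0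
  have hlogb : 0 < Real.logb 2 (uSeq γ hbar μ D0 0 / ε) := Nat.ceil_pos.1 hKpos
  have hKlt : (K : ℝ) < Real.logb 2 (uSeq γ hbar μ D0 0 / ε) + 1 := Nat.ceil_lt_add_one hlogb.le
  have hKl : (K : ℝ) ≤ 2 * l := by
    have h1 : Real.log (uSeq γ hbar μ D0 0 / ε) ≤ Real.log a1 := by
      refine Real.log_le_log (by positivity) ?_
      rw [div_eq_mul_inv]
      exact mul_le_mul_of_nonneg_right huH (by linarith)
    have h2 : Real.logb 2 (uSeq γ hbar μ D0 0 / ε) ≤ 2 * Real.log a1 := by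
      have h3 := Real.log_two_gt_d9
      rw [Real.logb, div_le_iff₀ (by linarith)]
      nlinarith
    linarith
  have h2K : 2 ^ K * (uSeq γ hbar μ D0 0)⁻¹ ≤ 2 * ε⁻¹ := by
    have h1 : (2 : ℝ) ^ (K : ℝ) ≤ 2 ^ (Real.logb 2 (uSeq γ hbar μ D0 0 / ε) + 1) :=
      Real.rpow_le_rpow_of_exponent_le (by norm_num) hKlt.le
    rw [Real.rpow_natCast, Real.rpow_add (by norm_num), Real.rpow_logb (by norm_num)
      (by norm_num) (by positivity), Real.rpow_one] at h1
    calc 2 ^ K * (uSeq γ hbar μ D0 0)⁻¹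
        ≤ uSeq γ hbar μ D0 0 / ε * 2 * (uSeq γ hbar μ D0 0)⁻¹ := by gcongr
      _ = 2 * ε⁻¹ := by field_simp
  have hlogT : Real.log T ≤ 18 + Real.log a1 := by
    calc Real.log T ≤ Real.log (19 * g) := Real.log_le_log (by linarith) hTle
      _ = Real.log 19 + Real.log g := Real.log_mul (by norm_num) (by linarith)
      _ ≤ _ := by
        have h1 := Real.log_le_sub_one_of_pos (show (0 : ℝ) < 19 by norm_num)
        have h2 := Real.log_le_log (by linarith) hga
        linarith
  have hlogT0 : 0 ≤ Real.log T := Real.log_nonneg (by linarith)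
  have hlogK : Real.log K ≤ 2 * l := by
    have := Real.log_le_sub_one_of_pos (show (0 : ℝ) < K by linarith)
    linarith
  have hL1 : Real.log (24 * K * nS * nA * δ⁻¹) ≤ 26 * l := by
    have h1 : 24 * K * nS * nA * δ⁻¹ = 24 * (K * a2) := by rw [ha2]; ring
    rw [h1, Real.log_mul (by norm_num) (by positivity), Real.log_mul (by positivity) (by positivity)]
    have := Real.log_le_sub_one_of_pos (show (0 : ℝ) < 24 by norm_num)
    linarith
  have hL2 : Real.log (4 * K * ((T : ℝ) - 1) * nS * nA * δ⁻¹) ≤ 25 * l := by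
    have hT0 : 0 < (T : ℝ) - 1 := by linarith
    have h1 : 4 * K * ((T : ℝ) - 1) * nS * nA * δ⁻¹ = 4 * (K * (((T : ℝ) - 1) * a2)) := by
      rw [ha2]; ring
    rw [h1, Real.log_mul (by norm_num) (by positivity), Real.log_mul (by positivity) (by positivity),
      Real.log_mul (by positivity) (by positivity)]
    have h2 := Real.log_le_sub_one_of_pos (show (0 : ℝ) < 4 by norm_num)
    have h3 := Real.log_le_log hT0 (show (T : ℝ) - 1 ≤ T by linarith)
    linarith
  have hL1nn : 0 ≤ Real.log (24 * K * nS * nA * δ⁻¹) :=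
    Real.log_nonneg (by
      linarith [le_mOne_logArg (Fintype.card_pos (α := S)) (Fintype.card_pos (α := A)) hδ hKpos])
  have hL2nn : 0 ≤ Real.log (4 * K * ((T : ℝ) - 1) * nS * nA * δ⁻¹) :=
    Real.log_nonneg (by
      linarith [le_mTwo_logArg (Fintype.card_pos (α := S)) (Fintype.card_pos (α := A)) hδ hKpos
        (show (1 : ℝ) ≤ (T : ℝ) - 1 by linarith)])
  set b := (1 + hbar) ^ 2 / μ with hb
  have hb0 : 0 ≤ b := by positivity
  have hone : ∀ k, mOne (Fintype.card S) (Fintype.card A) γ hbar μ D0 ε δ k ≤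
      6323200 * b * g ^ 5 * l ^ 2 * (uSeq γ hbar μ D0 k)⁻¹ + 5200 * l := by
    intro k
    have huk := uSeq_pos hγ1 hh μ D0 k
    have h1 : max (64 * (1 + hbar) ^ 2 / μ * ((1 - γ) ^ 5)⁻¹ * (uSeq γ hbar μ D0 k)⁻¹ *
        (Real.log T + 1)) 1 ≤ 64 * b * g ^ 5 * (uSeq γ hbar μ D0 k)⁻¹ * (19 * l) + 1 := by
      have h2 : 64 * (1 + hbar) ^ 2 / μ * ((1 - γ) ^ 5)⁻¹ * (uSeq γ hbar μ D0 k)⁻¹ *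
          (Real.log T + 1) = 64 * b * g ^ 5 * (uSeq γ hbar μ D0 k)⁻¹ * (Real.log T + 1) := by
        rw [hb, hg, inv_pow]
        ring
      have h3 : 64 * b * g ^ 5 * (uSeq γ hbar μ D0 k)⁻¹ * (Real.log T + 1) ≤
          64 * b * g ^ 5 * (uSeq γ hbar μ D0 k)⁻¹ * (19 * l) :=
        mul_le_mul_of_nonneg_left (by linarith) (by positivity)
      have h4 : 0 ≤ 64 * b * g ^ 5 * (uSeq γ hbar μ D0 k)⁻¹ * (19 * l) := by positivity
      rw [h2]
      exact max_le (by linarith) (by linarith)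
    calc mOne (Fintype.card S) (Fintype.card A) γ hbar μ D0 ε δ k
        ≤ 200 * (64 * b * g ^ 5 * (uSeq γ hbar μ D0 k)⁻¹ * (19 * l) + 1) * (26 * l) :=
          mul_le_mul (mul_le_mul_of_nonneg_left h1 (by norm_num)) hL1 hL1nn (by positivity)
      _ = _ := by ring
  have htwo : mTwo (Fintype.card S) (Fintype.card A) γ hbar μ D0 ε δ ≤
      190000 * (b + D0) * g ^ 4 * l ^ 2 + 400 * g ^ 4 * l := by
    have h1 : H / μ ≤ b + D0 := by
      have h2 : H / μ = (1 + hbar) / μ + D0 := by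
        rw [hH]
        field_simp
      have h3 : (1 + hbar) / μ ≤ b := by
        rw [hb]
        gcongr
        nlinarith
      linarith
    have h4 : 400 * H / μ * (Real.log T + 1) + 16 ≤ 400 * (b + D0) * (19 * l) + 16 := by
      rw [mul_div_assoc]
      gcongr
      linarith
    calc mTwo (Fintype.card S) (Fintype.card A) γ hbar μ D0 ε δ
        ≤ (400 * (b + D0) * (19 * l) + 16) * ((1 - γ) ^ 4)⁻¹ * (25 * l) :=
          mul_le_mul (mul_le_mul_of_nonneg_right h4 (by positivity)) hL2 hL2nn (by positivity)
      _ = _ := by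
        rw [hg, inv_pow]
        ring
  have hceil : ∀ x y : ℝ, x ≤ y → 0 ≤ y → (⌈x⌉₊ : ℝ) ≤ y + 1 := fun x y hxy hy =>
    (Nat.cast_le.2 (Nat.ceil_mono hxy)).trans (Nat.ceil_lt_add_one hy).le
  have hg5 : 1 ≤ g ^ 5 := one_le_pow₀ hg1
  have hg4 : 1 ≤ g ^ 4 := one_le_pow₀ hg1
  set c := b + D0 + 1 with hc
  have hc1 : 1 ≤ c := by linarith
  have hsum1 : ∑ k ∈ Finset.range K,
      (⌈mOne (Fintype.card S) (Fintype.card A) γ hbar μ D0 ε δ k⌉₊ : ℝ) ≤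
      12656802 * c * (g ^ 5 * ε⁻¹) * l ^ 3 := by
    have h1 : ∑ k ∈ Finset.range K,
        (⌈mOne (Fintype.card S) (Fintype.card A) γ hbar μ D0 ε δ k⌉₊ : ℝ) ≤
        ∑ k ∈ Finset.range K,
          (6323200 * b * g ^ 5 * l ^ 2 * (uSeq γ hbar μ D0 k)⁻¹ + 5200 * l + 1) :=
      Finset.sum_le_sum fun k _ => hceil _ _ (hone k) (by
        have := uSeq_pos hγ1 hh μ D0 k
        positivity)
    have h2 : ∑ k ∈ Finset.range K,
        (6323200 * b * g ^ 5 * l ^ 2 * (uSeq γ hbar μ D0 k)⁻¹ + 5200 * l + 1) =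
        6323200 * b * g ^ 5 * l ^ 2 * ∑ k ∈ Finset.range K, (uSeq γ hbar μ D0 k)⁻¹ +
          K * (5200 * l + 1) := by
      simp only [Finset.sum_add_distrib, ← Finset.mul_sum, Finset.sum_const, Finset.card_range,
        nsmul_eq_mul]
      ring
    have h3 : ∑ k ∈ Finset.range K, (uSeq γ hbar μ D0 k)⁻¹ ≤ 2 * ε⁻¹ :=
      (sum_inv_uSeq_le hγ1 hh K).trans h2K
    have h4 : 6323200 * b * g ^ 5 * l ^ 2 * ∑ k ∈ Finset.range K, (uSeq γ hbar μ D0 k)⁻¹ ≤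
        12646400 * (c * (g ^ 5 * ε⁻¹) * l ^ 3) := by
      calc _ ≤ 6323200 * c * g ^ 5 * l ^ 3 * (2 * ε⁻¹) := by
            have hbc : b ≤ c := by linarith
            have hl23 : l ^ 2 ≤ l ^ 3 := pow_le_pow_right₀ hl1' (by norm_num)
            have hnn : 0 ≤ ∑ k ∈ Finset.range K, (uSeq γ hbar μ D0 k)⁻¹ :=
              Finset.sum_nonneg fun k _ => (inv_pos.2 (uSeq_pos hγ1 hh μ D0 k)).le
            gcongr
        _ = _ := by ring
    have h5 : (K : ℝ) * (5200 * l + 1) ≤ 10402 * (c * (g ^ 5 * ε⁻¹) * l ^ 3) := by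
      have h6 : 1 ≤ c * (g ^ 5 * ε⁻¹) :=
        one_le_mul_of_one_le_of_one_le hc1 (one_le_mul_of_one_le_of_one_le hg5 hε1')
      calc (K : ℝ) * (5200 * l + 1) ≤ 2 * l * (5200 * l + l) := by gcongr
        _ = 10402 * (1 * l ^ 2) := by ring
        _ ≤ 10402 * (c * (g ^ 5 * ε⁻¹) * l ^ 3) := by
            have hl23 : l ^ 2 ≤ l ^ 3 := pow_le_pow_right₀ hl1' (by norm_num)
            gcongr
    linarith
  have hsum2 : (K : ℝ) * (((T : ℝ) - 1) *
      (⌈mTwo (Fintype.card S) (Fintype.card A) γ hbar μ D0 ε δ⌉₊ : ℝ)) ≤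
      7235238 * c * (g ^ 5 * ε⁻¹) * l ^ 3 := by
    have h1 := hceil _ _ htwo (by positivity)
    have h2 : 190000 * (b + D0) * g ^ 4 * l ^ 2 + 400 * g ^ 4 * l + 1 ≤
        190401 * (c * g ^ 4 * l ^ 2) := by
      have h3 : 190000 * (b + D0) * g ^ 4 * l ^ 2 ≤ 190000 * (c * g ^ 4 * l ^ 2) := by
        have : (b + D0) * (g ^ 4 * l ^ 2) ≤ c * (g ^ 4 * l ^ 2) :=
          mul_le_mul_of_nonneg_right (by linarith) (by positivity)
        linarith
      have h4 : g ^ 4 * l ≤ c * g ^ 4 * l ^ 2 := by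
        calc g ^ 4 * l = 1 * g ^ 4 * l ^ 1 := by ring
          _ ≤ _ := by
            have hl12 : l ^ 1 ≤ l ^ 2 := pow_le_pow_right₀ hl1' (by norm_num)
            gcongr
      have h5 : 1 ≤ c * g ^ 4 * l ^ 2 :=
        one_le_mul_of_one_le_of_one_le (one_le_mul_of_one_le_of_one_le hc1 hg4) (one_le_pow₀ hl1')
      linarith
    calc (K : ℝ) * (((T : ℝ) - 1) *
          (⌈mTwo (Fintype.card S) (Fintype.card A) γ hbar μ D0 ε δ⌉₊ : ℝ))
        ≤ 2 * l * ((19 * g) * (190401 * (c * g ^ 4 * l ^ 2))) := by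
          have h3 : (T : ℝ) - 1 ≤ 19 * g := by linarith
          have h4 := h1.trans h2
          have h5 : 0 ≤ ((T : ℝ) - 1) *
              (⌈mTwo (Fintype.card S) (Fintype.card A) γ hbar μ D0 ε δ⌉₊ : ℝ) :=
            mul_nonneg (by linarith) (by positivity)
          gcongr
      _ = 7235238 * c * (g ^ 5 * 1) * l ^ 3 := by ring
      _ ≤ _ := by gcongr
  rw [Finset.sum_add_distrib, Finset.sum_const, Finset.card_range, nsmul_eq_mul, ← inv_pow, ← hg]
  have hfin : ∑ k ∈ Finset.range K,
      (⌈mOne (Fintype.card S) (Fintype.card A) γ hbar μ D0 ε δ k⌉₊ : ℝ) + (K : ℝ) *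
      (((T : ℝ) - 1) * (⌈mTwo (Fintype.card S) (Fintype.card A) γ hbar μ D0 ε δ⌉₊ : ℝ)) ≤
      20000000 * (c * (g ^ 5 * ε⁻¹) * l ^ 3) := by
    have : 0 ≤ c * (g ^ 5 * ε⁻¹) * l ^ 3 := by positivity
    linarith
  have hnn : 0 ≤ nS * nA := by positivity
  refine (mul_le_mul_of_nonneg_left hfin hnn).trans (le_of_eq ?_)
  ring

end Count

end

theorem theorem3 :
    ∃ C : ℝ, 0 < C ∧
      ∀ (S : Type*) [Fintype S] [DecidableEq S] [Nonempty S]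
        [MeasurableSpace S] [MeasurableSingletonClass S]
        (A : Type*) [Fintype A] [Nonempty A]
        (M : DMDP S A) (R : Regularizer A) (d : DistGen A) (μ D0 ε δ : ℝ),
        R.StronglyConvex d μ →
        (∀ y ∈ stdSimplex ℝ A, d.breg (uniformDist A) y ≤ D0) →
        0 < ε → δ ∈ Set.Ioo (0 : ℝ) 1 →
        -- the guarantee of the output policy, for all admissible sample sizes
        (∀ (m1 m2 : ℕ → ℕ),
          (∀ k < numEpochs M.γ R.hbar μ D0 ε,
            mOne (Fintype.card S) (Fintype.card A) M.γ R.hbar μ D0 ε δ k ≤ m1 k ∧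
            mTwo (Fintype.card S) (Fintype.card A) M.γ R.hbar μ D0 ε δ ≤ m2 k) →
          ∀ (Ω : Type*) [MeasurableSpace Ω] (ℙ : MeasureTheory.Measure Ω)
            [MeasureTheory.IsProbabilityMeasure ℙ] (X : ℕ → ℕ → S → A → ℕ → Ω → S),
            (∀ k t s a i, Measurable (X k t s a i)) →
            (∀ k t s a i s', ℙ.real {ω | X k t s a i ω = s'} = M.P s a s') →
            ProbabilityTheory.iIndepFun
              (fun j : ℕ × ℕ × S × A × ℕ => X j.1 j.2.1 j.2.2.1 j.2.2.2.1 j.2.2.2.2) ℙ →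
            1 - δ ≤ ℙ.real {ω |
              let out : S → A → ℝ :=
                svmdPolicy M R d (numIters M.γ) (fun _ t => 2 / (μ * ((t : ℝ) + 1))) m1 m2
                  (fun k t s a i => X k t s a i ω) (numEpochs M.γ R.hbar μ D0 ε)
              IsEpsOptimal M R ε out ∧
                ∀ pstar, IsOptimalPolicy M R pstar →
                  ∀ s, d.breg (out s) (pstar s) ≤ ε / (μ * (1 - M.γ))}) ∧
        -- the number of observations, for the smallest admissible sample sizes
        (ε ≤ 1 →
          (numObservations S A (numEpochs M.γ R.hbar μ D0 ε) (numIters M.γ)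
            (fun k => ⌈mOne (Fintype.card S) (Fintype.card A) M.γ R.hbar μ D0 ε δ k⌉₊)
            (fun _ => ⌈mTwo (Fintype.card S) (Fintype.card A) M.γ R.hbar μ D0 ε δ⌉₊) : ℝ) ≤
          C * ((1 + R.hbar) ^ 2 / μ + D0 + 1) *
            ((Fintype.card S : ℝ) * Fintype.card A * ((1 - M.γ) ^ 5)⁻¹ * ε⁻¹) *
            (1 + Real.log ((1 + R.hbar + μ * D0) * Fintype.card S * Fintype.card A /
              ((1 - M.γ) * ε * δ))) ^ 3) := by
  refine ⟨20000000, by norm_num, ?_⟩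
  intro S _ _ _ _ _ A _ _ M R d μ D0 ε δ hμ hD0 hε hδ
  have hD0' : 0 ≤ D0 := by
    have h := hD0 _ uniformDist_mem
    rwa [breg_self] at h
  exact ⟨fun m1 m2 hm Ω _ ν _ X hX hlaw hind =>
      one_sub_le_measure_epsOptimal hμ hD0 hε hδ hm hX hlaw hind,
    fun hε1 => numObservations_le M.γ_mem.1 M.γ_mem.2 R.hbar_nonneg hμ.1 hD0' hε hε1 hδ⟩
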